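/- Let $G=SL_2(\mathbb R)$, let $I$ be the identity matrix, and write $X^{c}=G\setminus X$ and $XY=\{xy: x\in X,\ y\in Y\}$ for $X,Y\subset G$. **Notation.** For $\varepsilon,\delta\in\{1,-1\}$, $\alpha\in\mathbb R\setminus\pi\mathbb Z$ and real $\lambda$ with $|\lambda|>1$, let $C_2^{\varepsilon\delta}$, $C_3^\alpha$, $C_4^\lambda$ be the conjugacy classes in $G$ of $$\begin{pmatrix}\varepsilon&0\\ \delta&\varepsilon\end{pmatrix},\qquad \begin{pmatrix}\cos\alpha&-\sin\alpha\\ \sin\alpha&\cos\alpha\end{pmatrix},\qquad \begin{pmatrix}\lambda&0\\ 0&\lambda^{-1}\end{pmatrix}$$ respectively (superscripts $\pm1$ are written $\pm$). For a set $j$ of angles put $C_3^{j}=\bigcup_{\alpha\in j}C_3^\alpha$, and put $C_4^+=\bigcup_{\lambda>1}C_4^\lambda$, $C_4^-=\bigcup_{\lambda<-1}C_4^\lambda$, $\overline{C_4^+}=C_4^+\cup\{I\}\cup C_2^{++}\cup C_2^{+-}$, $G^+=\overline{C_4^+}\cup C_3^{(0,\pi)}$, $$U=C_4^+\cup C_2^{++}\cup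 C_3^{(0,\pi)}\cup C_2^{-+}\cup C_4^-,\qquad L=C_4^-\cup C_2^{--}\cup C_3^{(\pi,2\pi)}\cup C_2^{+-}\cup C_4^+ .$$ A conjugacy class is called scalar if it is $\{I\}$ or $\{-I\}$. **Theorem 3.1.** Below $0<\alpha,\beta,\gamma,\delta<\pi$ and $\lambda,\mu>1$, unless stated otherwise. **(a)** The conjugacy classes contained in $G^+$ are exactly $\{I\}$, $C_2^{++}$, $C_2^{+-}$, $C_3^\alpha$ ($0<\alpha<\pi$) and $C_4^\lambda$ ($\lambda>1$). The product of conjugacy classes of $G$ is commutative, and $\{I\}C=C$ for every class $C$. Double products: * $C_2^{++}C_2^{++}=C_2^{++}\cup C_3^{(0,\pi)}\cup C_2^{-+}\cup C_4^-$; $\ C_2^{++}C_2^{+-}=\overline{C_4^+}$; $\ C_2^{+-}C_2^{+-}=C_4^-\cup C_2^{--}\cup C_3^{(\pi,2\pi)}\cup C_2^{+-}$. * $C_3^\alpha C_2^{++}=C_3^{(\alpha,\pi)}\cup C_2^{-+}\cup C_4^-$; $\ C_3^\alpha C_2^{+-}=C_4^+\cup C_2^{++}\cup C_3^{(0,\alpha)}$.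 * $C_3^\alpha C_3^\beta$ equals $C_3^{[\alpha+\beta,\pi)}\cup C_2^{-+}\cup C_4^-$ if $\alpha+\beta<\pi$; $\{-I\}\cup C_4^-$ if $\alpha+\beta=\pi$; $C_4^-\cup C_2^{--}\cup C_3^{(\pi,\alpha+\beta]}$ if $\alpha+\beta>\pi$. * $C_4^\lambda C_2^{++}=C_4^\lambda C_3^\alpha=U$; $\ C_4^\lambda C_2^{+-}=L$; $\ C_4^\lambda C_4^\lambda=\{-I\}^c$; $\ C_4^\lambda C_4^\mu=\{I,-I\}^c$ if $\lambda\ne\mu$. Triple products: * $C_2^{++}C_2^{++}C_2^{++}=C_2^{+-}C_2^{+-}C_2^{+-}=\{I\}^c$; $\ C_2^{++}C_2^{++}C_2^{+-}=(\{-I\}\cup C_2^{--}\cup C_3^{(\pi,2\pi)})^c$; $\ C_2^{++}C_2^{+-}C_2^{+-}=(\{-I\}\cup C_3^{(0,\pi)}\cup C_2^{-+})^c$. * $C_3^\alpha C_2^{++}C_2^{++}=(\{I\}\cup C_2^{++}\cup C_3^{(0,\alpha]})^c$; $\ C_3^\alpha C_2^{++}C_2^{+-}=U$; $\ C_3^\alpha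 C_2^{+-}C_2^{+-}=(\{-I\}\cup C_3^{[\alpha,\pi)}\cup C_2^{-+})^c$. * $C_3^\alpha C_3^\beta C_2^{++}$ equals $(\{I\}\cup C_2^{++}\cup C_3^{(0,\alpha+\beta]})^c$ if $\alpha+\beta<\pi$, and $L$ if $\alpha+\beta\ge\pi$. * $C_3^\alpha C_3^\beta C_2^{+-}$ equals $U$ if $\alpha+\beta\le\pi$, and $(\{I\}\cup C_3^{[\alpha+\beta,2\pi)}\cup C_2^{+-})^c$ if $\alpha+\beta>\pi$. * With $S=\alpha+\beta+\gamma$, $C_3^\alpha C_3^\beta C_3^\gamma$ equals $(\{I\}\cup C_2^{++}\cup C_3^{(0,S)})^c$ if $S<\pi$; $\{-I\}\cup L$ if $S=\pi$; $L$ if $\pi<S<2\pi$; $\{I\}\cup L$ if $S=2\pi$; $(\{-I\}\cup C_3^{(S-2\pi,\pi)}\cup C_2^{-+})^c$ if $S>2\pi$. * $C_4^\lambda C_2^{++}C_2^{++}=C_4^\lambda C_2^{+-}C_2^{+-}=C_4^\lambda C_3^\alpha C_2^{++}=C_4^\lambda C_3^\alpha C_3^\beta=\{I\}^c$; $\ C_4^\lambda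 C_2^{++}C_2^{+-}=C_4^\lambda C_3^\alpha C_2^{+-}=\{-I\}^c$; $\ C_4^\lambda C_4^\mu C=G$ for every non-scalar class $C$. Triples of elliptic classes whose product contains $I$: for $\alpha,\beta,\gamma\in(0,2\pi)\setminus\{\pi\}$, let $k$ be the number of them that exceed $\pi$ and $S=\alpha+\beta+\gamma$. Then $I\in C_3^\alpha C_3^\beta C_3^\gamma$ if and only if: $S\ge2\pi$ when $k=0$; $S\le2\pi$ when $k=1$; $S\ge4\pi$ when $k=2$; $S\le4\pi$ when $k=3$. Equivalently, for $\alpha,\beta,\gamma\in(-\pi,\pi)\setminus\{0\}$ with exactly $k$ of them negative, $I\in C_3^\alpha C_3^\beta C_3^\gamma$ if and only if: $S\ge2\pi$ when $k=0$; $S\le0$ when $k=1$; $S\ge0$ when $k=2$; $S\le-2\pi$ when $k=3$. **(b)** Quadruple products: * $C_2^{++}C_2^{++}C_2^{+-}C_2^{+-}=C_2^{++}C_2^{+-}C_2^{+-}C_3^\alpha=\{-I\}^c$. * $C_2^{++}C_2^{++}C_2^{+-}C_3^\alpha=C_2^{++}C_2^{+-}C_3^\alpha C_3^\beta=\{I\}^c$.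 * $C_2^{++}C_2^{++}C_3^\alpha C_3^\beta=\{-I\}^c$ if $\alpha+\beta\ge\pi$; $\ C_2^{+-}C_2^{+-}C_3^\alpha C_3^\beta=\{-I\}^c$ if $\alpha+\beta\le\pi$. * $C_3^\alpha C_3^\beta C_3^\gamma C_3^\delta=\{-I\}^c$ if $\pi<\alpha+\beta+\gamma+\delta<3\pi$. * $C_3^\alpha C_3^\beta C_3^\gamma C_2^{++}$ equals $G$ if $\alpha+\beta+\gamma<\pi$ and $\{-I\}^c$ if $\alpha+\beta+\gamma\ge\pi$. * $C_3^\alpha C_3^\beta C_3^\gamma C_2^{+-}$ equals $\{I\}^c$ if $\alpha+\beta+\gamma\le2\pi$ and $G$ if $\alpha+\beta+\gamma>2\pi$. * The product of any other four non-scalar conjugacy classes contained in $G^+$ (that is, four classes which do not form, in any order, one of the quadruples just listed) is $G$. **(c)** The product of any five non-scalar conjugacy classes of $G$ is $G$. -/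

import Mathlib

open Real Set
open scoped Pointwise

namespace SL2Classes

/-- The group `G = SL₂(ℝ)`. -/
abbrev SL2R : Type := Matrix.SpecialLinearGroup (Fin 2) ℝ

/-- The conjugacy class in `SL₂(ℝ)` of a matrix `M` of determinant one (empty if `det M ≠ 1`). -/
def cls (M : Matrix (Fin 2) (Fin 2) ℝ) : Set SL2R :=
  {A | ∃ B : SL2R, (B : Matrix (Fin 2) (Fin 2) ℝ) = M ∧ IsConj B A}

theorem cls_coe (B : SL2R) : cls (B : Matrix (Fin 2) (Fin 2) ℝ) = conjugatesOf B := by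
  ext A
  constructor
  · rintro ⟨B', h, hA⟩
    have : B' = B := Subtype.ext h
    subst this
    exact hA
  · intro hA
    exact ⟨B, rfl, hA⟩

/-- The class `𝔠₂^{ε,δ}`, with `ε, δ = ±1`. -/
def cl2 (ε δ : ℤˣ) : Set SL2R :=
  cls !![((ε : ℤ) : ℝ), 0; ((δ : ℤ) : ℝ), ((ε : ℤ) : ℝ)]

/-- The class `𝔠₃^α` of the rotation through the angle `α`; used for `α ∉ ℤπ`. -/
noncomputable def cl3 (α : ℝ) : Set SL2R :=
  cls !![cos α, -sin α; sin α, cos α]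

/-- The class `𝔠₄^l`, with `|l| > 1`. -/
noncomputable def cl4 (l : ℝ) : Set SL2R :=
  cls !![l, 0; 0, l⁻¹]

/-- `𝔠₃^j`, the union of the classes `𝔠₃^α` with `α ∈ j`. -/
noncomputable def cl3On (j : Set ℝ) : Set SL2R := ⋃ α ∈ j, cl3 α

/-- `𝔠₄⁺`, the union of the classes `𝔠₄^l` with `l > 1`. -/
noncomputable def cl4Pos : Set SL2R := ⋃ l ∈ Ioi (1 : ℝ), cl4 l

/-- `𝔠₄⁻`, the union of the classes `𝔠₄^l` with `l < -1`. -/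
noncomputable def cl4Neg : Set SL2R := ⋃ l ∈ Iio (-1 : ℝ), cl4 l

/-- `𝔠₄⁺ ∪ {I} ∪ 𝔠₂^{+,+} ∪ 𝔠₂^{+,-}`. -/
noncomputable def cl4PosBar : Set SL2R := cl4Pos ∪ {1} ∪ (cl2 1 1 ∪ cl2 1 (-1))

/-- The set `G⁺`. -/
noncomputable def GPlus : Set SL2R := cl4PosBar ∪ cl3On (Ioo 0 π)

/-- `𝔠₃^{⟨[0,π]⟩}`. -/
noncomputable def upperFull : Set SL2R :=
  cl4Pos ∪ cl2 1 1 ∪ cl3On (Ioo 0 π) ∪ cl2 (-1) 1 ∪ cl4Neg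

/-- `𝔠₃^{⟨[π,2π]⟩}`. -/
noncomputable def lowerFull : Set SL2R :=
  cl4Neg ∪ cl2 (-1) (-1) ∪ cl3On (Ioo π (2 * π)) ∪ cl2 1 (-1) ∪ cl4Pos

/-- `C` is a conjugacy class of `SL₂(ℝ)`. -/
def IsClass (C : Set SL2R) : Prop := ∃ A : SL2R, C = conjugatesOf A

/-- `C` is a conjugacy class of `SL₂(ℝ)` other than `{I}` and `{-I}`. -/
def IsNonscalarClass (C : Set SL2R) : Prop :=
  ∃ A : SL2R, A ≠ 1 ∧ A ≠ -1 ∧ C = conjugatesOf A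

/-- The unordered quadruples of classes whose product is listed individually: all other
quadruples of non-scalar classes contained in `G⁺` have product `G`. -/
def IsListed (m : Multiset (Set SL2R)) : Prop :=
  m = {cl2 1 1, cl2 1 1, cl2 1 (-1), cl2 1 (-1)} ∨
  (∃ α ∈ Ioo 0 π, m = {cl2 1 1, cl2 1 1, cl2 1 (-1), cl3 α}) ∨
  (∃ α ∈ Ioo 0 π, m = {cl2 1 1, cl2 1 (-1), cl2 1 (-1), cl3 α}) ∨
  (∃ α ∈ Ioo 0 π, ∃ β ∈ Ioo 0 π, m = {cl2 1 1, cl2 1 (-1), cl3 α, cl3 β}) ∨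
  (∃ α ∈ Ioo 0 π, ∃ β ∈ Ioo 0 π, π ≤ α + β ∧ m = {cl2 1 1, cl2 1 1, cl3 α, cl3 β}) ∨
  (∃ α ∈ Ioo 0 π, ∃ β ∈ Ioo 0 π, α + β ≤ π ∧ m = {cl2 1 (-1), cl2 1 (-1), cl3 α, cl3 β}) ∨
  (∃ α ∈ Ioo 0 π, ∃ β ∈ Ioo 0 π, ∃ γ ∈ Ioo 0 π, ∃ δ ∈ Ioo 0 π,
    π < α + β + γ + δ ∧ α + β + γ + δ < 3 * π ∧ m = {cl3 α, cl3 β, cl3 γ, cl3 δ}) ∨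
  (∃ α ∈ Ioo 0 π, ∃ β ∈ Ioo 0 π, ∃ γ ∈ Ioo 0 π,
    m = {cl3 α, cl3 β, cl3 γ, cl2 1 1} ∨ m = {cl3 α, cl3 β, cl3 γ, cl2 1 (-1)})

end SL2Classes

open SL2Classes

/-! Two linear coordinates control everything: the trace `tr` and the antisymmetric part `skew`.
They satisfy `4 ≤ tr g ^ 2 + skew g ^ 2`, and every pair obeying this inequality occurs. A conjugacy
class is determined by its trace together with, when the trace lies in `[-2, 2]`, the sign of `skew`
(`isConj_iff_invariants`). Membership in each set of the theorem thus becomes a condition on `tr`,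
on the sign of `skew`, and on the angle `ang`.

In a product of invariant sets the first factor may be frozen at one representative
(`mem_conjugatesOf_mul`). A rotation rotates the `(tr, skew)` plane; a lower unipotent shifts the
trace by a multiple of the upper right entry, which it preserves; a diagonal matrix leaves enough
freedom to solve for the other factor explicitly. This gives the double products. Triple products
follow by distributing over unions, pulling out signs, and checking the ten types of elements in
`trichotomies`.

For longer products, two non-scalar classes always produce a hyperbolic element
(`exists_hyperbolic`), and two hyperbolic classes produce every non-scalar matrix
(`mem_cl4_mul_cl4_of_ne`). Four non-scalar classes therefore miss at most `1` and `-1`, and whether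
they do is read off a triple product, since `1 ∈ X * D` exactly when the inverse of a representative
of `D` lies in `X`. A fifth non-scalar class absorbs the remaining scalars (`mul_eq_univ`). -/

namespace SL2Classes

/-! ### Matrix entries. -/

/-- The matrix with the given entries, as an element of `SL₂(ℝ)`. -/
def ofEntries (p q r s : ℝ) (h : p * s - q * r = 1) : SL2R :=
  ⟨!![p, q; r, s], by rw [Matrix.det_fin_two_of]; exact h⟩

section Entries
variable (p q r s : ℝ) (h : p * s - q * r = 1)

@[simp] theorem ofEntries_zero_zero : ofEntries p q r s h 0 0 = p := rfl
@[simp] theorem ofEntries_zero_one : ofEntries p q r s h 0 1 = q := rfl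
@[simp] theorem ofEntries_one_zero : ofEntries p q r s h 1 0 = r := rfl
@[simp] theorem ofEntries_one_one : ofEntries p q r s h 1 1 = s := rfl

end Entries

theorem det_entries (g : SL2R) : g 0 0 * g 1 1 - g 0 1 * g 1 0 = 1 := by
  rw [← Matrix.det_fin_two]; exact g.det_coe

theorem ext_entries {g h : SL2R} (h00 : g 0 0 = h 0 0) (h01 : g 0 1 = h 0 1)
    (h10 : g 1 0 = h 1 0) (h11 : g 1 1 = h 1 1) : g = h := by
  apply Matrix.SpecialLinearGroup.ext
  intro i j
  fin_cases i <;> fin_cases j <;> assumption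

theorem mul_zero_zero (g h : SL2R) : (g * h) 0 0 = g 0 0 * h 0 0 + g 0 1 * h 1 0 := by
  simp [Matrix.mul_apply]
theorem mul_zero_one (g h : SL2R) : (g * h) 0 1 = g 0 0 * h 0 1 + g 0 1 * h 1 1 := by
  simp [Matrix.mul_apply]
theorem mul_one_zero (g h : SL2R) : (g * h) 1 0 = g 1 0 * h 0 0 + g 1 1 * h 1 0 := by
  simp [Matrix.mul_apply]
theorem mul_one_one (g h : SL2R) : (g * h) 1 1 = g 1 0 * h 0 1 + g 1 1 * h 1 1 := by
  simp [Matrix.mul_apply]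

/-! ### The invariants `tr`, `skew` and `ang`. -/

/-- The trace of a `2 × 2` matrix. -/
def tr (g : SL2R) : ℝ := g 0 0 + g 1 1

/-- The antisymmetric part `g₂₁ - g₁₂`, whose sign tells apart classes of equal trace. -/
def skew (g : SL2R) : ℝ := g 1 0 - g 0 1

/-- The angle in `[0, π]` whose cosine is half of the trace, clipped to `[-1, 1]`. -/
noncomputable def ang (g : SL2R) : ℝ := arccos (tr g / 2)

/-- By the determinant condition, `tr g ^ 2 + skew g ^ 2 - 4` equals `(g 0 0 - g 1 1) ^ 2 + (g 0 1 +
g 1 0) ^ 2`. -/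
theorem four_le (g : SL2R) : 4 ≤ tr g ^ 2 + skew g ^ 2 := by
  have := det_entries g
  unfold tr skew
  nlinarith [sq_nonneg (g 0 0 - g 1 1), sq_nonneg (g 0 1 + g 1 0)]

theorem exists_tr_skew {t w : ℝ} (h : 4 ≤ t ^ 2 + w ^ 2) : ∃ g : SL2R, tr g = t ∧ skew g = w := by
  have hs : √((t ^ 2 + w ^ 2 - 4) / 4) ^ 2 = (t ^ 2 + w ^ 2 - 4) / 4 := sq_sqrt (by linarith)
  set u := √((t ^ 2 + w ^ 2 - 4) / 4)
  -- The off-diagonal part is purely antisymmetric, and `u` spreads the diagonal just enough to make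
  -- the determinant one.
  refine ⟨ofEntries (t / 2 + u) (-w / 2) (w / 2) (t / 2 - u) (by nlinarith), ?_, ?_⟩
  · simp [tr]
  · simp [skew]; ring

@[simp] theorem tr_one : tr 1 = 2 := by simp [tr]; norm_num
@[simp] theorem skew_one : skew 1 = 0 := by simp [skew]
@[simp] theorem tr_neg (g : SL2R) : tr (-g) = -tr g := by simp [tr]; ring
@[simp] theorem skew_neg (g : SL2R) : skew (-g) = -skew g := by simp [skew]; ring
@[simp] theorem ang_neg (g : SL2R) : ang (-g) = π - ang g := by
  simp only [ang, tr_neg, neg_div, arccos_neg]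

theorem eq_one_iff (g : SL2R) : g = 1 ↔ tr g = 2 ∧ skew g = 0 := by
  refine ⟨by rintro rfl; simp, fun ⟨ht, hw⟩ => ?_⟩
  have hd := det_entries g
  unfold tr at ht
  unfold skew at hw
  have h10 : g 1 0 = g 0 1 := by linarith
  have h11 : g 1 1 = 2 - g 0 0 := by linarith
  rw [h10, h11] at hd
  have h1 : g 0 1 = 0 := by nlinarith [sq_nonneg (g 0 0 - 1), sq_nonneg (g 0 1)]
  have h2 : g 0 0 = 1 := by nlinarith [sq_nonneg (g 0 0 - 1), sq_nonneg (g 0 1)]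
  apply ext_entries <;> simp [h10, h11, h1, h2]; norm_num

theorem eq_neg_one_iff (g : SL2R) : g = -1 ↔ tr g = -2 ∧ skew g = 0 := by
  rw [← neg_eq_iff_eq_neg, eq_one_iff]
  simp [neg_eq_iff_eq_neg]

/-! ### Classification of conjugacy classes. -/

/-- The companion matrix with positive orientation. -/
def compPos (t : ℝ) : SL2R := ofEntries 0 (-1) 1 t (by ring)

/-- The companion matrix with negative orientation. -/
def compNeg (t : ℝ) : SL2R := ofEntries 0 1 (-1) t (by ring)

theorem isConj_of_mul_eq {g h c : SL2R} (e : c * g = h * c) : IsConj g h :=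
  isConj_iff.2 ⟨c, by rw [e, mul_inv_cancel_right]⟩

/-- The quadratic form in the hypothesis is the determinant of the pair `v`, `g v` with `v = (x,
y)`. When it is positive, rescaling gives a basis of determinant one in which, by Cayley–Hamilton,
`g` is its companion matrix. For a negative value, `isConj_compNeg` uses `v`, `-g v`. -/
theorem isConj_compPos {g : SL2R} {x y : ℝ}
    (h : 0 < g 1 0 * x ^ 2 + (g 1 1 - g 0 0) * x * y - g 0 1 * y ^ 2) :
    IsConj (compPos (tr g)) g := by
  have hd := det_entries g
  set Q := g 1 0 * x ^ 2 + (g 1 1 - g 0 0) * x * y - g 0 1 * y ^ 2 with hQ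
  have hk : (√Q)⁻¹ ^ 2 * Q = 1 := by
    rw [inv_pow, sq_sqrt h.le]; exact inv_mul_cancel₀ h.ne'
  set k := (√Q)⁻¹
  refine isConj_of_mul_eq (c := ofEntries (k * x) (k * (g 0 0 * x + g 0 1 * y)) (k * y)
    (k * (g 1 0 * x + g 1 1 * y)) (by linear_combination hk - k ^ 2 * hQ)) ?_
  apply ext_entries
  · simp [mul_zero_zero, compPos]; ring
  · simp [mul_zero_one, compPos, tr]; linear_combination (k * x) * hd
  · simp [mul_one_zero, compPos]; ring
  · simp [mul_one_one, compPos, tr]; linear_combination (k * y) * hd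

theorem isConj_compNeg {g : SL2R} {x y : ℝ}
    (h : g 1 0 * x ^ 2 + (g 1 1 - g 0 0) * x * y - g 0 1 * y ^ 2 < 0) :
    IsConj (compNeg (tr g)) g := by
  have hd := det_entries g
  set Q := -(g 1 0 * x ^ 2 + (g 1 1 - g 0 0) * x * y - g 0 1 * y ^ 2) with hQ
  have h : 0 < Q := by linarith
  have hk : (√Q)⁻¹ ^ 2 * Q = 1 := by
    rw [inv_pow, sq_sqrt h.le]; exact inv_mul_cancel₀ h.ne'
  set k := (√Q)⁻¹
  refine isConj_of_mul_eq (c := ofEntries (k * x) (-k * (g 0 0 * x + g 0 1 * y)) (k * y)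
    (-k * (g 1 0 * x + g 1 1 * y)) (by linear_combination hk - k ^ 2 * hQ)) ?_
  apply ext_entries
  · simp [mul_zero_zero, compNeg]; ring
  · simp [mul_zero_one, compNeg, tr]; linear_combination (-k * x) * hd
  · simp [mul_one_zero, compNeg]; ring
  · simp [mul_one_one, compNeg, tr]; linear_combination (-k * y) * hd

/-- `skew g` is the sum of the values of the quadratic form at the two standard basis vectors, so
one of them is positive. -/
theorem isConj_compPos_of_skew_pos {g : SL2R} (h : 0 < skew g) : IsConj (compPos (tr g)) g := by
  unfold skew at h
  rcases lt_or_ge 0 (g 1 0) with hc | hc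
  · exact isConj_compPos (x := 1) (y := 0) (by linarith)
  · exact isConj_compPos (x := 0) (y := 1) (by linarith)

theorem isConj_compNeg_of_skew_neg {g : SL2R} (h : skew g < 0) : IsConj (compNeg (tr g)) g := by
  unfold skew at h
  rcases lt_or_ge (g 1 0) 0 with hc | hc
  · exact isConj_compNeg (x := 1) (y := 0) (by linarith)
  · exact isConj_compNeg (x := 0) (y := 1) (by linarith)

/-- The discriminant of the form is `tr g ^ 2 - 4`. When this is positive the form is indefinite,
hence positive somewhere, whatever the sign of `skew g`. -/
theorem isConj_compPos_of_hyperbolic {g : SL2R} (h : 4 < tr g ^ 2) :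
    IsConj (compPos (tr g)) g := by
  have hd := det_entries g
  have hD : 0 < (g 1 1 - g 0 0) ^ 2 + 4 * g 0 1 * g 1 0 := by unfold tr at h; nlinarith
  rcases lt_trichotomy (g 1 0) 0 with hc | hc | hc
  -- The vertex of the downward parabola obtained by setting `y = 1`.
  · refine isConj_compPos (x := (g 1 1 - g 0 0) / (-2 * g 1 0)) (y := 1) ?_
    have : g 1 0 * ((g 1 1 - g 0 0) / (-2 * g 1 0)) ^ 2
        + (g 1 1 - g 0 0) * ((g 1 1 - g 0 0) / (-2 * g 1 0)) * 1 - g 0 1 * 1 ^ 2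
        = ((g 1 1 - g 0 0) ^ 2 + 4 * g 0 1 * g 1 0) / (-4 * g 1 0) := by
      have := hc.ne
      field_simp; ring
    rw [this]
    exact div_pos hD (by linarith)
  · rw [hc] at hD
    have hne : g 1 1 - g 0 0 ≠ 0 := by intro h0; rw [h0] at hD; simp at hD
    -- With `g 1 0 = 0` the form is affine in `x` at `y = 1`; this `x` makes its value `1`.
    refine isConj_compPos (x := (g 0 1 + 1) / (g 1 1 - g 0 0)) (y := 1) ?_
    have : g 1 0 * ((g 0 1 + 1) / (g 1 1 - g 0 0)) ^ 2
        + (g 1 1 - g 0 0) * ((g 0 1 + 1) / (g 1 1 - g 0 0)) * 1 - g 0 1 * 1 ^ 2 = 1 := by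
      rw [hc]; field_simp; ring
    rw [this]; exact one_pos
  · exact isConj_compPos (x := 1) (y := 0) (by linarith)

theorem tr_eq_of_isConj {g h : SL2R} (hc : IsConj g h) : tr g = tr h := by
  obtain ⟨c, rfl⟩ := isConj_iff.1 hc
  have e (x : SL2R) : tr x = Matrix.trace (x : Matrix (Fin 2) (Fin 2) ℝ) := by
    simp [tr, Matrix.trace_fin_two]
  have comm (x y : SL2R) : tr (x * y) = tr (y * x) := by
    rw [e, e, Matrix.SpecialLinearGroup.coe_mul, Matrix.SpecialLinearGroup.coe_mul,
      Matrix.trace_mul_comm]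
  rw [comm, ← mul_assoc, inv_mul_cancel, one_mul]

/-- For trace in `[-2, 2]` the form is semidefinite, and `skew` of a conjugate is again a sum of two
of its values, taken at the columns of the inverse of the conjugator up to sign. -/
theorem skew_nonneg_of_isConj {g h : SL2R} (hc : IsConj g h) (ht : tr g ^ 2 ≤ 4)
    (hw : 0 ≤ skew g) : 0 ≤ skew h := by
  obtain ⟨c, rfl⟩ := isConj_iff.1 hc
  have hd := det_entries g
  have hD : (g 1 1 - g 0 0) ^ 2 + 4 * g 0 1 * g 1 0 ≤ 0 := by unfold tr at ht; nlinarith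
  have hp : 0 ≤ g 1 0 ∧ g 0 1 ≤ 0 := by
    unfold skew at hw
    constructor <;> by_contra hcon <;> push Not at hcon <;>
      nlinarith [sq_nonneg (g 1 1 - g 0 0)]
  have key (x y : ℝ) : 0 ≤ g 1 0 * x ^ 2 + (g 1 1 - g 0 0) * x * y - g 0 1 * y ^ 2 := by
    rcases hp.1.eq_or_lt with h0 | h0
    · rw [← h0] at hD ⊢
      have : g 1 1 - g 0 0 = 0 := by nlinarith
      rw [this]; nlinarith [sq_nonneg y]
    · have : 0 ≤ 4 * g 1 0 *
          (g 1 0 * x ^ 2 + (g 1 1 - g 0 0) * x * y - g 0 1 * y ^ 2) := by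
        nlinarith [sq_nonneg (2 * g 1 0 * x + (g 1 1 - g 0 0) * y), sq_nonneg y,
          mul_nonneg (neg_nonneg.2 hD) (sq_nonneg y)]
      exact nonneg_of_mul_nonneg_right this (by linarith)
  have e : skew (c * g * c⁻¹) = (g 1 0 * c 1 1 ^ 2 + (g 1 1 - g 0 0) * c 1 1 * (-c 1 0)
      - g 0 1 * (-c 1 0) ^ 2) + (g 1 0 * c 0 1 ^ 2 + (g 1 1 - g 0 0) * c 0 1 * (-c 0 0)
      - g 0 1 * (-c 0 0) ^ 2) := by
    have i00 : c⁻¹ 0 0 = c 1 1 := by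
      simp [Matrix.SpecialLinearGroup.coe_inv, Matrix.adjugate_fin_two]
    have i01 : c⁻¹ 0 1 = -c 0 1 := by
      simp [Matrix.SpecialLinearGroup.coe_inv, Matrix.adjugate_fin_two]
    have i10 : c⁻¹ 1 0 = -c 1 0 := by
      simp [Matrix.SpecialLinearGroup.coe_inv, Matrix.adjugate_fin_two]
    have i11 : c⁻¹ 1 1 = c 0 0 := by
      simp [Matrix.SpecialLinearGroup.coe_inv, Matrix.adjugate_fin_two]
    simp only [skew, mul_one_zero, mul_zero_one, mul_zero_zero, mul_one_one, i00, i01, i10, i11]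
    ring
  rw [e]
  exact add_nonneg (key _ _) (key _ _)

theorem skew_pos_of_isConj {g h : SL2R} (hc : IsConj g h) (ht : tr g ^ 2 ≤ 4)
    (hw : 0 < skew g) : 0 < skew h := by
  refine (skew_nonneg_of_isConj hc ht hw.le).lt_of_ne' fun h0 => ?_
  have he := tr_eq_of_isConj hc
  have h4 := four_le h
  have ht2 : tr g ^ 2 = 4 := by rw [h0, ← he] at h4; nlinarith
  -- If `skew h` vanished, the trace would be `2` or `-2`; weak preservation applied to `-h` and
  -- `-g` then contradicts `0 < skew g`.
  have hh := skew_nonneg_of_isConj (g := -h) (h := -g)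
    (by obtain ⟨c, rfl⟩ := isConj_iff.1 hc.symm; exact isConj_iff.2 ⟨c, by simp⟩)
    (by rw [tr_neg, ← he]; linarith [neg_sq (tr g)]) (by simp [h0])
  rw [skew_neg] at hh
  linarith

theorem isConj_neg {g h : SL2R} (hc : IsConj g h) : IsConj (-g) (-h) := by
  obtain ⟨c, rfl⟩ := isConj_iff.1 hc
  exact isConj_iff.2 ⟨c, by simp⟩

theorem skew_neg_of_isConj {g h : SL2R} (hc : IsConj g h) (ht : tr g ^ 2 ≤ 4)
    (hw : skew g < 0) : skew h < 0 := by
  have := skew_pos_of_isConj (isConj_neg hc) (by simpa using ht) (by simpa using hw)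
  simpa using this

/-- The classification of conjugacy classes of `SL₂(ℝ)`. -/
theorem isConj_iff_invariants {g h : SL2R} :
    IsConj g h ↔ tr g = tr h ∧ (-2 ≤ tr g → tr g ≤ 2 → SignType.sign (skew g) =
      SignType.sign (skew h)) := by
  constructor
  · intro hc
    refine ⟨tr_eq_of_isConj hc, fun h1 h2 => ?_⟩
    have ht : tr g ^ 2 ≤ 4 := by nlinarith
    rcases lt_trichotomy (skew g) 0 with hw | hw | hw
    · rw [sign_neg hw, sign_neg (skew_neg_of_isConj hc ht hw)]
    · rcases lt_trichotomy (skew h) 0 with hw' | hw' | hw'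
      · have := skew_neg_of_isConj hc.symm (by rwa [← tr_eq_of_isConj hc]) hw'
        linarith
      · rw [hw, hw']
      · have := skew_pos_of_isConj hc.symm (by rwa [← tr_eq_of_isConj hc]) hw'
        linarith
    · rw [sign_pos hw, sign_pos (skew_pos_of_isConj hc ht hw)]
  · rintro ⟨ht, hs⟩
    by_cases h4 : 4 < tr g ^ 2
    · have h1 := isConj_compPos_of_hyperbolic h4
      rw [ht] at h1 h4
      exact h1.symm.trans (isConj_compPos_of_hyperbolic h4)
    · have hs := hs (by nlinarith) (by nlinarith)
      rcases lt_trichotomy (skew g) 0 with hw | hw | hw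
      · rw [sign_neg hw, eq_comm, sign_eq_neg_one_iff] at hs
        have h1 := isConj_compNeg_of_skew_neg hw
        rw [ht] at h1
        exact h1.symm.trans (isConj_compNeg_of_skew_neg hs)
      · rw [hw, _root_.sign_zero, eq_comm, _root_.sign_eq_zero_iff] at hs
        have h5 := four_le g
        -- With `skew` zero, `four_le` leaves no room inside `(-2, 2)`, so both elements are the
        -- same scalar matrix.
        have : (tr g - 2) * (tr g + 2) = 0 := by rw [hw] at h5; nlinarith
        rcases mul_eq_zero.1 this with h6 | h6
        · rw [(eq_one_iff g).2 ⟨by linarith, hw⟩, (eq_one_iff h).2 ⟨by linarith, hs⟩]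
        · rw [(eq_neg_one_iff g).2 ⟨by linarith, hw⟩, (eq_neg_one_iff h).2 ⟨by linarith, hs⟩]
      · rw [sign_pos hw, eq_comm, sign_eq_one_iff] at hs
        have h1 := isConj_compPos_of_skew_pos hw
        rw [ht] at h1
        exact h1.symm.trans (isConj_compPos_of_skew_pos hs)

/-! ### Angles and the ten types of elements. -/

/-- Cosine is decreasing on `[0, π]`. Clipping does no harm: a trace at most `-2` gives the angle
`π`, which exceeds every `α < π`. -/
theorem lt_ang_iff {g : SL2R} {α : ℝ} (h0 : 0 ≤ α) (h1 : α < π) :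
    α < ang g ↔ tr g < 2 * cos α := by
  have hα : arccos (cos α) = α := arccos_cos h0 h1.le
  constructor
  · intro h
    by_contra hcon
    have := antitone_arccos (show cos α ≤ tr g / 2 by linarith)
    rw [hα] at this
    exact absurd h (not_lt.2 this)
  · intro h
    rcases lt_or_ge (tr g / 2) (-1) with h2 | h2
    · rwa [ang, arccos_of_le_neg_one h2.le]
    · exact hα.symm.trans_lt (arccos_lt_arccos h2 (by linarith) (cos_le_one α))

theorem ang_lt_iff {g : SL2R} {α : ℝ} (h0 : 0 < α) (h1 : α ≤ π) :
    ang g < α ↔ 2 * cos α < tr g := by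
  have := lt_ang_iff (g := -g) (α := π - α) (by linarith) (by linarith)
  rw [ang_neg, tr_neg, cos_pi_sub] at this
  constructor
  · intro h
    linarith [this.1 (by linarith)]
  · intro h
    linarith [this.2 (by linarith)]

theorem ang_eq_iff {g : SL2R} {α : ℝ} (h0 : 0 < α) (h1 : α < π) :
    ang g = α ↔ tr g = 2 * cos α := by
  have h2 := lt_ang_iff (g := g) h0.le h1
  have h3 := ang_lt_iff (g := g) h0 h1.le
  constructor
  · intro h
    rw [h] at h2 h3
    exact le_antisymm (not_lt.1 (mt h3.2 (lt_irrefl _))) (not_lt.1 (mt h2.2 (lt_irrefl _)))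
  · intro h
    rw [h] at h2 h3
    exact le_antisymm (not_lt.1 (mt h2.1 (lt_irrefl _))) (not_lt.1 (mt h3.1 (lt_irrefl _)))

/-- The ten types of elements of `SL₂(ℝ)`. -/
theorem trichotomies (g : SL2R) :
    (tr g = 2 ∧ ang g = 0 ∧ skew g = 0) ∨ (tr g = 2 ∧ ang g = 0 ∧ 0 < skew g) ∨
    (tr g = 2 ∧ ang g = 0 ∧ skew g < 0) ∨
    (tr g = -2 ∧ ang g = π ∧ skew g = 0) ∨ (tr g = -2 ∧ ang g = π ∧ 0 < skew g) ∨
    (tr g = -2 ∧ ang g = π ∧ skew g < 0) ∨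
    (2 < tr g ∧ ang g = 0) ∨ (tr g < -2 ∧ ang g = π) ∨
    (-2 < tr g ∧ tr g < 2 ∧ 0 < ang g ∧ ang g < π ∧ 0 < skew g) ∨
    (-2 < tr g ∧ tr g < 2 ∧ 0 < ang g ∧ ang g < π ∧ skew g < 0) := by
  have h0 : 2 ≤ tr g → ang g = 0 := fun h => arccos_of_one_le (by linarith)
  have h1 : tr g ≤ -2 → ang g = π := fun h => arccos_of_le_neg_one (by linarith)
  have h2 : tr g < 2 → 0 < ang g := fun h => arccos_pos.2 (by linarith)
  have h3 : -2 < tr g → ang g < π := fun h => (ang_lt_iff pi_pos le_rfl).2 (by simpa using h)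
  have h4 := four_le g
  rcases lt_trichotomy (tr g) 2 with h | h | h
  · rcases lt_trichotomy (tr g) (-2) with h' | h' | h'
    · simp [h', h1 h'.le]
    · rcases lt_trichotomy (skew g) 0 with h5 | h5 | h5 <;> simp [h', h1 h'.le, h5]
    · rcases lt_trichotomy (skew g) 0 with h5 | h5 | h5
      · simp [h, h', h2 h, h3 h', h5]
      · rw [h5] at h4; nlinarith
      · simp [h, h', h2 h, h3 h', h5]
  · rcases lt_trichotomy (skew g) 0 with h5 | h5 | h5 <;> simp [h, h0 h.ge, h5]
  · simp [h, h0 h.le]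

/-! ### The conjugacy classes in terms of the invariants. -/

/-- A set is invariant under conjugation. -/
def ConjInv (X : Set SL2R) : Prop := ∀ ⦃x y : SL2R⦄, IsConj x y → x ∈ X → y ∈ X

theorem mem_conjugatesOf {A g : SL2R} : g ∈ conjugatesOf A ↔ IsConj A g := Iff.rfl

theorem conjInv_conjugatesOf (A : SL2R) : ConjInv (conjugatesOf A) :=
  fun _ _ hxy hx => IsConj.trans hx hxy

theorem conjInv_cls (M : Matrix (Fin 2) (Fin 2) ℝ) : ConjInv (cls M) := by
  rintro x y hxy ⟨B, hB, hx⟩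
  exact ⟨B, hB, hx.trans hxy⟩

/-- Conjugating both factors simultaneously brings the first one to `A`, and the invariance of `D`
keeps the second in `D`. -/
theorem mem_conjugatesOf_mul {A g : SL2R} {D : Set SL2R} (hD : ConjInv D) :
    g ∈ conjugatesOf A * D ↔ ∃ B ∈ D, IsConj (A * B) g := by
  constructor
  · rintro ⟨x, hx, y, hy, rfl⟩
    obtain ⟨c, rfl⟩ := isConj_iff.1 (mem_conjugatesOf.1 hx)
    refine ⟨c⁻¹ * y * c, hD (isConj_iff.2 ⟨c⁻¹, by simp⟩) hy, isConj_iff.2 ⟨c, ?_⟩⟩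
    group
  · rintro ⟨B, hB, hc⟩
    obtain ⟨c, rfl⟩ := isConj_iff.1 hc
    refine ⟨c * A * c⁻¹, isConj_iff.2 ⟨c, rfl⟩, c * B * c⁻¹, hD (isConj_iff.2 ⟨c, rfl⟩) hB, ?_⟩
    simp only
    group

/-- The rotation through `α`. -/
noncomputable def rot (α : ℝ) : SL2R :=
  ofEntries (cos α) (-sin α) (sin α) (cos α) (by nlinarith [sin_sq_add_cos_sq α])

/-- The lower triangular unipotent matrix. -/
def lowerUnip (x : ℝ) : SL2R := ofEntries 1 0 x 1 (by ring)

/-- The diagonal matrix with entries `l` and `l⁻¹`. -/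
noncomputable def diag (l : ℝ) (hl : l ≠ 0) : SL2R := ofEntries l 0 0 l⁻¹ (by simp [hl])

theorem cl3_eq (α : ℝ) : cl3 α = conjugatesOf (rot α) := cls_coe (rot α)

theorem cl4_eq {l : ℝ} (hl : l ≠ 0) : cl4 l = conjugatesOf (diag l hl) := cls_coe (diag l hl)

theorem cl2_one_eq (δ : ℤˣ) : cl2 1 δ = conjugatesOf (lowerUnip ((δ : ℤ) : ℝ)) := by
  rw [← cls_coe]; simp [cl2, lowerUnip, ofEntries]

theorem neg_conjugatesOf (A : SL2R) : -conjugatesOf A = conjugatesOf (-A) := by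
  ext g
  rw [Set.mem_neg, mem_conjugatesOf, mem_conjugatesOf]
  exact ⟨fun h => by simpa using isConj_neg h, fun h => by simpa using isConj_neg h⟩

/-- Negation changes the sign of the off-diagonal entry as well, hence the `-δ`. -/
theorem cl2_neg_one_eq (δ : ℤˣ) : cl2 (-1) δ = -cl2 1 (-δ) := by
  rw [cl2_one_eq, neg_conjugatesOf, ← cls_coe, cl2]
  rw [Matrix.SpecialLinearGroup.coe_neg]
  congr 1
  ext i j
  fin_cases i <;> fin_cases j <;> simp [lowerUnip, ofEntries]

theorem cl3_add_pi (α : ℝ) : cl3 (α + π) = -cl3 α := by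
  rw [cl3_eq, cl3_eq, neg_conjugatesOf]
  congr 1
  apply ext_entries <;> simp [rot]

theorem cl3_add_two_pi (α : ℝ) : cl3 (α + 2 * π) = cl3 α := by
  unfold cl3; rw [cos_add_two_pi, sin_add_two_pi]

theorem cl4_neg {l : ℝ} (hl : l ≠ 0) : cl4 (-l) = -cl4 l := by
  rw [cl4_eq hl, cl4_eq (neg_ne_zero.2 hl), neg_conjugatesOf]
  congr 1
  apply ext_entries <;> simp [diag, inv_neg]

theorem mem_cl2_one_one {g : SL2R} : g ∈ cl2 1 1 ↔ tr g = 2 ∧ 0 < skew g := by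
  rw [cl2_one_eq, mem_conjugatesOf, isConj_iff_invariants]
  have e1 : tr (lowerUnip (((1 : ℤˣ) : ℤ) : ℝ)) = 2 := by simp [lowerUnip, tr]; norm_num
  have e2 : skew (lowerUnip (((1 : ℤˣ) : ℤ) : ℝ)) = 1 := by simp [lowerUnip, skew]
  rw [e1, e2, eq_comm (a := (2 : ℝ)), sign_pos one_pos, eq_comm (a := (1 : SignType)),
    sign_eq_one_iff]
  simp

theorem mem_cl2_one_neg_one {g : SL2R} : g ∈ cl2 1 (-1) ↔ tr g = 2 ∧ skew g < 0 := by
  rw [cl2_one_eq, mem_conjugatesOf, isConj_iff_invariants]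
  have e1 : tr (lowerUnip (((-1 : ℤˣ) : ℤ) : ℝ)) = 2 := by simp [lowerUnip, tr]; norm_num
  have e2 : skew (lowerUnip (((-1 : ℤˣ) : ℤ) : ℝ)) = -1 := by simp [lowerUnip, skew]
  rw [e1, e2, eq_comm (a := (2 : ℝ)), sign_neg neg_one_lt_zero, eq_comm (a := (-1 : SignType)),
    sign_eq_neg_one_iff]
  simp

theorem mem_cl2_neg_one_one {g : SL2R} : g ∈ cl2 (-1) 1 ↔ tr g = -2 ∧ 0 < skew g := by
  rw [cl2_neg_one_eq, Set.mem_neg, mem_cl2_one_neg_one]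
  simp [neg_eq_iff_eq_neg]

theorem mem_cl2_neg_one_neg_one {g : SL2R} : g ∈ cl2 (-1) (-1) ↔ tr g = -2 ∧ skew g < 0 := by
  rw [cl2_neg_one_eq, Set.mem_neg, neg_neg, mem_cl2_one_one]
  simp [neg_eq_iff_eq_neg]

theorem mem_cl3 {g : SL2R} {α : ℝ} (h0 : 0 < α) (h1 : α < π) :
    g ∈ cl3 α ↔ ang g = α ∧ 0 < skew g := by
  have hs := sin_pos_of_pos_of_lt_pi h0 h1
  rw [ang_eq_iff h0 h1, cl3_eq, mem_conjugatesOf, isConj_iff_invariants]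
  have e1 : tr (rot α) = 2 * cos α := by simp [rot, tr]; ring
  have e2 : skew (rot α) = 2 * sin α := by simp [rot, skew]; ring
  rw [e1, e2, eq_comm (a := 2 * cos α), sign_pos (by linarith), eq_comm (a := (1 : SignType)),
    sign_eq_one_iff]
  have := neg_one_le_cos α
  have := cos_le_one α
  exact and_congr_right fun _ =>
    ⟨fun h => h (by linarith) (by linarith), fun h _ _ => h⟩

/-- A rotation through more than `π` is minus the rotation through `α - π`. As `ang` ranges in `[0,
π]`, it sees the reflected angle `2 * π - α`, and `skew` carries the orientation. -/
theorem mem_cl3_lower {g : SL2R} {α : ℝ} (h0 : π < α) (h1 : α < 2 * π) :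
    g ∈ cl3 α ↔ ang g = 2 * π - α ∧ skew g < 0 := by
  have := cl3_add_pi (α - π)
  rw [sub_add_cancel] at this
  rw [this, Set.mem_neg, mem_cl3 (by linarith) (by linarith), ang_neg, skew_neg, neg_pos]
  exact and_congr_left fun _ => ⟨fun h => by linarith, fun h => by linarith⟩

theorem two_lt_add_inv {l : ℝ} (hl : 1 < l) : 2 < l + l⁻¹ := by
  have : l + l⁻¹ - 2 = (l - 1) ^ 2 / l := by field_simp; ring
  have : 0 < (l - 1) ^ 2 / l := div_pos (pow_pos (by linarith) 2) (by linarith)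
  linarith

theorem mem_cl4 {g : SL2R} {l : ℝ} (hl : 1 < l) : g ∈ cl4 l ↔ tr g = l + l⁻¹ := by
  have h2 := two_lt_add_inv hl
  rw [cl4_eq (by linarith : l ≠ 0), mem_conjugatesOf, isConj_iff_invariants]
  have e1 : tr (diag l (by linarith)) = l + l⁻¹ := by simp [diag, tr]
  rw [e1, eq_comm]
  exact and_iff_left fun _ _ => by linarith

theorem exists_add_inv_eq {t : ℝ} (ht : 2 < t) : ∃ l, 1 < l ∧ l + l⁻¹ = t := by
  have hs : √(t ^ 2 - 4) ^ 2 = t ^ 2 - 4 := sq_sqrt (by nlinarith)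
  have h0 := sqrt_nonneg (t ^ 2 - 4)
  set s := √(t ^ 2 - 4)
  -- The larger root of `l ^ 2 - t * l + 1`.
  refine ⟨(t + s) / 2, by linarith, ?_⟩
  have : t + s ≠ 0 := by linarith
  field_simp
  nlinarith

theorem mem_cl4Pos {g : SL2R} : g ∈ cl4Pos ↔ 2 < tr g := by
  simp only [cl4Pos, mem_iUnion, mem_Ioi, exists_prop]
  constructor
  · rintro ⟨l, hl, hg⟩
    rw [(mem_cl4 hl).1 hg]
    exact two_lt_add_inv hl
  · intro h
    obtain ⟨l, hl, e⟩ := exists_add_inv_eq h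
    exact ⟨l, hl, (mem_cl4 hl).2 e.symm⟩

theorem cl4Neg_eq : cl4Neg = -cl4Pos := by
  ext g
  simp only [cl4Neg, cl4Pos, Set.mem_neg, mem_iUnion, mem_Ioi, mem_Iio, exists_prop]
  constructor
  · rintro ⟨l, hl, hg⟩
    refine ⟨-l, by linarith, ?_⟩
    rwa [cl4_neg (by linarith), Set.mem_neg, neg_neg]
  · rintro ⟨l, hl, hg⟩
    refine ⟨-l, by linarith, ?_⟩
    rwa [cl4_neg (by linarith), Set.mem_neg]

theorem mem_cl4Neg {g : SL2R} : g ∈ cl4Neg ↔ tr g < -2 := by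
  rw [cl4Neg_eq, Set.mem_neg, mem_cl4Pos, tr_neg]
  exact lt_neg

theorem mem_cl3On {g : SL2R} {j : Set ℝ} (hj : j ⊆ Ioo 0 π) :
    g ∈ cl3On j ↔ ang g ∈ j ∧ 0 < skew g := by
  simp only [cl3On, mem_iUnion, exists_prop]
  constructor
  · rintro ⟨θ, hθ, hg⟩
    rw [mem_cl3 (hj hθ).1 (hj hθ).2] at hg
    rw [hg.1]
    exact ⟨hθ, hg.2⟩
  · rintro ⟨h1, h2⟩
    exact ⟨_, h1, (mem_cl3 (hj h1).1 (hj h1).2).2 ⟨rfl, h2⟩⟩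

theorem mem_cl3On_lower {g : SL2R} {j : Set ℝ} (hj : j ⊆ Ioo π (2 * π)) :
    g ∈ cl3On j ↔ 2 * π - ang g ∈ j ∧ skew g < 0 := by
  simp only [cl3On, mem_iUnion, exists_prop]
  constructor
  · rintro ⟨θ, hθ, hg⟩
    rw [mem_cl3_lower (hj hθ).1 (hj hθ).2] at hg
    rw [hg.1, sub_sub_cancel]
    exact ⟨hθ, hg.2⟩
  · rintro ⟨h1, h2⟩
    exact ⟨_, h1, (mem_cl3_lower (hj h1).1 (hj h1).2).2 ⟨by ring, h2⟩⟩

section Intervals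
variable {g : SL2R} {x y : ℝ}

theorem mem_cl3On_Ioo (hx : 0 ≤ x) (hy : y ≤ π) :
    g ∈ cl3On (Ioo x y) ↔ (x < ang g ∧ ang g < y) ∧ 0 < skew g :=
  mem_cl3On fun _ h => ⟨hx.trans_lt h.1, h.2.trans_le hy⟩

theorem mem_cl3On_Ico (hx : 0 < x) (hy : y ≤ π) :
    g ∈ cl3On (Ico x y) ↔ (x ≤ ang g ∧ ang g < y) ∧ 0 < skew g :=
  mem_cl3On fun _ h => ⟨hx.trans_le h.1, h.2.trans_le hy⟩

theorem mem_cl3On_Ioc (hx : 0 ≤ x) (hy : y < π) :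
    g ∈ cl3On (Ioc x y) ↔ (x < ang g ∧ ang g ≤ y) ∧ 0 < skew g :=
  mem_cl3On fun _ h => ⟨hx.trans_lt h.1, h.2.trans_lt hy⟩

theorem mem_cl3On_Ioo_lower (hx : π ≤ x) (hy : y ≤ 2 * π) :
    g ∈ cl3On (Ioo x y) ↔ (x < 2 * π - ang g ∧ 2 * π - ang g < y) ∧ skew g < 0 :=
  mem_cl3On_lower fun _ h => ⟨hx.trans_lt h.1, h.2.trans_le hy⟩

theorem mem_cl3On_Ico_lower (hx : π < x) (hy : y ≤ 2 * π) :
    g ∈ cl3On (Ico x y) ↔ (x ≤ 2 * π - ang g ∧ 2 * π - ang g < y) ∧ skew g < 0 :=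
  mem_cl3On_lower fun _ h => ⟨hx.trans_le h.1, h.2.trans_le hy⟩

theorem mem_cl3On_Ioc_lower (hx : π ≤ x) (hy : y < 2 * π) :
    g ∈ cl3On (Ioc x y) ↔ (x < 2 * π - ang g ∧ 2 * π - ang g ≤ y) ∧ skew g < 0 :=
  mem_cl3On_lower fun _ h => ⟨hx.trans_lt h.1, h.2.trans_lt hy⟩

end Intervals

theorem ConjInv.mul_comm {C : Set SL2R} (hC : ConjInv C) (D : Set SL2R) : C * D = D * C := by
  ext g
  constructor
  · rintro ⟨x, hx, y, hy, rfl⟩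
    exact ⟨y, hy, y⁻¹ * x * y, hC (isConj_iff.2 ⟨y⁻¹, by simp⟩) hx, by simp [mul_assoc]⟩
  · rintro ⟨y, hy, x, hx, rfl⟩
    exact ⟨y * x * y⁻¹, hC (isConj_iff.2 ⟨y, rfl⟩) hx, y, hy, by simp [mul_assoc]⟩

theorem conjInv_cl2 (ε δ : ℤˣ) : ConjInv (cl2 ε δ) := conjInv_cls _
theorem conjInv_cl3 (α : ℝ) : ConjInv (cl3 α) := conjInv_cls _
theorem conjInv_cl4 (l : ℝ) : ConjInv (cl4 l) := conjInv_cls _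

theorem inv_entries (g : SL2R) :
    g⁻¹ 0 0 = g 1 1 ∧ g⁻¹ 0 1 = -g 0 1 ∧ g⁻¹ 1 0 = -g 1 0 ∧ g⁻¹ 1 1 = g 0 0 := by
  simp [Matrix.SpecialLinearGroup.coe_inv, Matrix.adjugate_fin_two]

@[simp] theorem tr_inv (g : SL2R) : tr g⁻¹ = tr g := by
  obtain ⟨h1, h2, h3, h4⟩ := inv_entries g
  rw [tr, h1, h4, tr, add_comm]

@[simp] theorem skew_inv (g : SL2R) : skew g⁻¹ = -skew g := by
  obtain ⟨h1, h2, h3, h4⟩ := inv_entries g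
  rw [skew, h2, h3, skew]; ring

@[simp] theorem ang_inv (g : SL2R) : ang g⁻¹ = ang g := by
  rw [ang, tr_inv, ang]

/-! ### Products with an elliptic class. -/

/-- Left multiplication by a rotation rotates the plane of the pairs `(tr, skew)`. -/
theorem mem_cl3_mul {α : ℝ} (h0 : 0 < α) (h1 : α < π) {D : Set SL2R} (hD : ConjInv D) {g : SL2R} :
    g ∈ cl3 α * D ↔ ∃ B ∈ D, sin α * skew B = cos α * tr B - tr g ∧
      (-2 ≤ tr g → tr g ≤ 2 →
        SignType.sign (skew g) = SignType.sign (tr B - tr g * cos α)) := by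
  have hs := sin_pos_of_pos_of_lt_pi h0 h1
  rw [cl3_eq, mem_conjugatesOf_mul hD]
  refine exists_congr fun B => and_congr_right fun _ => ?_
  have e1 : tr (rot α * B) = cos α * tr B - sin α * skew B := by
    simp only [tr, skew, mul_zero_zero, mul_one_one, rot, ofEntries_zero_zero, ofEntries_zero_one,
      ofEntries_one_zero, ofEntries_one_one]
    ring
  have e2 : skew (rot α * B) = sin α * tr B + cos α * skew B := by
    simp only [tr, skew, mul_zero_one, mul_one_zero, rot, ofEntries_zero_zero, ofEntries_zero_one,
      ofEntries_one_zero, ofEntries_one_one]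
    ring
  rw [isConj_iff_invariants, e1]
  have h : cos α * tr B - sin α * skew B = tr g ↔ sin α * skew B = cos α * tr B - tr g :=
    ⟨fun h => by linarith, fun h => by linarith⟩
  rw [h]
  refine and_congr_right fun h2 => ?_
  have e3 : SignType.sign (skew (rot α * B)) = SignType.sign (tr B - tr g * cos α) := by
    -- Eliminating `skew B` between the two rotation formulas expresses the new `skew` through
    -- traces alone.
    have : tr B - tr g * cos α = sin α * skew (rot α * B) := by
      rw [e2]; linear_combination (-cos α) * h2 - tr B * sin_sq_add_cos_sq α
    rw [this, sign_mul, sign_pos hs, one_mul]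
  rw [e3, ← h.2 h2, eq_comm (a := SignType.sign (skew g))]

section Rotation
variable {α : ℝ} {g : SL2R}

/-- It makes `tr B - tr g * cos α` positive whenever `2 ≤ tr B`, which fixes the orientation of
products of an elliptic class with a unipotent or hyperbolic one. -/
theorem abs_mul_cos_lt (h0 : 0 < α) (h1 : α < π) {t : ℝ} (h2 : -2 ≤ t) (h3 : t ≤ 2) :
    t * cos α < 2 := by
  have hc1 : cos α < 1 := by
    simpa using cos_lt_cos_of_nonneg_of_le_pi le_rfl h1.le h0
  have hc2 : -1 < cos α := by
    simpa using cos_lt_cos_of_nonneg_of_le_pi h0.le le_rfl h1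
  rcases le_total 0 (cos α) with hc | hc
  · nlinarith [mul_nonneg (sub_nonneg.2 h3) hc]
  · nlinarith [mul_nonneg (by linarith : 0 ≤ t + 2) (neg_nonneg.2 hc)]

/-- With `tr B = 2` the trace equation determines `skew B = (2 * cos α - tr g) / sin α`; its
positivity is exactly `α < ang g`. -/
theorem mem_cl3_mul_cl2_pos (h0 : 0 < α) (h1 : α < π) :
    g ∈ cl3 α * cl2 1 1 ↔ α < ang g ∧ (-2 ≤ tr g → 0 < skew g) := by
  have hs := sin_pos_of_pos_of_lt_pi h0 h1
  have hc := cos_le_one α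
  rw [mem_cl3_mul h0 h1 (conjInv_cl2 _ _), lt_ang_iff h0.le h1]
  simp only [mem_cl2_one_one]
  constructor
  · rintro ⟨B, ⟨hB1, hB2⟩, h2, h3⟩
    rw [hB1] at h2 h3
    have := mul_pos hs hB2
    refine ⟨by linarith, fun h4 => ?_⟩
    have h5 : tr g ≤ 2 := by linarith
    have h6 := h3 h4 h5
    exact sign_eq_one_iff.1 (h6.trans (sign_pos (by linarith [abs_mul_cos_lt h0 h1 h4 h5])))
  · rintro ⟨h2, h3⟩
    obtain ⟨B, hB1, hB2⟩ := exists_tr_skew (t := 2) (w := (2 * cos α - tr g) / sin α)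
      (by nlinarith [sq_nonneg ((2 * cos α - tr g) / sin α)])
    refine ⟨B, ⟨hB1, by rw [hB2]; exact div_pos (by linarith) hs⟩, ?_, fun h4 h5 => ?_⟩
    · rw [hB1, hB2]; field_simp
    · rw [hB1, sign_pos (h3 h4), sign_pos (by linarith [abs_mul_cos_lt h0 h1 h4 h5])]

theorem mem_cl3_mul_cl2_neg (h0 : 0 < α) (h1 : α < π) :
    g ∈ cl3 α * cl2 1 (-1) ↔ ang g < α ∧ (tr g ≤ 2 → 0 < skew g) := by
  have hs := sin_pos_of_pos_of_lt_pi h0 h1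
  have hc := neg_one_le_cos α
  rw [mem_cl3_mul h0 h1 (conjInv_cl2 _ _), ang_lt_iff h0 h1.le]
  simp only [mem_cl2_one_neg_one]
  constructor
  · rintro ⟨B, ⟨hB1, hB2⟩, h2, h3⟩
    rw [hB1] at h2 h3
    have := mul_neg_of_pos_of_neg hs hB2
    refine ⟨by linarith, fun h5 => ?_⟩
    have h4 : -2 ≤ tr g := by linarith
    have h6 := h3 h4 h5
    exact sign_eq_one_iff.1 (h6.trans (sign_pos (by linarith [abs_mul_cos_lt h0 h1 h4 h5])))
  · rintro ⟨h2, h3⟩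
    obtain ⟨B, hB1, hB2⟩ := exists_tr_skew (t := 2) (w := (2 * cos α - tr g) / sin α)
      (by nlinarith [sq_nonneg ((2 * cos α - tr g) / sin α)])
    refine ⟨B, ⟨hB1, by rw [hB2]; exact div_neg_of_neg_of_pos (by linarith) hs⟩, ?_,
      fun h4 h5 => ?_⟩
    · rw [hB1, hB2]; field_simp
    · rw [hB1, sign_pos (h3 h5), sign_pos (by linarith [abs_mul_cos_lt h0 h1 h4 h5])]

theorem mem_cl4_mul_cl3 {l : ℝ} (hl : 1 < l) (h0 : 0 < α) (h1 : α < π) :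
    g ∈ cl4 l * cl3 α ↔ (-2 ≤ tr g → tr g ≤ 2 → 0 < skew g) := by
  have hs := sin_pos_of_pos_of_lt_pi h0 h1
  have hl2 := two_lt_add_inv hl
  rw [(conjInv_cl4 l).mul_comm, mem_cl3_mul h0 h1 (conjInv_cl4 l)]
  simp only [mem_cl4 hl]
  constructor
  · rintro ⟨B, hB, -, h3⟩ h4 h5
    have h6 := h3 h4 h5
    rw [hB] at h6
    exact sign_eq_one_iff.1 (h6.trans (sign_pos (by linarith [abs_mul_cos_lt h0 h1 h4 h5])))
  · intro h3
    obtain ⟨B, hB1, hB2⟩ := exists_tr_skew (t := l + l⁻¹)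
      (w := (cos α * (l + l⁻¹) - tr g) / sin α)
      (by nlinarith [sq_nonneg ((cos α * (l + l⁻¹) - tr g) / sin α)])
    refine ⟨B, hB1, ?_, fun h4 h5 => ?_⟩
    · rw [hB1, hB2]; field_simp
    · rw [hB1, sign_pos (h3 h4 h5), sign_pos (by linarith [abs_mul_cos_lt h0 h1 h4 h5])]

variable {β : ℝ}

/-- For `B` of trace `2 * cos β` and positive orientation, `four_le` says `2 * sin β ≤ skew B`, with
every such value attained. Rotating by `α` turns this bound into the addition formula for cosine. -/
theorem mem_cl3_mul_cl3 (h0 : 0 < α) (h1 : α < π) (h2 : 0 < β) (h3 : β < π) :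
    g ∈ cl3 α * cl3 β ↔ tr g ≤ 2 * cos (α + β) ∧ (-2 ≤ tr g →
        SignType.sign (skew g) = SignType.sign (2 * cos β - tr g * cos α)) := by
  have hs := sin_pos_of_pos_of_lt_pi h0 h1
  have hsβ := sin_pos_of_pos_of_lt_pi h2 h3
  have hc := cos_le_one (α + β)
  rw [mem_cl3_mul h0 h1 (conjInv_cl3 β)]
  simp only [mem_cl3 h2 h3, ang_eq_iff h2 h3]
  constructor
  · rintro ⟨B, ⟨hB1, hB2⟩, h4, h5⟩
    have h6 := four_le B
    rw [hB1] at h4 h5 h6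
    have h7 : 2 * sin β ≤ skew B := by
      refine le_of_sq_le_sq ?_ hB2.le
      nlinarith [sin_sq_add_cos_sq β]
    have h8 : tr g ≤ 2 * cos (α + β) := by
      rw [cos_add]; nlinarith
    exact ⟨h8, fun h => h5 h (by linarith)⟩
  · rintro ⟨h4, h5⟩
    have h7 : 2 * sin β ≤ (2 * cos β * cos α - tr g) / sin α := by
      rw [le_div_iff₀ hs]
      rw [cos_add] at h4
      linarith
    obtain ⟨B, hB1, hB2⟩ := exists_tr_skew (t := 2 * cos β)
      (w := (2 * cos β * cos α - tr g) / sin α) (by nlinarith [sin_sq_add_cos_sq β])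
    refine ⟨B, ⟨hB1, by rw [hB2]; linarith⟩, ?_, fun h _ => ?_⟩
    · rw [hB1, hB2]; field_simp
    · rw [hB1]; exact h5 h

theorem mem_cl3_mul_cl3_of_lt (h0 : 0 < α) (h2 : 0 < β) (h3 : α + β < π) :
    g ∈ cl3 α * cl3 β ↔ α + β ≤ ang g ∧ (-2 ≤ tr g → 0 < skew g) := by
  rw [mem_cl3_mul_cl3 h0 (by linarith) h2 (by linarith), ← not_lt (a := ang g),
    ang_lt_iff (by linarith) h3.le, not_lt]
  refine and_congr_right fun h4 => ?_
  -- For `cos α ≥ 0` the upper bound on `tr g` is used, writing `β` as `(α + β) - α`; for `cos α <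
  -- 0` the lower bound `-2` together with `β < π - α` suffices.
  have key : -2 ≤ tr g → 0 < 2 * cos β - tr g * cos α := by
    intro h5
    rcases le_or_gt 0 (cos α) with hc | hc
    · have e : cos β = cos (α + β) * cos α + sin (α + β) * sin α := by
        rw [← cos_sub]; ring_nf
      have s1 := sin_pos_of_pos_of_lt_pi h0 (by linarith)
      have s2 := sin_pos_of_pos_of_lt_pi (by linarith : 0 < α + β) h3
      nlinarith [mul_pos s1 s2, mul_le_mul_of_nonneg_right h4 hc]
    · have : cos (π - α) < cos β := cos_lt_cos_of_nonneg_of_le_pi h2.le (by linarith) (by linarith)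
      rw [cos_pi_sub] at this
      nlinarith
  constructor
  · intro h5 h6
    have h7 := h5 h6
    rwa [sign_pos (key h6), sign_eq_one_iff] at h7
  · intro h5 h6
    rw [sign_pos (key h6), sign_pos (h5 h6)]

theorem mem_cl3_mul_cl3_of_gt (h1 : α < π) (h2 : β < π) (h3 : π < α + β) :
    g ∈ cl3 α * cl3 β ↔ 2 * π - (α + β) ≤ ang g ∧ (-2 ≤ tr g → skew g < 0) := by
  rw [mem_cl3_mul_cl3 (by linarith) h1 (by linarith) h2, ← not_lt (a := ang g),
    ang_lt_iff (by linarith) (by linarith), not_lt, cos_two_pi_sub]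
  refine and_congr_right fun h4 => ?_
  have key : -2 ≤ tr g → 2 * cos β - tr g * cos α < 0 := by
    intro h5
    have : cos β < cos (π - α) :=
      cos_lt_cos_of_nonneg_of_le_pi (by linarith) (by linarith) (by linarith)
    rw [cos_pi_sub] at this
    rcases le_or_gt 0 (cos α) with hc | hc
    · nlinarith
    · have e : cos β = cos (α + β) * cos α + sin (α + β) * sin α := by
        rw [← cos_sub]; ring_nf
      have s1 := sin_pos_of_pos_of_lt_pi (by linarith : 0 < α) h1
      have s2 : sin (α + β) < 0 := by
        have := sin_pos_of_pos_of_lt_pi (by linarith : 0 < α + β - π) (by linarith)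
        rw [sin_sub_pi] at this; linarith
      nlinarith [mul_neg_of_pos_of_neg s1 s2, mul_le_mul_of_nonpos_right h4 hc.le]
  constructor
  · intro h5 h6
    have h7 := h5 h6
    rwa [_root_.sign_neg (key h6), sign_eq_neg_one_iff] at h7
  · intro h5 h6
    rw [_root_.sign_neg (key h6), _root_.sign_neg (h5 h6)]

theorem mem_cl3_mul_cl3_of_eq (h0 : 0 < α) (h2 : 0 < β) (h3 : α + β = π) :
    g ∈ cl3 α * cl3 β ↔ tr g ≤ -2 ∧ (tr g = -2 → skew g = 0) := by
  rw [mem_cl3_mul_cl3 h0 (by linarith) h2 (by linarith), h3, cos_pi,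
    show β = π - α by linarith, cos_pi_sub, mul_neg_one]
  -- In this borderline case the expression governing the sign vanishes at trace `-2`, so only `-1`
  -- occurs there.
  refine and_congr_right fun h4 => ?_
  constructor
  · intro h5 h6
    have h7 := h5 h6.ge
    rwa [h6, show 2 * -cos α - -2 * cos α = 0 by ring, _root_.sign_zero,
      _root_.sign_eq_zero_iff] at h7
  · intro h5 h6
    have h7 := le_antisymm h4 h6
    rw [h7, h5 h7, show 2 * -cos α - -2 * cos α = 0 by ring]

end Rotation

/-! ### Products with a unipotent class. -/

/-- For trace in `[-2, 2]` the diagonal product is at most one, so the off-diagonal entries have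
product at most zero. The orientation can then be read from `g 0 1`, which left multiplication by
`lowerUnip` preserves. -/
theorem skew_pos_of_entry_neg {g : SL2R} (h1 : -2 ≤ tr g) (h2 : tr g ≤ 2) (h : g 0 1 < 0) :
    0 < skew g := by
  have hd := det_entries g
  unfold tr at h1 h2
  unfold skew
  have : 0 ≤ g 1 0 := by
    by_contra hc
    push Not at hc
    nlinarith [mul_pos_of_neg_of_neg hc h, sq_nonneg (g 0 0 - g 1 1)]
  linarith

theorem skew_neg_of_entry_pos {g : SL2R} (h1 : -2 ≤ tr g) (h2 : tr g ≤ 2) (h : 0 < g 0 1) :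
    skew g < 0 := by
  have := skew_pos_of_entry_neg (g := -g) (by rw [tr_neg]; linarith) (by rw [tr_neg]; linarith)
    (by simpa using h)
  simpa using this

theorem diagonal_of_entry_eq_zero {g : SL2R} (h1 : tr g = 2) (h : g 0 1 = 0) :
    g 0 0 = 1 ∧ g 1 1 = 1 := by
  have hd := det_entries g
  unfold tr at h1
  have : g 0 0 = 1 := by rw [h] at hd; nlinarith [sq_nonneg (g 0 0 - 1)]
  exact ⟨this, by linarith⟩

theorem tr_lowerUnip_mul (x : ℝ) (B : SL2R) : tr (lowerUnip x * B) = tr B + x * B 0 1 := by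
  simp [tr, lowerUnip, mul_zero_zero, mul_one_one]; ring

theorem skew_lowerUnip_mul (x : ℝ) (B : SL2R) :
    skew (lowerUnip x * B) = skew B + x * B 0 0 := by
  simp [skew, lowerUnip, mul_one_zero, mul_zero_one]; ring

theorem lowerUnip_mul_entry (x : ℝ) (B : SL2R) : (lowerUnip x * B) 0 1 = B 0 1 := by
  simp [lowerUnip, mul_zero_one]

theorem mem_cl2_one_mul {δ : ℤˣ} {D : Set SL2R} (hD : ConjInv D) {g : SL2R} :
    g ∈ cl2 1 δ * D ↔ ∃ B ∈ D, IsConj (lowerUnip ((δ : ℤ) : ℝ) * B) g := by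
  rw [cl2_one_eq, mem_conjugatesOf_mul hD]

section Unipotent
variable {g : SL2R}

/-- The product has trace `2 + B 0 1`, and positive orientation of `B` forces `B 0 1 ≤ 0`. The
unchanged entry `B 0 1` orients the product, except when it is zero and both factors are lower
triangular. -/
theorem mem_cl2_pos_mul_cl2_pos :
    g ∈ cl2 1 1 * cl2 1 1 ↔ tr g ≤ 2 ∧ (-2 ≤ tr g → 0 < skew g) := by
  rw [mem_cl2_one_mul (conjInv_cl2 _ _)]
  simp only [mem_cl2_one_one, Units.val_one, Int.cast_one]
  constructor
  · rintro ⟨B, ⟨hB1, hB2⟩, hc⟩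
    have h1 := tr_eq_of_isConj hc
    rw [tr_lowerUnip_mul, one_mul, hB1] at h1
    have hq : B 0 1 ≤ 0 := not_lt.1 fun h => by
      linarith [skew_neg_of_entry_pos (by linarith) hB1.le h]
    have h2 : tr g ≤ 2 := by linarith
    refine ⟨h2, fun h3 => skew_pos_of_isConj hc ?_ ?_⟩
    · rw [tr_eq_of_isConj hc]; nlinarith
    · rcases hq.lt_or_eq with h | h
      · apply skew_pos_of_entry_neg <;> try rw [tr_eq_of_isConj hc]
        · exact h3
        · exact h2
        · rwa [lowerUnip_mul_entry]
      · rw [skew_lowerUnip_mul, (diagonal_of_entry_eq_zero hB1 h).1]; linarith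
  · rintro ⟨h1, h2⟩
    rcases h1.lt_or_eq with h | h
    -- An upper unipotent whose corner entry is precisely the required change of trace.
    · refine ⟨ofEntries 1 (tr g - 2) 0 1 (by ring), ⟨by simp [tr]; norm_num, by simpa [skew]⟩,
        isConj_iff_invariants.2 ⟨?_, ?_⟩⟩
      · rw [tr_lowerUnip_mul]; simp [tr]; ring
      · intro h3 h4
        rw [skew_lowerUnip_mul, sign_pos, sign_pos]
        · apply h2; rw [tr_lowerUnip_mul] at h3; simp [tr] at h3 ⊢; linarith
        · simp [skew]; linarith
    · refine ⟨lowerUnip 1, ⟨by simp [tr, lowerUnip]; norm_num, by simp [skew, lowerUnip]⟩,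
        isConj_iff_invariants.2 ⟨?_, ?_⟩⟩
      · rw [tr_lowerUnip_mul, h]; simp [lowerUnip, tr]; norm_num
      · intro _ _
        rw [skew_lowerUnip_mul, sign_pos, sign_pos]
        · apply h2; linarith
        · simp [skew, lowerUnip]

theorem mem_cl2_neg_mul_cl2_neg :
    g ∈ cl2 1 (-1) * cl2 1 (-1) ↔ tr g ≤ 2 ∧ (-2 ≤ tr g → skew g < 0) := by
  rw [mem_cl2_one_mul (conjInv_cl2 _ _)]
  simp only [mem_cl2_one_neg_one, Units.val_neg, Units.val_one, Int.cast_neg, Int.cast_one]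
  constructor
  · rintro ⟨B, ⟨hB1, hB2⟩, hc⟩
    have h1 := tr_eq_of_isConj hc
    rw [tr_lowerUnip_mul, neg_one_mul, hB1] at h1
    have hq : 0 ≤ B 0 1 := not_lt.1 fun h => by
      linarith [skew_pos_of_entry_neg (by linarith) hB1.le h]
    have h2 : tr g ≤ 2 := by linarith
    refine ⟨h2, fun h3 => skew_neg_of_isConj hc ?_ ?_⟩
    · rw [tr_eq_of_isConj hc]; nlinarith
    · rcases hq.lt_or_eq with h | h
      · apply skew_neg_of_entry_pos <;> try rw [tr_eq_of_isConj hc]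
        · exact h3
        · exact h2
        · rwa [lowerUnip_mul_entry]
      · rw [skew_lowerUnip_mul, (diagonal_of_entry_eq_zero hB1 h.symm).1]; linarith
  · rintro ⟨h1, h2⟩
    rcases h1.lt_or_eq with h | h
    · refine ⟨ofEntries 1 (2 - tr g) 0 1 (by ring), ⟨by simp [tr]; norm_num, by simpa [skew]⟩,
        isConj_iff_invariants.2 ⟨?_, ?_⟩⟩
      · rw [tr_lowerUnip_mul]; simp [tr]; ring
      · intro h3 h4
        rw [skew_lowerUnip_mul, _root_.sign_neg, _root_.sign_neg]
        · apply h2; rw [tr_lowerUnip_mul] at h3; simp [tr] at h3 ⊢; linarith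
        · simp [skew]; linarith
    · refine ⟨lowerUnip (-1), ⟨by simp [tr, lowerUnip]; norm_num, by simp [skew, lowerUnip]⟩,
        isConj_iff_invariants.2 ⟨?_, ?_⟩⟩
      · rw [tr_lowerUnip_mul, h]; simp [lowerUnip, tr]; norm_num
      · intro _ _
        rw [skew_lowerUnip_mul, _root_.sign_neg, _root_.sign_neg]
        · apply h2; linarith
        · simp [skew, lowerUnip]

theorem mem_cl2_pos_mul_cl2_neg : g ∈ cl2 1 1 * cl2 1 (-1) ↔ 2 ≤ tr g := by
  rw [mem_cl2_one_mul (conjInv_cl2 _ _)]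
  simp only [mem_cl2_one_neg_one, Units.val_one, Int.cast_one]
  constructor
  · rintro ⟨B, ⟨hB1, hB2⟩, hc⟩
    have h1 := tr_eq_of_isConj hc
    rw [tr_lowerUnip_mul, one_mul, hB1] at h1
    have hq : 0 ≤ B 0 1 := not_lt.1 fun h => by
      linarith [skew_pos_of_entry_neg (by linarith) hB1.le h]
    linarith
  · intro h1
    rcases h1.lt_or_eq with h | h
    · refine ⟨ofEntries 1 (tr g - 2) 0 1 (by ring), ⟨by simp [tr]; norm_num, by simpa [skew]⟩,
        isConj_iff_invariants.2 ⟨?_, ?_⟩⟩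
      · rw [tr_lowerUnip_mul]; simp [tr]; ring
      · intro _ h4
        rw [tr_lowerUnip_mul] at h4; simp [tr] at h4 h; linarith
    -- At trace `2` all three signs of `skew` must be reached: the sum of `1` and a negative number
    -- can have any sign.
    · have hw : ∃ r : ℝ, r < 0 ∧ SignType.sign (r + 1) = SignType.sign (skew g) := by
        rcases lt_trichotomy (skew g) 0 with hw | hw | hw
        · exact ⟨-2, by norm_num, by rw [_root_.sign_neg hw, _root_.sign_neg (by norm_num)]⟩
        · exact ⟨-1, by norm_num, by rw [hw]; norm_num⟩
        · exact ⟨-1 / 2, by norm_num, by rw [sign_pos hw, sign_pos (by norm_num)]⟩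
      obtain ⟨r, hr, hs⟩ := hw
      refine ⟨lowerUnip r, ⟨by simp [tr, lowerUnip]; norm_num, by simpa [skew, lowerUnip]⟩,
        isConj_iff_invariants.2 ⟨?_, ?_⟩⟩
      · rw [tr_lowerUnip_mul, ← h]; simp [lowerUnip, tr]; norm_num
      · intro _ _
        rw [skew_lowerUnip_mul, ← hs]
        simp [skew, lowerUnip]

theorem exists_entry {t q : ℝ} (hq : q ≠ 0) : ∃ B : SL2R, tr B = t ∧ B 0 1 = q :=
  ⟨ofEntries t q (-q⁻¹) 0 (by field_simp; ring), by simp [tr], rfl⟩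

/-- The upper right entry must be `tr g - (l + l⁻¹)`, which is negative whenever `tr g ≤ 2`; so
elements with trace in `[-2, 2]` are positively oriented. -/
theorem mem_cl4_mul_cl2_pos {l : ℝ} (hl : 1 < l) :
    g ∈ cl4 l * cl2 1 1 ↔ (-2 ≤ tr g → tr g ≤ 2 → 0 < skew g) := by
  have hl2 := two_lt_add_inv hl
  rw [(conjInv_cl4 l).mul_comm, mem_cl2_one_mul (conjInv_cl4 l)]
  simp only [mem_cl4 hl, Units.val_one, Int.cast_one]
  constructor
  · rintro ⟨B, hB, hc⟩ h1 h2
    have h := tr_eq_of_isConj hc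
    refine skew_pos_of_isConj hc (by rw [h]; nlinarith) ?_
    refine skew_pos_of_entry_neg (by rwa [h]) (by rwa [h]) ?_
    rw [tr_lowerUnip_mul, one_mul] at h
    rw [lowerUnip_mul_entry]; linarith
  · intro h
    -- If no change of trace is needed the entry is zero, outside the scope of `exists_entry`; the
    -- diagonal matrix then serves.
    by_cases hq : tr g = l + l⁻¹
    · refine ⟨diag l (by linarith), by simp [diag, tr], isConj_iff_invariants.2 ⟨?_, ?_⟩⟩
      · rw [tr_lowerUnip_mul, hq]; simp [tr, diag]
      · intro _ h3
        rw [tr_lowerUnip_mul] at h3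
        simp [tr, diag] at h3
        linarith
    · obtain ⟨B, hB1, hB2⟩ := exists_entry (t := l + l⁻¹) (sub_ne_zero.2 hq)
      have e : tr (lowerUnip 1 * B) = tr g := by rw [tr_lowerUnip_mul, hB1, hB2]; ring
      refine ⟨B, hB1, isConj_iff_invariants.2 ⟨e, fun h1 h2 => ?_⟩⟩
      rw [sign_pos (h (e ▸ h1) (e ▸ h2)), sign_pos]
      refine skew_pos_of_entry_neg h1 h2 ?_
      rw [lowerUnip_mul_entry, hB2]; linarith

theorem mem_cl4_mul_cl2_neg {l : ℝ} (hl : 1 < l) :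
    g ∈ cl4 l * cl2 1 (-1) ↔ (-2 ≤ tr g → tr g ≤ 2 → skew g < 0) := by
  have hl2 := two_lt_add_inv hl
  rw [(conjInv_cl4 l).mul_comm, mem_cl2_one_mul (conjInv_cl4 l)]
  simp only [mem_cl4 hl, Units.val_neg, Units.val_one, Int.cast_neg, Int.cast_one]
  constructor
  · rintro ⟨B, hB, hc⟩ h1 h2
    have h := tr_eq_of_isConj hc
    refine skew_neg_of_isConj hc (by rw [h]; nlinarith) ?_
    refine skew_neg_of_entry_pos (by rwa [h]) (by rwa [h]) ?_
    rw [tr_lowerUnip_mul, neg_one_mul] at h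
    rw [lowerUnip_mul_entry]; linarith
  · intro h
    by_cases hq : l + l⁻¹ = tr g
    · refine ⟨diag l (by linarith), by simp [diag, tr], isConj_iff_invariants.2 ⟨?_, ?_⟩⟩
      · rw [tr_lowerUnip_mul, ← hq]; simp [tr, diag]
      · intro _ h3
        rw [tr_lowerUnip_mul] at h3
        simp [tr, diag] at h3
        linarith
    · obtain ⟨B, hB1, hB2⟩ := exists_entry (t := l + l⁻¹) (sub_ne_zero.2 hq)
      have e : tr (lowerUnip (-1) * B) = tr g := by rw [tr_lowerUnip_mul, hB1, hB2]; ring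
      refine ⟨B, hB1, isConj_iff_invariants.2 ⟨e, fun h1 h2 => ?_⟩⟩
      rw [_root_.sign_neg (h (e ▸ h1) (e ▸ h2)), _root_.sign_neg]
      refine skew_neg_of_entry_pos h1 h2 ?_
      rw [lowerUnip_mul_entry, hB2]; linarith

end Unipotent

/-! ### Products of two hyperbolic classes. -/

theorem add_inv_injOn {l m : ℝ} (hl : 1 < l) (hm : 1 < m) (h : l + l⁻¹ = m + m⁻¹) : l = m := by
  have h1 : (l - m) * (l * m - 1) = 0 := by
    field_simp at h
    linear_combination h
  rcases mul_eq_zero.1 h1 with h2 | h2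
  · linarith
  · nlinarith

/-- The trace of `diag l` times a matrix with diagonal `p`, `τ - p` depends only on `p`, which is
solved for. The off-diagonal entries are then constrained only by their product `K`, leaving the
orientation free. -/
theorem mem_cl4_mul_cl4_of_ne {l m : ℝ} (hl : 1 < l) (hm : 1 < m) {g : SL2R} (h1 : g ≠ 1)
    (h2 : g ≠ -1) : g ∈ cl4 l * cl4 m := by
  have hl0 : l ≠ 0 := by linarith
  have hl2 : 0 < l ^ 2 - 1 := by nlinarith
  rw [cl4_eq hl0, mem_conjugatesOf_mul (conjInv_cl4 m)]
  simp only [mem_cl4 hm]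
  set t := tr g with ht
  set τ := m + m⁻¹
  obtain ⟨p, hps⟩ : ∃ p, l * p + l⁻¹ * (τ - p) = t :=
    ⟨(l * t - τ) / (l ^ 2 - 1), by field_simp; ring⟩
  set K := p * (τ - p) - 1 with hK
  -- The arithmetic-geometric inequality for the two diagonal entries of the product, whose sum is
  -- `t` and whose product is `K + 1`. For `t` in `[-2, 2]` it gives `K ≤ 0`, so the two terms of
  -- the new `skew` do not compete.
  have hle : 4 * K ≤ t ^ 2 - 4 := by
    have e : l * p * (l⁻¹ * (τ - p)) = K + 1 := by rw [hK]; field_simp; ring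
    rw [← hps]
    nlinarith [sq_nonneg (l * p - l⁻¹ * (τ - p))]
  have build (q r : ℝ) (hqr : q * r = K) (hsk : -2 ≤ t → t ≤ 2 →
      SignType.sign (l⁻¹ * r - l * q) = SignType.sign (skew g)) :
      ∃ B, tr B = τ ∧ IsConj (diag l hl0 * B) g := by
    refine ⟨ofEntries p q r (τ - p) (by rw [hqr, hK]; ring), by simp [tr],
      isConj_iff_invariants.2 ⟨?_, ?_⟩⟩
    · refine Eq.trans ?_ hps; simp [tr, mul_zero_zero, mul_one_one, diag]
    · have : tr (diag l hl0 * ofEntries p q r (τ - p) (by rw [hqr, hK]; ring)) = t := by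
        refine Eq.trans ?_ hps; simp [tr, mul_zero_zero, mul_one_one, diag]
      rw [this]
      intro h3 h4
      rw [← hsk h3 h4]
      simp [skew, mul_zero_one, mul_one_zero, diag]
  have hinv : 0 < l⁻¹ := inv_pos.2 (by linarith)
  by_cases hcase : -2 ≤ t ∧ t ≤ 2
  · have hK0 : K ≤ 0 := by nlinarith
    rcases lt_trichotomy (skew g) 0 with hw | hw | hw
    · refine build 1 K (by ring) fun _ _ => ?_
      rw [_root_.sign_neg hw, _root_.sign_neg]; nlinarith
    · exfalso
      have h4 := four_le g
      rw [hw, ← ht] at h4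
      have : (t - 2) * (t + 2) = 0 := by nlinarith
      rcases mul_eq_zero.1 this with h | h
      · exact h1 ((eq_one_iff g).2 ⟨by linarith, hw⟩)
      · exact h2 ((eq_neg_one_iff g).2 ⟨by linarith, hw⟩)
    · refine build (-1) (-K) (by ring) fun _ _ => ?_
      rw [sign_pos hw, sign_pos]; nlinarith
  · exact build 1 K (by ring) fun h h' => absurd ⟨h, h'⟩ hcase

theorem neg_one_notMem_cl4_mul_cl4 {l m : ℝ} (hl : 1 < l) (hm : 1 < m) :
    (-1 : SL2R) ∉ cl4 l * cl4 m := by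
  rintro ⟨x, hx, y, hy, h⟩
  have e : y = -x⁻¹ := by
    rw [eq_comm, ← mul_neg_one, ← h]; simp
  rw [mem_cl4 hl] at hx
  rw [mem_cl4 hm, e, tr_neg, tr_inv] at hy
  linarith [two_lt_add_inv hl, two_lt_add_inv hm]

theorem one_mem_cl4_mul_cl4_iff {l m : ℝ} (hl : 1 < l) (hm : 1 < m) :
    (1 : SL2R) ∈ cl4 l * cl4 m ↔ l = m := by
  constructor
  · rintro ⟨x, hx, y, hy, h⟩
    have e : y = x⁻¹ := eq_inv_of_mul_eq_one_right h
    rw [mem_cl4 hl] at hx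
    rw [mem_cl4 hm, e, tr_inv, hx] at hy
    exact add_inv_injOn hl hm hy
  · rintro rfl
    have : diag l (by linarith) ∈ cl4 l := by rw [cl4_eq (by linarith)]; exact mem_conjugatesOf_self
    exact ⟨_, this, _, by rw [mem_cl4 hl, tr_inv]; exact (mem_cl4 hl).1 this, mul_inv_cancel _⟩

/-! ### Double products as sets. -/

theorem mem_cl4PosBar {g : SL2R} : g ∈ cl4PosBar ↔ 2 ≤ tr g := by
  simp only [cl4PosBar, mem_union, mem_singleton_iff, mem_cl4Pos, eq_one_iff, mem_cl2_one_one,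
    mem_cl2_one_neg_one]
  grind

theorem mem_upperFull {g : SL2R} :
    g ∈ upperFull ↔ (-2 ≤ tr g → tr g ≤ 2 → 0 < skew g) := by
  simp only [upperFull, mem_union, mem_cl4Pos, mem_cl4Neg, mem_cl2_one_one, mem_cl2_neg_one_one,
    mem_cl3On_Ioo le_rfl le_rfl]
  rcases trichotomies g with h | h | h | h | h | h | h | h | h | h <;> grind

theorem mem_lowerFull {g : SL2R} :
    g ∈ lowerFull ↔ (-2 ≤ tr g → tr g ≤ 2 → skew g < 0) := by
  simp only [lowerFull, mem_union, mem_cl4Pos, mem_cl4Neg, mem_cl2_one_neg_one,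
    mem_cl2_neg_one_neg_one, mem_cl3On_Ioo_lower le_rfl le_rfl]
  rcases trichotomies g with h | h | h | h | h | h | h | h | h | h <;> grind

theorem cl2_pos_mul_cl2_pos :
    cl2 1 1 * cl2 1 1 = cl2 1 1 ∪ cl3On (Ioo 0 π) ∪ cl2 (-1) 1 ∪ cl4Neg := by
  ext g
  simp only [mem_cl2_pos_mul_cl2_pos, mem_union, mem_cl4Neg, mem_cl2_one_one,
    mem_cl2_neg_one_one, mem_cl3On_Ioo le_rfl le_rfl]
  rcases trichotomies g with h | h | h | h | h | h | h | h | h | h <;> grind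

theorem cl2_pos_mul_cl2_neg : cl2 1 1 * cl2 1 (-1) = cl4PosBar := by
  ext g
  rw [mem_cl2_pos_mul_cl2_neg, mem_cl4PosBar]

theorem cl2_neg_mul_cl2_neg :
    cl2 1 (-1) * cl2 1 (-1) =
      cl4Neg ∪ cl2 (-1) (-1) ∪ cl3On (Ioo π (2 * π)) ∪ cl2 1 (-1) := by
  ext g
  simp only [mem_cl2_neg_mul_cl2_neg, mem_union, mem_cl4Neg, mem_cl2_one_neg_one,
    mem_cl2_neg_one_neg_one, mem_cl3On_Ioo_lower le_rfl le_rfl]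
  rcases trichotomies g with h | h | h | h | h | h | h | h | h | h <;> grind

section Elliptic
variable {α β : ℝ}

theorem cl3_mul_cl2_pos (h0 : 0 < α) (h1 : α < π) :
    cl3 α * cl2 1 1 = cl3On (Ioo α π) ∪ cl2 (-1) 1 ∪ cl4Neg := by
  ext g
  simp only [mem_cl3_mul_cl2_pos h0 h1, mem_union, mem_cl4Neg,
    mem_cl2_neg_one_one, mem_cl3On_Ioo h0.le le_rfl]
  rcases trichotomies g with h | h | h | h | h | h | h | h | h | h <;> grind

theorem cl3_mul_cl2_neg (h0 : 0 < α) (h1 : α < π) :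
    cl3 α * cl2 1 (-1) = cl4Pos ∪ cl2 1 1 ∪ cl3On (Ioo 0 α) := by
  ext g
  simp only [mem_cl3_mul_cl2_neg h0 h1, mem_union, mem_cl4Pos,
    mem_cl2_one_one, mem_cl3On_Ioo le_rfl h1.le]
  rcases trichotomies g with h | h | h | h | h | h | h | h | h | h <;> grind

theorem cl3_mul_cl3_of_lt (h0 : 0 < α) (h1 : 0 < β) (h2 : α + β < π) :
    cl3 α * cl3 β = cl3On (Ico (α + β) π) ∪ cl2 (-1) 1 ∪ cl4Neg := by
  ext g
  simp only [mem_cl3_mul_cl3_of_lt h0 h1 h2, mem_union, mem_cl4Neg,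
    mem_cl2_neg_one_one, mem_cl3On_Ico (add_pos h0 h1) le_rfl]
  rcases trichotomies g with h | h | h | h | h | h | h | h | h | h <;> grind

theorem cl3_mul_cl3_of_eq (h0 : 0 < α) (h1 : 0 < β) (h2 : α + β = π) :
    cl3 α * cl3 β = {-1} ∪ cl4Neg := by
  ext g
  simp only [mem_cl3_mul_cl3_of_eq h0 h1 h2, mem_union, mem_cl4Neg, mem_singleton_iff,
    eq_neg_one_iff]
  rcases trichotomies g with h | h | h | h | h | h | h | h | h | h <;> grind

theorem cl3_mul_cl3_of_gt (h0 : α < π) (h1 : β < π) (h2 : π < α + β) :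
    cl3 α * cl3 β = cl4Neg ∪ cl2 (-1) (-1) ∪ cl3On (Ioc π (α + β)) := by
  ext g
  simp only [mem_cl3_mul_cl3_of_gt h0 h1 h2, mem_union, mem_cl4Neg,
    mem_cl2_neg_one_neg_one, mem_cl3On_Ioc_lower le_rfl (by linarith : α + β < 2 * π)]
  rcases trichotomies g with h | h | h | h | h | h | h | h | h | h <;> grind

end Elliptic

section Hyperbolic
variable {l m : ℝ}

theorem cl4_mul_cl2_pos (hl : 1 < l) : cl4 l * cl2 1 1 = upperFull := by
  ext g
  rw [mem_cl4_mul_cl2_pos hl, mem_upperFull]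

theorem cl4_mul_cl2_neg (hl : 1 < l) : cl4 l * cl2 1 (-1) = lowerFull := by
  ext g
  rw [mem_cl4_mul_cl2_neg hl, mem_lowerFull]

theorem cl4_mul_cl3 (hl : 1 < l) {α : ℝ} (h0 : 0 < α) (h1 : α < π) :
    cl4 l * cl3 α = upperFull := by
  ext g
  rw [mem_cl4_mul_cl3 hl h0 h1, mem_upperFull]

theorem cl4_mul_self (hl : 1 < l) : cl4 l * cl4 l = {-1}ᶜ := by
  ext g
  rw [mem_compl_singleton_iff]
  refine ⟨?_, fun h => ?_⟩
  · rintro hg rfl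
    exact neg_one_notMem_cl4_mul_cl4 hl hl hg
  · by_cases h1 : g = 1
    · rw [h1, one_mem_cl4_mul_cl4_iff hl hl]
    · exact mem_cl4_mul_cl4_of_ne hl hl h1 h

theorem cl4_mul_cl4 (hl : 1 < l) (hm : 1 < m) (hne : l ≠ m) : cl4 l * cl4 m = {1, -1}ᶜ := by
  ext g
  rw [mem_compl_iff, mem_insert_iff, mem_singleton_iff, not_or]
  refine ⟨fun hg => ⟨?_, ?_⟩, fun h => mem_cl4_mul_cl4_of_ne hl hm h.1 h.2⟩
  · rintro rfl
    exact hne ((one_mem_cl4_mul_cl4_iff hl hm).1 hg)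
  · rintro rfl
    exact neg_one_notMem_cl4_mul_cl4 hl hm hg

end Hyperbolic

/-! ### Products with unions of classes. -/

theorem mem_cl3On_mul {j : Set ℝ} {D : Set SL2R} {g : SL2R} :
    g ∈ cl3On j * D ↔ ∃ θ ∈ j, g ∈ cl3 θ * D := by
  simp only [cl3On, iUnion_mul, mem_iUnion, exists_prop]

theorem mem_neg_mul {X D : Set SL2R} {g : SL2R} : g ∈ -X * D ↔ -g ∈ X * D := by
  rw [neg_mul, Set.mem_neg]

theorem mem_cl4Neg_mul {D : Set SL2R} {g : SL2R} : g ∈ cl4Neg * D ↔ -g ∈ cl4Pos * D := by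
  rw [cl4Neg_eq, mem_neg_mul]

theorem mem_cl2_neg_one_one_mul {D : Set SL2R} {g : SL2R} :
    g ∈ cl2 (-1) 1 * D ↔ -g ∈ cl2 1 (-1) * D := by
  rw [cl2_neg_one_eq, mem_neg_mul]

theorem mem_cl2_neg_one_neg_one_mul {D : Set SL2R} {g : SL2R} :
    g ∈ cl2 (-1) (-1) * D ↔ -g ∈ cl2 1 1 * D := by
  rw [cl2_neg_one_eq, mem_neg_mul, neg_neg]

theorem mem_neg_one_mul {D : Set SL2R} {g : SL2R} : g ∈ ({-1} : Set SL2R) * D ↔ -g ∈ D := by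
  rw [show ({-1} : Set SL2R) = -{1} by simp, mem_neg_mul, singleton_mul]
  simp

theorem mem_cl3On_Ioo_pi_mul {y : ℝ} {D : Set SL2R} {g : SL2R} :
    g ∈ cl3On (Ioo π y) * D ↔ -g ∈ cl3On (Ioo 0 (y - π)) * D := by
  rw [mem_cl3On_mul, mem_cl3On_mul]
  constructor
  · rintro ⟨θ, hθ, h⟩
    refine ⟨θ - π, ⟨by linarith [hθ.1], by linarith [hθ.2]⟩, ?_⟩
    rwa [← mem_neg_mul, ← cl3_add_pi, sub_add_cancel]
  · rintro ⟨θ, hθ, h⟩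
    refine ⟨θ + π, ⟨by linarith [hθ.1], by linarith [hθ.2]⟩, ?_⟩
    rwa [cl3_add_pi, mem_neg_mul]

theorem mem_cl3On_Ioc_pi_mul {y : ℝ} {D : Set SL2R} {g : SL2R} :
    g ∈ cl3On (Ioc π y) * D ↔ -g ∈ cl3On (Ioc 0 (y - π)) * D := by
  rw [mem_cl3On_mul, mem_cl3On_mul]
  constructor
  · rintro ⟨θ, hθ, h⟩
    refine ⟨θ - π, ⟨by linarith [hθ.1], by linarith [hθ.2]⟩, ?_⟩
    rwa [← mem_neg_mul, ← cl3_add_pi, sub_add_cancel]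
  · rintro ⟨θ, hθ, h⟩
    refine ⟨θ + π, ⟨by linarith [hθ.1], by linarith [hθ.2]⟩, ?_⟩
    rwa [cl3_add_pi, mem_neg_mul]

section Arcs
variable {g : SL2R} {x y γ : ℝ}

theorem mem_cl3On_mul_cl2_pos {j : Set ℝ} (hj : j ⊆ Ioo 0 π) :
    g ∈ cl3On j * cl2 1 1 ↔ (∃ θ ∈ j, θ < ang g) ∧ (-2 ≤ tr g → 0 < skew g) := by
  rw [mem_cl3On_mul, ← exists_and_right]
  refine exists_congr fun θ => ?_
  rw [and_assoc]
  exact and_congr_right fun h => mem_cl3_mul_cl2_pos (hj h).1 (hj h).2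

theorem mem_cl3On_mul_cl2_neg {j : Set ℝ} (hj : j ⊆ Ioo 0 π) :
    g ∈ cl3On j * cl2 1 (-1) ↔ (∃ θ ∈ j, ang g < θ) ∧ (tr g ≤ 2 → 0 < skew g) := by
  rw [mem_cl3On_mul, ← exists_and_right]
  refine exists_congr fun θ => ?_
  rw [and_assoc]
  exact and_congr_right fun h => mem_cl3_mul_cl2_neg (hj h).1 (hj h).2

/-- The condition is `θ < ang g` for some `θ` in the arc, so only the left end of the arc matters.
For `cl2 1 (-1)` the inequality is reversed and only the right end matters. -/
theorem mem_cl3On_Ioo_mul_cl2_pos (hx : 0 ≤ x) (hxy : x < y) (hy : y ≤ π) :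
    g ∈ cl3On (Ioo x y) * cl2 1 1 ↔ x < ang g ∧ (-2 ≤ tr g → 0 < skew g) := by
  rw [mem_cl3On_mul_cl2_pos fun _ h => ⟨hx.trans_lt h.1, h.2.trans_le hy⟩]
  refine and_congr_left fun _ => ⟨fun ⟨θ, h1, h2⟩ => h1.1.trans h2, fun h => ?_⟩
  obtain ⟨θ, h1, h2⟩ := exists_between (lt_min h hxy)
  exact ⟨θ, ⟨h1, h2.trans_le (min_le_right _ _)⟩, h2.trans_le (min_le_left _ _)⟩

theorem mem_cl3On_Ioo_mul_cl2_neg (hx : 0 ≤ x) (hxy : x < y) (hy : y ≤ π) :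
    g ∈ cl3On (Ioo x y) * cl2 1 (-1) ↔ ang g < y ∧ (tr g ≤ 2 → 0 < skew g) := by
  rw [mem_cl3On_mul_cl2_neg fun _ h => ⟨hx.trans_lt h.1, h.2.trans_le hy⟩]
  refine and_congr_left fun _ => ⟨fun ⟨θ, h1, h2⟩ => h2.trans h1.2, fun h => ?_⟩
  obtain ⟨θ, h1, h2⟩ := exists_between (max_lt h hxy)
  exact ⟨θ, ⟨(le_max_right _ _).trans_lt h1, h2⟩, (le_max_left _ _).trans_lt h1⟩

theorem mem_cl3On_Ico_mul_cl2_pos (hx : 0 < x) (hxy : x < y) (hy : y ≤ π) :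
    g ∈ cl3On (Ico x y) * cl2 1 1 ↔ x < ang g ∧ (-2 ≤ tr g → 0 < skew g) := by
  rw [mem_cl3On_mul_cl2_pos fun _ h => ⟨hx.trans_le h.1, h.2.trans_le hy⟩]
  exact and_congr_left fun _ => ⟨fun ⟨θ, h1, h2⟩ => h1.1.trans_lt h2,
    fun h => ⟨x, ⟨le_rfl, hxy⟩, h⟩⟩

theorem mem_cl3On_Ico_mul_cl2_neg (hx : 0 < x) (hxy : x < y) (hy : y ≤ π) :
    g ∈ cl3On (Ico x y) * cl2 1 (-1) ↔ ang g < y ∧ (tr g ≤ 2 → 0 < skew g) := by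
  rw [mem_cl3On_mul_cl2_neg fun _ h => ⟨hx.trans_le h.1, h.2.trans_le hy⟩]
  refine and_congr_left fun _ => ⟨fun ⟨θ, h1, h2⟩ => h2.trans h1.2, fun h => ?_⟩
  obtain ⟨θ, h1, h2⟩ := exists_between (max_lt h hxy)
  exact ⟨θ, ⟨((le_max_right _ _).trans_lt h1).le, h2⟩, (le_max_left _ _).trans_lt h1⟩

theorem mem_cl3On_Ioc_mul_cl2_pos (hx : 0 ≤ x) (hxy : x < y) (hy : y < π) :
    g ∈ cl3On (Ioc x y) * cl2 1 1 ↔ x < ang g ∧ (-2 ≤ tr g → 0 < skew g) := by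
  rw [mem_cl3On_mul_cl2_pos fun _ h => ⟨hx.trans_lt h.1, h.2.trans_lt hy⟩]
  refine and_congr_left fun _ => ⟨fun ⟨θ, h1, h2⟩ => h1.1.trans h2, fun h => ?_⟩
  obtain ⟨θ, h1, h2⟩ := exists_between (lt_min h hxy)
  exact ⟨θ, ⟨h1, (h2.trans_le (min_le_right _ _)).le⟩, h2.trans_le (min_le_left _ _)⟩

theorem mem_cl3On_Ioc_mul_cl2_neg (hx : 0 ≤ x) (hxy : x < y) (hy : y < π) :
    g ∈ cl3On (Ioc x y) * cl2 1 (-1) ↔ ang g < y ∧ (tr g ≤ 2 → 0 < skew g) := by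
  rw [mem_cl3On_mul_cl2_neg fun _ h => ⟨hx.trans_lt h.1, h.2.trans_lt hy⟩]
  exact and_congr_left fun _ => ⟨fun ⟨θ, h1, h2⟩ => h2.trans_le h1.2,
    fun h => ⟨y, ⟨hxy, le_rfl⟩, h⟩⟩

/-- The three alternatives come from angles `θ` with `θ + γ` below, equal to, or above `π`. -/
theorem mem_cl3On_mul_cl3 {j : Set ℝ} (hj : j ⊆ Ioo 0 π) (h0 : 0 < γ) (h1 : γ < π) :
    g ∈ cl3On j * cl3 γ ↔
      ((∃ θ ∈ j, θ + γ < π ∧ θ + γ ≤ ang g) ∧ (-2 ≤ tr g → 0 < skew g)) ∨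
      (π - γ ∈ j ∧ tr g ≤ -2 ∧ (tr g = -2 → skew g = 0)) ∨
      ((∃ θ ∈ j, π < θ + γ ∧ 2 * π - (θ + γ) ≤ ang g) ∧ (-2 ≤ tr g → skew g < 0)) := by
  rw [mem_cl3On_mul]
  constructor
  · rintro ⟨θ, hθ, h⟩
    rcases lt_trichotomy (θ + γ) π with h2 | h2 | h2
    · rw [mem_cl3_mul_cl3_of_lt (hj hθ).1 h0 h2] at h
      exact Or.inl ⟨⟨θ, hθ, h2, h.1⟩, h.2⟩
    · rw [mem_cl3_mul_cl3_of_eq (hj hθ).1 h0 h2] at h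
      exact Or.inr (Or.inl ⟨by rwa [← h2, add_sub_cancel_right], h⟩)
    · rw [mem_cl3_mul_cl3_of_gt (hj hθ).2 h1 h2] at h
      exact Or.inr (Or.inr ⟨⟨θ, hθ, h2, h.1⟩, h.2⟩)
  · rintro (⟨⟨θ, hθ, h2, h3⟩, h4⟩ | ⟨hθ, h⟩ | ⟨⟨θ, hθ, h2, h3⟩, h4⟩)
    · exact ⟨θ, hθ, (mem_cl3_mul_cl3_of_lt (hj hθ).1 h0 h2).2 ⟨h3, h4⟩⟩
    · exact ⟨_, hθ, (mem_cl3_mul_cl3_of_eq (hj hθ).1 h0 (by ring)).2 h⟩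
    · exact ⟨θ, hθ, (mem_cl3_mul_cl3_of_gt (hj hθ).2 h1 h2).2 ⟨h3, h4⟩⟩

theorem ang_le_pi (g : SL2R) : ang g ≤ π := arccos_le_pi _

theorem mem_cl3On_Ioo_mul_cl3 (h0 : 0 < γ) (h1 : γ < π) :
    g ∈ cl3On (Ioo 0 π) * cl3 γ ↔
      (γ < ang g ∧ (-2 ≤ tr g → 0 < skew g)) ∨
      (tr g ≤ -2 ∧ (tr g = -2 → skew g = 0)) ∨
      (π - γ < ang g ∧ (-2 ≤ tr g → skew g < 0)) := by
  have ha := ang_le_pi g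
  rw [mem_cl3On_mul_cl3 le_rfl h0 h1]
  refine or_congr (and_congr_left fun _ => ⟨?_, fun h => ?_⟩)
    (or_congr ?_ (and_congr_left fun _ => ⟨?_, fun h => ?_⟩))
  · rintro ⟨θ, hθ, h2, h3⟩; linarith [hθ.1]
  -- The midpoint of the admissible interval from `0` to `ang g - γ`.
  · exact ⟨(ang g - γ) / 2, ⟨by linarith, by linarith⟩, by linarith, by linarith⟩
  · exact and_iff_right ⟨by linarith, by linarith⟩
  · rintro ⟨θ, hθ, h2, h3⟩; linarith [hθ.2]
  -- The midpoint between the least admissible angle `2 * π - γ - ang g` and `π`.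
  · exact ⟨(3 * π - γ - ang g) / 2, ⟨by linarith, by linarith⟩, by linarith, by linarith⟩

theorem mem_cl3On_Ico_mul_cl3 (hx : 0 < x) (hy : x < π) (h0 : 0 < γ) (h1 : γ < π) :
    g ∈ cl3On (Ico x π) * cl3 γ ↔
      (x + γ < π ∧ x + γ ≤ ang g ∧ (-2 ≤ tr g → 0 < skew g)) ∨
      (x + γ ≤ π ∧ tr g ≤ -2 ∧ (tr g = -2 → skew g = 0)) ∨
      (π - γ < ang g ∧ (-2 ≤ tr g → skew g < 0)) := by
  have ha := ang_le_pi g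
  rw [mem_cl3On_mul_cl3 (fun _ h => ⟨hx.trans_le h.1, h.2⟩) h0 h1, ← and_assoc (a := x + γ < π)]
  refine or_congr (and_congr_left fun _ => ⟨?_, fun h => ?_⟩)
    (or_congr (and_congr_left fun _ => ⟨fun h => ?_, fun h => ?_⟩)
      (and_congr_left fun _ => ⟨?_, fun h => ?_⟩))
  · rintro ⟨θ, hθ, h2, h3⟩; constructor <;> linarith [hθ.1]
  · exact ⟨x, ⟨le_rfl, hy⟩, h⟩
  · linarith [h.1]
  · exact ⟨by linarith, by linarith⟩
  · rintro ⟨θ, hθ, h2, h3⟩; linarith [hθ.2]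
  · have h5 := le_max_right x ((3 * π - γ - ang g) / 2)
    exact ⟨max x ((3 * π - γ - ang g) / 2), ⟨le_max_left _ _, max_lt hy (by linarith)⟩,
      by linarith, by linarith⟩

theorem mem_cl3On_Ioc_mul_cl3 (hx : 0 < x) (hy : x < π) (h0 : 0 < γ) (h1 : γ < π) :
    g ∈ cl3On (Ioc 0 x) * cl3 γ ↔
      (γ < ang g ∧ (-2 ≤ tr g → 0 < skew g)) ∨
      (π ≤ x + γ ∧ tr g ≤ -2 ∧ (tr g = -2 → skew g = 0)) ∨
      (π < x + γ ∧ 2 * π - (x + γ) ≤ ang g ∧ (-2 ≤ tr g → skew g < 0)) := by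
  have ha := ang_le_pi g
  rw [mem_cl3On_mul_cl3 (fun _ h => ⟨h.1, h.2.trans_lt hy⟩) h0 h1, ← and_assoc (a := π < x + γ)]
  refine or_congr (and_congr_left fun _ => ⟨?_, fun h => ?_⟩)
    (or_congr (and_congr_left fun _ => ⟨fun h => ?_, fun h => ?_⟩)
      (and_congr_left fun _ => ⟨?_, fun h => ?_⟩))
  · rintro ⟨θ, hθ, h2, h3⟩; linarith [hθ.1]
  · have h5 := min_le_right x ((ang g - γ) / 2)
    exact ⟨min x ((ang g - γ) / 2), ⟨lt_min hx (by linarith), min_le_left _ _⟩,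
      by linarith, by linarith⟩
  · linarith [h.2]
  · exact ⟨by linarith, by linarith⟩
  · rintro ⟨θ, hθ, h2, h3⟩; constructor <;> linarith [hθ.2]
  · exact ⟨x, ⟨hx, le_rfl⟩, h⟩

/-- When the criterion does not involve `l`, the union over `l` behaves like a single class; the
value `2` is an arbitrary representative. -/
theorem mem_cl4Pos_mul {D : Set SL2R} {p : Prop} (h : ∀ l, 1 < l → (g ∈ cl4 l * D ↔ p)) :
    g ∈ cl4Pos * D ↔ p := by
  simp only [cl4Pos, iUnion_mul, mem_iUnion, mem_Ioi, exists_prop]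
  exact ⟨fun ⟨l, hl, hg⟩ => (h l hl).1 hg, fun hp => ⟨2, one_lt_two, (h 2 one_lt_two).2 hp⟩⟩

theorem mem_cl4Pos_mul_cl2_pos :
    g ∈ cl4Pos * cl2 1 1 ↔ (-2 ≤ tr g → tr g ≤ 2 → 0 < skew g) :=
  mem_cl4Pos_mul fun _ hl => mem_cl4_mul_cl2_pos hl

theorem mem_cl4Pos_mul_cl2_neg :
    g ∈ cl4Pos * cl2 1 (-1) ↔ (-2 ≤ tr g → tr g ≤ 2 → skew g < 0) :=
  mem_cl4Pos_mul fun _ hl => mem_cl4_mul_cl2_neg hl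

theorem mem_cl4Pos_mul_cl3 (h0 : 0 < γ) (h1 : γ < π) :
    g ∈ cl4Pos * cl3 γ ↔ (-2 ≤ tr g → tr g ≤ 2 → 0 < skew g) :=
  mem_cl4Pos_mul fun _ hl => mem_cl4_mul_cl3 hl h0 h1

theorem mem_cl2_neg_mul_cl2_pos : g ∈ cl2 1 (-1) * cl2 1 1 ↔ 2 ≤ tr g := by
  rw [(conjInv_cl2 _ _).mul_comm, mem_cl2_pos_mul_cl2_neg]

theorem mem_cl2_pos_mul_cl3 (h0 : 0 < γ) (h1 : γ < π) :
    g ∈ cl2 1 1 * cl3 γ ↔ γ < ang g ∧ (-2 ≤ tr g → 0 < skew g) := by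
  rw [(conjInv_cl2 _ _).mul_comm, mem_cl3_mul_cl2_pos h0 h1]

theorem mem_cl2_neg_mul_cl3 (h0 : 0 < γ) (h1 : γ < π) :
    g ∈ cl2 1 (-1) * cl3 γ ↔ ang g < γ ∧ (tr g ≤ 2 → 0 < skew g) := by
  rw [(conjInv_cl2 _ _).mul_comm, mem_cl3_mul_cl2_neg h0 h1]

end Arcs

/-! ### Triple products. -/

theorem cl2_pos_pos_pos : cl2 1 1 * cl2 1 1 * cl2 1 1 = {1}ᶜ := by
  ext g
  rw [cl2_pos_mul_cl2_pos]
  simp only [union_mul, mem_union, mem_compl_iff, mem_singleton_iff, eq_one_iff,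
    mem_cl2_pos_mul_cl2_pos, mem_cl3On_Ioo_mul_cl2_pos le_rfl pi_pos le_rfl,
    mem_cl2_neg_one_one_mul, mem_cl2_neg_mul_cl2_pos, mem_cl4Neg_mul, mem_cl4Pos_mul_cl2_pos,
    tr_neg, skew_neg]
  rcases trichotomies g with h | h | h | h | h | h | h | h | h | h <;> grind

theorem cl2_pos_pos_neg : cl2 1 1 * cl2 1 1 * cl2 1 (-1) =
    ({-1} ∪ cl2 (-1) (-1) ∪ cl3On (Ioo π (2 * π)))ᶜ := by
  ext g
  rw [cl2_pos_mul_cl2_pos]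
  simp only [union_mul, mem_union, mem_compl_iff, mem_singleton_iff, eq_neg_one_iff,
    mem_cl2_pos_mul_cl2_neg, mem_cl3On_Ioo_mul_cl2_neg le_rfl pi_pos le_rfl,
    mem_cl2_neg_one_one_mul, mem_cl2_neg_mul_cl2_neg, mem_cl4Neg_mul, mem_cl4Pos_mul_cl2_neg,
    tr_neg, skew_neg, mem_cl2_neg_one_neg_one, mem_cl3On_Ioo_lower le_rfl le_rfl]
  rcases trichotomies g with h | h | h | h | h | h | h | h | h | h <;> grind

theorem cl2_neg_neg_pos : cl2 1 (-1) * cl2 1 (-1) * cl2 1 1 =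
    ({-1} ∪ cl3On (Ioo 0 π) ∪ cl2 (-1) 1)ᶜ := by
  ext g
  rw [cl2_neg_mul_cl2_neg]
  simp only [union_mul, mem_union, mem_compl_iff, mem_singleton_iff, eq_neg_one_iff,
    mem_cl2_neg_mul_cl2_pos, mem_cl3On_Ioo_pi_mul, two_mul, add_sub_cancel_right,
    mem_cl3On_Ioo_mul_cl2_pos le_rfl pi_pos le_rfl,
    mem_cl2_neg_one_neg_one_mul, mem_cl2_pos_mul_cl2_pos, mem_cl4Neg_mul, mem_cl4Pos_mul_cl2_pos,
    tr_neg, skew_neg, ang_neg, mem_cl2_neg_one_one, mem_cl3On_Ioo le_rfl le_rfl]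
  rcases trichotomies g with h | h | h | h | h | h | h | h | h | h <;> grind

theorem cl2_neg_neg_neg : cl2 1 (-1) * cl2 1 (-1) * cl2 1 (-1) = {1}ᶜ := by
  ext g
  rw [cl2_neg_mul_cl2_neg]
  simp only [union_mul, mem_union, mem_compl_iff, mem_singleton_iff, eq_one_iff,
    mem_cl2_neg_mul_cl2_neg, mem_cl3On_Ioo_pi_mul, two_mul, add_sub_cancel_right,
    mem_cl3On_Ioo_mul_cl2_neg le_rfl pi_pos le_rfl,
    mem_cl2_neg_one_neg_one_mul, mem_cl2_pos_mul_cl2_neg, mem_cl4Neg_mul, mem_cl4Pos_mul_cl2_neg,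
    tr_neg, skew_neg, ang_neg]
  rcases trichotomies g with h | h | h | h | h | h | h | h | h | h <;> grind

section OneElliptic
variable {α : ℝ}

theorem cl3_mul_cl2_pos_pos (h0 : 0 < α) (h1 : α < π) :
    cl3 α * cl2 1 1 * cl2 1 1 = ({1} ∪ cl2 1 1 ∪ cl3On (Ioc 0 α))ᶜ := by
  ext g
  rw [cl3_mul_cl2_pos h0 h1]
  simp only [union_mul, mem_union, mem_compl_iff, mem_singleton_iff, eq_one_iff,
    mem_cl3On_Ioo_mul_cl2_pos h0.le h1 le_rfl, mem_cl2_one_one, mem_cl3On_Ioc le_rfl h1,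
    mem_cl2_neg_one_one_mul, mem_cl2_neg_mul_cl2_pos, mem_cl4Neg_mul, mem_cl4Pos_mul_cl2_pos,
    tr_neg, skew_neg]
  rcases trichotomies g with h | h | h | h | h | h | h | h | h | h <;> grind

theorem cl3_mul_cl2_pos_neg (h0 : 0 < α) (h1 : α < π) :
    cl3 α * cl2 1 1 * cl2 1 (-1) = upperFull := by
  ext g
  rw [cl3_mul_cl2_pos h0 h1]
  simp only [union_mul, mem_union, mem_upperFull,
    mem_cl3On_Ioo_mul_cl2_neg h0.le h1 le_rfl,
    mem_cl2_neg_one_one_mul, mem_cl2_neg_mul_cl2_neg, mem_cl4Neg_mul, mem_cl4Pos_mul_cl2_neg,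
    tr_neg, skew_neg]
  rcases trichotomies g with h | h | h | h | h | h | h | h | h | h <;> grind

theorem cl3_mul_cl2_neg_neg (h0 : 0 < α) (h1 : α < π) :
    cl3 α * cl2 1 (-1) * cl2 1 (-1) = ({-1} ∪ cl3On (Ico α π) ∪ cl2 (-1) 1)ᶜ := by
  ext g
  rw [cl3_mul_cl2_neg h0 h1]
  simp only [union_mul, mem_union, mem_compl_iff, mem_singleton_iff, eq_neg_one_iff,
    mem_cl3On_Ioo_mul_cl2_neg le_rfl h0 h1.le, mem_cl2_neg_one_one, mem_cl3On_Ico h0 le_rfl,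
    mem_cl2_pos_mul_cl2_neg, mem_cl4Pos_mul_cl2_neg]
  rcases trichotomies g with h | h | h | h | h | h | h | h | h | h <;> grind

end OneElliptic

section TwoElliptic
variable {α β : ℝ}

theorem cl3_mul_cl3_mul_cl2_pos_of_lt (h0 : 0 < α) (h1 : 0 < β) (h2 : α + β < π) :
    cl3 α * cl3 β * cl2 1 1 = ({1} ∪ cl2 1 1 ∪ cl3On (Ioc 0 (α + β)))ᶜ := by
  ext g
  rw [cl3_mul_cl3_of_lt h0 h1 h2]
  simp only [union_mul, mem_union, mem_compl_iff, mem_singleton_iff, eq_one_iff,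
    mem_cl3On_Ico_mul_cl2_pos (add_pos h0 h1) h2 le_rfl, mem_cl2_one_one,
    mem_cl3On_Ioc le_rfl h2, mem_cl2_neg_one_one_mul, mem_cl2_neg_mul_cl2_pos, mem_cl4Neg_mul,
    mem_cl4Pos_mul_cl2_pos, tr_neg, skew_neg]
  rcases trichotomies g with h | h | h | h | h | h | h | h | h | h <;> grind

theorem cl3_mul_cl3_mul_cl2_pos_of_ge (h0 : 0 < α) (h0' : α < π) (h1 : 0 < β) (h1' : β < π)
    (h2 : π ≤ α + β) : cl3 α * cl3 β * cl2 1 1 = lowerFull := by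
  ext g
  rcases h2.eq_or_lt with h2 | h2
  · rw [cl3_mul_cl3_of_eq h0 h1 h2.symm]
    simp only [union_mul, mem_union, mem_lowerFull, mem_neg_one_mul, mem_cl2_one_one,
      mem_cl4Neg_mul, mem_cl4Pos_mul_cl2_pos, tr_neg, skew_neg]
    rcases trichotomies g with h | h | h | h | h | h | h | h | h | h <;> grind
  · rw [cl3_mul_cl3_of_gt h0' h1' h2]
    simp only [union_mul, mem_union, mem_lowerFull, mem_cl2_neg_one_neg_one_mul,
      mem_cl2_pos_mul_cl2_pos, mem_cl4Neg_mul, mem_cl4Pos_mul_cl2_pos, mem_cl3On_Ioc_pi_mul,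
      mem_cl3On_Ioc_mul_cl2_pos le_rfl (sub_pos.2 h2) (by linarith : α + β - π < π), tr_neg,
      skew_neg, ang_neg]
    rcases trichotomies g with h | h | h | h | h | h | h | h | h | h <;> grind

theorem cl3_mul_cl3_mul_cl2_neg_of_le (h0 : 0 < α) (h1 : 0 < β) (h2 : α + β ≤ π) :
    cl3 α * cl3 β * cl2 1 (-1) = upperFull := by
  ext g
  rcases h2.eq_or_lt with h2 | h2
  · rw [cl3_mul_cl3_of_eq h0 h1 h2]
    simp only [union_mul, mem_union, mem_upperFull, mem_neg_one_mul, mem_cl2_one_neg_one,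
      mem_cl4Neg_mul, mem_cl4Pos_mul_cl2_neg, tr_neg, skew_neg]
    rcases trichotomies g with h | h | h | h | h | h | h | h | h | h <;> grind
  · rw [cl3_mul_cl3_of_lt h0 h1 h2]
    simp only [union_mul, mem_union, mem_upperFull, mem_cl2_neg_one_one_mul,
      mem_cl2_neg_mul_cl2_neg, mem_cl4Neg_mul, mem_cl4Pos_mul_cl2_neg,
      mem_cl3On_Ico_mul_cl2_neg (add_pos h0 h1) h2 le_rfl, tr_neg, skew_neg]
    rcases trichotomies g with h | h | h | h | h | h | h | h | h | h <;> grind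

theorem cl3_mul_cl3_mul_cl2_neg_of_gt (h0 : α < π) (h1 : β < π) (h2 : π < α + β) :
    cl3 α * cl3 β * cl2 1 (-1) =
      ({1} ∪ cl3On (Ico (α + β) (2 * π)) ∪ cl2 1 (-1))ᶜ := by
  ext g
  rw [cl3_mul_cl3_of_gt h0 h1 h2]
  simp only [union_mul, mem_union, mem_compl_iff, mem_singleton_iff, eq_one_iff,
    mem_cl2_neg_one_neg_one_mul, mem_cl2_pos_mul_cl2_neg, mem_cl4Neg_mul, mem_cl4Pos_mul_cl2_neg,
    mem_cl3On_Ioc_pi_mul, mem_cl2_one_neg_one, mem_cl3On_Ico_lower h2 le_rfl,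
    mem_cl3On_Ioc_mul_cl2_neg le_rfl (sub_pos.2 h2) (by linarith : α + β - π < π), tr_neg,
    skew_neg, ang_neg]
  rcases trichotomies g with h | h | h | h | h | h | h | h | h | h <;> grind

end TwoElliptic

section FullSets

/-- `upperFull` and `lowerFull` arise both as products of a hyperbolic class with another class and
as products of three non-hyperbolic classes, so the lemmas of this section serve triple and
quadruple products alike. -/
theorem upperFull_mul_cl2_pos : upperFull * cl2 1 1 = {1}ᶜ := by
  ext g
  simp only [upperFull, union_mul, mem_union, mem_compl_iff, mem_singleton_iff, eq_one_iff,
    mem_cl2_pos_mul_cl2_pos, mem_cl3On_Ioo_mul_cl2_pos le_rfl pi_pos le_rfl,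
    mem_cl2_neg_one_one_mul, mem_cl2_neg_mul_cl2_pos, mem_cl4Neg_mul, mem_cl4Pos_mul_cl2_pos,
    tr_neg, skew_neg]
  rcases trichotomies g with h | h | h | h | h | h | h | h | h | h <;> grind

theorem upperFull_mul_cl2_neg : upperFull * cl2 1 (-1) = {-1}ᶜ := by
  ext g
  simp only [upperFull, union_mul, mem_union, mem_compl_iff, mem_singleton_iff, eq_neg_one_iff,
    mem_cl2_pos_mul_cl2_neg, mem_cl3On_Ioo_mul_cl2_neg le_rfl pi_pos le_rfl,
    mem_cl2_neg_one_one_mul, mem_cl2_neg_mul_cl2_neg, mem_cl4Neg_mul, mem_cl4Pos_mul_cl2_neg,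
    tr_neg, skew_neg]
  rcases trichotomies g with h | h | h | h | h | h | h | h | h | h <;> grind

theorem lowerFull_mul_cl2_pos : lowerFull * cl2 1 1 = {-1}ᶜ := by
  ext g
  simp only [lowerFull, union_mul, mem_union, mem_compl_iff, mem_singleton_iff, eq_neg_one_iff,
    mem_cl2_neg_mul_cl2_pos, mem_cl3On_Ioo_pi_mul, two_mul, add_sub_cancel_right,
    mem_cl3On_Ioo_mul_cl2_pos le_rfl pi_pos le_rfl,
    mem_cl2_neg_one_neg_one_mul, mem_cl2_pos_mul_cl2_pos, mem_cl4Neg_mul, mem_cl4Pos_mul_cl2_pos,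
    tr_neg, skew_neg, ang_neg]
  rcases trichotomies g with h | h | h | h | h | h | h | h | h | h <;> grind

theorem lowerFull_mul_cl2_neg : lowerFull * cl2 1 (-1) = {1}ᶜ := by
  ext g
  simp only [lowerFull, union_mul, mem_union, mem_compl_iff, mem_singleton_iff, eq_one_iff,
    mem_cl2_neg_mul_cl2_neg, mem_cl3On_Ioo_pi_mul, two_mul, add_sub_cancel_right,
    mem_cl3On_Ioo_mul_cl2_neg le_rfl pi_pos le_rfl,
    mem_cl2_neg_one_neg_one_mul, mem_cl2_pos_mul_cl2_neg, mem_cl4Neg_mul, mem_cl4Pos_mul_cl2_neg,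
    tr_neg, skew_neg, ang_neg]
  rcases trichotomies g with h | h | h | h | h | h | h | h | h | h <;> grind

theorem upperFull_mul_cl3 {β : ℝ} (h0 : 0 < β) (h1 : β < π) : upperFull * cl3 β = {1}ᶜ := by
  ext g
  simp only [upperFull, union_mul, mem_union, mem_compl_iff, mem_singleton_iff, eq_one_iff,
    mem_cl2_pos_mul_cl3 h0 h1, mem_cl3On_Ioo_mul_cl3 h0 h1,
    mem_cl2_neg_one_one_mul, mem_cl2_neg_mul_cl3 h0 h1, mem_cl4Neg_mul,
    mem_cl4Pos_mul_cl3 h0 h1, tr_neg, skew_neg, ang_neg]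
  rcases trichotomies g with h | h | h | h | h | h | h | h | h | h <;> grind

theorem lowerFull_mul_cl3 {β : ℝ} (h0 : 0 < β) (h1 : β < π) : lowerFull * cl3 β = {-1}ᶜ := by
  ext g
  simp only [lowerFull, union_mul, mem_union, mem_compl_iff, mem_singleton_iff, eq_neg_one_iff,
    mem_cl2_neg_mul_cl3 h0 h1, mem_cl3On_Ioo_pi_mul, two_mul, add_sub_cancel_right,
    mem_cl3On_Ioo_mul_cl3 h0 h1, mem_cl2_neg_one_neg_one_mul, mem_cl2_pos_mul_cl3 h0 h1,
    mem_cl4Neg_mul, mem_cl4Pos_mul_cl3 h0 h1, tr_neg, skew_neg, ang_neg]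
  rcases trichotomies g with h | h | h | h | h | h | h | h | h | h <;> grind

end FullSets

section ThreeElliptic
variable {α β γ : ℝ}

theorem cl3_mul_cl3_mul_cl3_of_lt_pi (h0 : 0 < α) (h1 : 0 < β) (h2 : 0 < γ)
    (hS : α + β + γ < π) :
    cl3 α * cl3 β * cl3 γ = ({1} ∪ cl2 1 1 ∪ cl3On (Ioo 0 (α + β + γ)))ᶜ := by
  ext g
  have h3 : γ < π := by linarith
  have h4 : α + β < π := by linarith
  rw [cl3_mul_cl3_of_lt h0 h1 h4]
  simp only [union_mul, mem_union, mem_compl_iff, mem_singleton_iff, eq_one_iff,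
    mem_cl3On_Ico_mul_cl3 (add_pos h0 h1) h4 h2 h3, mem_cl2_neg_one_one_mul,
    mem_cl2_neg_mul_cl3 h2 h3, mem_cl4Neg_mul, mem_cl4Pos_mul_cl3 h2 h3, mem_cl2_one_one,
    mem_cl3On_Ioo le_rfl hS.le, tr_neg, skew_neg, ang_neg]
  rcases trichotomies g with h | h | h | h | h | h | h | h | h | h <;> grind

theorem cl3_mul_cl3_mul_cl3_of_eq_pi (h0 : 0 < α) (h1 : 0 < β) (h2 : 0 < γ)
    (hS : α + β + γ = π) : cl3 α * cl3 β * cl3 γ = {-1} ∪ lowerFull := by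
  ext g
  have h3 : γ < π := by linarith
  have h4 : α + β < π := by linarith
  rw [cl3_mul_cl3_of_lt h0 h1 h4]
  simp only [union_mul, mem_union, mem_singleton_iff, eq_neg_one_iff,
    mem_cl3On_Ico_mul_cl3 (add_pos h0 h1) h4 h2 h3, mem_cl2_neg_one_one_mul,
    mem_cl2_neg_mul_cl3 h2 h3, mem_cl4Neg_mul, mem_cl4Pos_mul_cl3 h2 h3, mem_lowerFull,
    tr_neg, skew_neg, ang_neg]
  rcases trichotomies g with h | h | h | h | h | h | h | h | h | h <;> grind

/-- The proof must split on `α + β` against `π`, but the outcome depends only on the total angle: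
`lowerFull` is always present, `1` joins at `2 * π`, and a positively oriented part joins beyond it.
-/
theorem mem_cl3_mul_cl3_mul_cl3_of_gt_pi (h0 : 0 < α) (h0' : α < π) (h1 : 0 < β) (h1' : β < π)
    (h2 : 0 < γ) (h3 : γ < π) (hS : π < α + β + γ) {g : SL2R} :
    g ∈ cl3 α * cl3 β * cl3 γ ↔ g ∈ lowerFull ∨
      (2 * π ≤ α + β + γ ∧ tr g = 2 ∧ skew g = 0) ∨
      (2 * π < α + β + γ ∧ ang g ≤ α + β + γ - 2 * π ∧ (tr g ≤ 2 → 0 < skew g)) := by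
  rcases lt_trichotomy (α + β) π with h4 | h4 | h4
  · rw [cl3_mul_cl3_of_lt h0 h1 h4]
    simp only [union_mul, mem_union,
      mem_cl3On_Ico_mul_cl3 (add_pos h0 h1) h4 h2 h3, mem_cl2_neg_one_one_mul,
      mem_cl2_neg_mul_cl3 h2 h3, mem_cl4Neg_mul, mem_cl4Pos_mul_cl3 h2 h3, mem_lowerFull,
      tr_neg, skew_neg, ang_neg]
    rcases trichotomies g with h | h | h | h | h | h | h | h | h | h <;> grind
  · rw [cl3_mul_cl3_of_eq h0 h1 h4]
    simp only [union_mul, mem_union, mem_neg_one_mul, mem_cl3 h2 h3,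
      mem_cl4Neg_mul, mem_cl4Pos_mul_cl3 h2 h3, mem_lowerFull,
      tr_neg, skew_neg, ang_neg]
    rcases trichotomies g with h | h | h | h | h | h | h | h | h | h <;> grind
  · rw [cl3_mul_cl3_of_gt h0' h1' h4]
    simp only [union_mul, mem_union, mem_cl2_neg_one_neg_one_mul, mem_cl2_pos_mul_cl3 h2 h3,
      mem_cl3On_Ioc_pi_mul,
      mem_cl3On_Ioc_mul_cl3 (sub_pos.2 h4) (by linarith : α + β - π < π) h2 h3,
      mem_cl4Neg_mul, mem_cl4Pos_mul_cl3 h2 h3, mem_lowerFull,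
      tr_neg, skew_neg, ang_neg]
    rcases trichotomies g with h | h | h | h | h | h | h | h | h | h <;> grind

theorem cl3_mul_cl3_mul_cl3_of_lt_two_pi (h0 : 0 < α) (h0' : α < π) (h1 : 0 < β) (h1' : β < π)
    (h2 : 0 < γ) (h3 : γ < π) (hS : π < α + β + γ) (hS' : α + β + γ < 2 * π) :
    cl3 α * cl3 β * cl3 γ = lowerFull := by
  ext g
  rw [mem_cl3_mul_cl3_mul_cl3_of_gt_pi h0 h0' h1 h1' h2 h3 hS]
  grind

theorem cl3_mul_cl3_mul_cl3_of_eq_two_pi (h0 : 0 < α) (h0' : α < π) (h1 : 0 < β) (h1' : β < π)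
    (h2 : 0 < γ) (h3 : γ < π) (hS : α + β + γ = 2 * π) :
    cl3 α * cl3 β * cl3 γ = {1} ∪ lowerFull := by
  ext g
  rw [mem_cl3_mul_cl3_mul_cl3_of_gt_pi h0 h0' h1 h1' h2 h3 (by linarith [pi_pos]), mem_union,
    mem_singleton_iff, eq_one_iff]
  grind

theorem cl3_mul_cl3_mul_cl3_of_gt_two_pi (h0 : 0 < α) (h0' : α < π) (h1 : 0 < β) (h1' : β < π)
    (h2 : 0 < γ) (h3 : γ < π) (hS : 2 * π < α + β + γ) :
    cl3 α * cl3 β * cl3 γ =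
      ({-1} ∪ cl3On (Ioo (α + β + γ - 2 * π) π) ∪ cl2 (-1) 1)ᶜ := by
  ext g
  rw [mem_cl3_mul_cl3_mul_cl3_of_gt_pi h0 h0' h1 h1' h2 h3 (by linarith [pi_pos])]
  simp only [mem_compl_iff, mem_union, mem_singleton_iff, eq_neg_one_iff, mem_cl2_neg_one_one,
    mem_cl3On_Ioo (by linarith : 0 ≤ α + β + γ - 2 * π) le_rfl, mem_lowerFull]
  rcases trichotomies g with h | h | h | h | h | h | h | h | h | h <;> grind

end ThreeElliptic

/-! ### Conjugacy classes contained in `GPlus`. -/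

section Classes

theorem IsClass.conjInv {C : Set SL2R} (hC : IsClass C) : ConjInv C := by
  obtain ⟨A, rfl⟩ := hC
  exact conjInv_conjugatesOf A

theorem IsClass.eq_conjugatesOf {C : Set SL2R} (hC : IsClass C) {A : SL2R} (hA : A ∈ C) :
    conjugatesOf A = C := by
  obtain ⟨B, rfl⟩ := hC
  exact (IsConj.conjugatesOf_eq (mem_conjugatesOf.1 hA)).symm

theorem isClass_cl2 (ε δ : ℤˣ) : IsClass (cl2 ε δ) := by
  rcases Int.units_eq_one_or ε with rfl | rfl
  · exact ⟨_, cl2_one_eq δ⟩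
  · rw [cl2_neg_one_eq, cl2_one_eq, neg_conjugatesOf]
    exact ⟨_, rfl⟩

theorem isClass_cl3 (α : ℝ) : IsClass (cl3 α) := ⟨_, cl3_eq α⟩

theorem isClass_cl4 {l : ℝ} (hl : 1 < l) : IsClass (cl4 l) := ⟨_, cl4_eq (by linarith)⟩

theorem isClass_singleton_one : IsClass {1} :=
  ⟨1, by ext g; rw [mem_conjugatesOf, mem_singleton_iff, isConj_one_right]⟩

theorem mem_GPlus {g : SL2R} :
    g ∈ GPlus ↔ 2 ≤ tr g ∨ (0 < ang g ∧ ang g < π) ∧ 0 < skew g := by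
  rw [GPlus, mem_union, mem_cl4PosBar, mem_cl3On_Ioo le_rfl le_rfl]

theorem IsClass.subset_GPlus_iff {C : Set SL2R} (hC : IsClass C) :
    C ⊆ GPlus ↔ C = {1} ∨ C = cl2 1 1 ∨ C = cl2 1 (-1) ∨
      (∃ α ∈ Ioo 0 π, C = cl3 α) ∨ ∃ l ∈ Ioi (1 : ℝ), C = cl4 l := by
  constructor
  · obtain ⟨A, rfl⟩ := hC
    intro h
    have hA := mem_GPlus.1 (h mem_conjugatesOf_self)
    rcases hA with hA | hA
    · rcases hA.lt_or_eq with h2 | h2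
      · obtain ⟨l, hl, e⟩ := exists_add_inv_eq h2
        exact Or.inr (Or.inr (Or.inr (Or.inr ⟨l, hl,
          (isClass_cl4 hl).eq_conjugatesOf ((mem_cl4 hl).2 e.symm)⟩)))
      · rcases lt_trichotomy (skew A) 0 with h3 | h3 | h3
        · exact Or.inr (Or.inr (Or.inl
            ((isClass_cl2 _ _).eq_conjugatesOf (mem_cl2_one_neg_one.2 ⟨h2.symm, h3⟩))))
        · exact Or.inl (isClass_singleton_one.eq_conjugatesOf ((eq_one_iff A).2 ⟨h2.symm, h3⟩))
        · exact Or.inr (Or.inl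
            ((isClass_cl2 _ _).eq_conjugatesOf (mem_cl2_one_one.2 ⟨h2.symm, h3⟩)))
    · exact Or.inr (Or.inr (Or.inr (Or.inl ⟨ang A, hA.1,
        (isClass_cl3 _).eq_conjugatesOf ((mem_cl3 hA.1.1 hA.1.2).2 ⟨rfl, hA.2⟩)⟩)))
  · rintro (rfl | rfl | rfl | ⟨α, hα, rfl⟩ | ⟨l, hl, rfl⟩) g hg <;> rw [mem_GPlus]
    · rw [mem_singleton_iff.1 hg, tr_one]; exact Or.inl le_rfl
    · exact Or.inl (mem_cl2_one_one.1 hg).1.ge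
    · exact Or.inl (mem_cl2_one_neg_one.1 hg).1.ge
    · obtain ⟨h1, h2⟩ := (mem_cl3 hα.1 hα.2).1 hg
      exact Or.inr ⟨h1 ▸ hα, h2⟩
    · rw [(mem_cl4 hl).1 hg]; exact Or.inl (two_lt_add_inv hl).le

theorem IsNonscalarClass.isClass {C : Set SL2R} (hC : IsNonscalarClass C) : IsClass C := by
  obtain ⟨A, -, -, rfl⟩ := hC
  exact ⟨A, rfl⟩

theorem IsNonscalarClass.conjInv {C : Set SL2R} (hC : IsNonscalarClass C) : ConjInv C :=
  hC.isClass.conjInv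

theorem IsClass.isNonscalarClass {C : Set SL2R} (hC : IsClass C) (h1 : (1 : SL2R) ∉ C)
    (h2 : (-1 : SL2R) ∉ C) : IsNonscalarClass C := by
  obtain ⟨A, rfl⟩ := hC
  refine ⟨A, ?_, ?_, rfl⟩ <;> rintro rfl
  · exact h1 mem_conjugatesOf_self
  · exact h2 mem_conjugatesOf_self

theorem isNonscalarClass_cl2_pos : IsNonscalarClass (cl2 1 1) :=
  (isClass_cl2 _ _).isNonscalarClass (by simp [mem_cl2_one_one]) (by simp [mem_cl2_one_one])

theorem isNonscalarClass_cl2_neg : IsNonscalarClass (cl2 1 (-1)) :=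
  (isClass_cl2 _ _).isNonscalarClass (by simp [mem_cl2_one_neg_one])
    (by simp [mem_cl2_one_neg_one])

theorem isNonscalarClass_cl3 {α : ℝ} (h0 : 0 < α) (h1 : α < π) : IsNonscalarClass (cl3 α) :=
  (isClass_cl3 _).isNonscalarClass (by simp [mem_cl3 h0 h1]) (by simp [mem_cl3 h0 h1])

end Classes

/-! ### Products of four and five arbitrary non-scalar classes. -/

/-- A class of non-scalar matrices contains matrices with every prescribed first row `(x, σ)`,
for a suitable sign `σ`. -/
theorem IsNonscalarClass.exists_entries {C : Set SL2R} (hC : IsNonscalarClass C) :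
    ∃ t σ : ℝ, σ ^ 2 = 1 ∧ ∀ x, ∃ B ∈ C, B 0 0 = x ∧ B 0 1 = σ ∧
      B 1 0 = σ * (x * (t - x) - 1) ∧ B 1 1 = t - x := by
  obtain ⟨A, h1, h2, rfl⟩ := hC
  rcases le_or_gt (skew A) 0 with hw | hw
  · refine ⟨tr A, 1, by norm_num, fun x => ⟨ofEntries x 1 (1 * (x * (tr A - x) - 1)) (tr A - x)
      (by ring), isConj_iff_invariants.2 ⟨by simp [tr], fun h3 h4 => ?_⟩, rfl, rfl, rfl, rfl⟩⟩
    -- Zero `skew` would force trace `2` or `-2` and make `A` scalar. Negative orientation matches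
    -- the choice `σ = 1` for the upper right entry.
    have hw' : skew A < 0 := by
      refine hw.lt_of_ne fun h0 => ?_
      have h5 := four_le A
      have : (tr A - 2) * (tr A + 2) = 0 := by rw [h0] at h5; nlinarith
      rcases mul_eq_zero.1 this with h | h
      · exact h1 ((eq_one_iff A).2 ⟨by linarith, h0⟩)
      · exact h2 ((eq_neg_one_iff A).2 ⟨by linarith, h0⟩)
    rw [_root_.sign_neg hw', _root_.sign_neg]
    apply skew_neg_of_entry_pos
    · simpa [tr] using h3
    · simpa [tr] using h4
    · simp
  · refine ⟨tr A, -1, by norm_num, fun x => ⟨ofEntries x (-1) (-1 * (x * (tr A - x) - 1))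
      (tr A - x) (by ring), isConj_iff_invariants.2 ⟨by simp [tr], fun h3 h4 => ?_⟩,
      rfl, rfl, rfl, rfl⟩⟩
    rw [sign_pos hw, sign_pos]
    apply skew_pos_of_entry_neg
    · simpa [tr] using h3
    · simpa [tr] using h4
    · simp

/-- The quotient `g * B⁻¹` is scalar only if `g` is `B` or `-B`. Choosing `B` in `C` with upper left
entry larger than `|g 0 0|` rules this out. -/
theorem mul_eq_univ {X C : Set SL2R} (hX : {1, -1}ᶜ ⊆ X) (hC : IsNonscalarClass C) :
    X * C = univ := by
  refine eq_univ_of_forall fun g => ?_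
  obtain ⟨t, σ, -, h⟩ := hC.exists_entries
  obtain ⟨B, hB, hB0, -⟩ := h (|g 0 0| + 1)
  refine ⟨g * B⁻¹, hX ?_, B, hB, by simp⟩
  rw [mem_compl_iff, mem_insert_iff, mem_singleton_iff, not_or]
  constructor
  · intro e
    rw [mul_inv_eq_one] at e
    rw [← e] at hB0
    linarith [le_abs_self (g 0 0)]
  · intro e
    rw [mul_inv_eq_iff_eq_mul, neg_one_mul] at e
    have : g 0 0 = -B 0 0 := by rw [e]; simp
    linarith [neg_abs_le (g 0 0)]

/-- Fixing the second factor and varying the entry `x` of the first makes the trace of the product a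
quadratic polynomial in `x` with leading coefficient `1` or `-1`, which cannot stay bounded. -/
theorem exists_hyperbolic {C D : Set SL2R} (hC : IsNonscalarClass C) (hD : IsNonscalarClass D) :
    ∃ h ∈ C * D, 4 < tr h ^ 2 := by
  obtain ⟨t, σ, hσ, hA⟩ := hC.exists_entries
  obtain ⟨s, τ, hτ, hB⟩ := hD.exists_entries
  obtain ⟨B, hBD, hB1, hB2, hB3, hB4⟩ := hB 0
  have key (x : ℝ) : ∃ h ∈ C * D, tr h = σ * τ * (x * (t - x) - 2) + (t - x) * s := by
    obtain ⟨A, hAC, hA1, hA2, hA3, hA4⟩ := hA x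
    refine ⟨A * B, mul_mem_mul hAC hBD, ?_⟩
    rw [tr, mul_zero_zero, mul_one_one, hA1, hA2, hA3, hA4, hB1, hB2, hB3, hB4]
    ring
  have hστ : σ * τ = 1 ∨ σ * τ = -1 := 
    mul_self_eq_one_iff.1 (by rw [← sq, mul_pow, hσ, hτ, one_mul])
  by_contra! hcon
  -- The second difference of the polynomial over `-3, 0, 3` has absolute value `18`, while three
  -- traces in `[-2, 2]` allow at most `8`.
  obtain ⟨h1, m1, e1⟩ := key 3
  obtain ⟨h2, m2, e2⟩ := key 0
  obtain ⟨h3, m3, e3⟩ := key (-3)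
  have b1 := abs_le_of_sq_le_sq' (by linarith [hcon h1 m1] : tr h1 ^ 2 ≤ 2 ^ 2) (by norm_num)
  have b2 := abs_le_of_sq_le_sq' (by linarith [hcon h2 m2] : tr h2 ^ 2 ≤ 2 ^ 2) (by norm_num)
  have b3 := abs_le_of_sq_le_sq' (by linarith [hcon h3 m3] : tr h3 ^ 2 ≤ 2 ^ 2) (by norm_num)
  rcases hστ with e | e <;> rw [e] at e1 e2 e3 <;> linarith

theorem ConjInv.mul {C D : Set SL2R} (hC : ConjInv C) (hD : ConjInv D) : ConjInv (C * D) := by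
  rintro x y hxy ⟨c, hc, d, hd, rfl⟩
  obtain ⟨a, rfl⟩ := isConj_iff.1 hxy
  exact ⟨a * c * a⁻¹, hC (isConj_iff.2 ⟨a, rfl⟩) hc, a * d * a⁻¹,
    hD (isConj_iff.2 ⟨a, rfl⟩) hd, by simp [mul_assoc]⟩

theorem ConjInv.cl4_subset {X : Set SL2R} (hX : ConjInv X) {h : SL2R} (hh : h ∈ X)
    (h4 : 4 < tr h ^ 2) : ∃ l, 1 < l ∧ (cl4 l ⊆ X ∨ cl4 l ⊆ -X) := by
  rcases le_or_gt (tr h) 2 with h2 | h2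
  · have h3 : 2 < tr (-h) := by rw [tr_neg]; nlinarith
    obtain ⟨l, hl, e⟩ := exists_add_inv_eq h3
    refine ⟨l, hl, Or.inr fun x hx => ?_⟩
    rw [← (isClass_cl4 hl).eq_conjugatesOf ((mem_cl4 hl).2 e.symm), mem_conjugatesOf] at hx
    exact Set.mem_neg.2 (hX (by simpa using isConj_neg hx) hh)
  · obtain ⟨l, hl, e⟩ := exists_add_inv_eq h2
    refine ⟨l, hl, Or.inl fun x hx => ?_⟩
    rw [← (isClass_cl4 hl).eq_conjugatesOf ((mem_cl4 hl).2 e.symm), mem_conjugatesOf] at hx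
    exact hX hx hh

/-- Each set contains a hyperbolic class of positive trace or the negative of one. The signs cancel
or leave a global minus, which is harmless because `-g` is non-scalar along with `g`. -/
theorem nonscalar_subset_mul {X Y : Set SL2R} (hX : ConjInv X) (hY : ConjInv Y)
    (h1 : ∃ h ∈ X, 4 < tr h ^ 2) (h2 : ∃ h ∈ Y, 4 < tr h ^ 2) : {1, -1}ᶜ ⊆ X * Y := by
  obtain ⟨h, hh, h4⟩ := h1
  obtain ⟨k, hk, k4⟩ := h2
  obtain ⟨l, hl, hlX⟩ := hX.cl4_subset hh h4
  obtain ⟨m, hm, hmY⟩ := hY.cl4_subset hk k4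
  intro g hg
  rw [mem_compl_iff, mem_insert_iff, mem_singleton_iff, not_or] at hg
  have p := mem_cl4_mul_cl4_of_ne hl hm hg.1 hg.2
  have n := mem_cl4_mul_cl4_of_ne hl hm (g := -g) (by rw [Ne, neg_eq_iff_eq_neg]; exact hg.2)
    (by rw [Ne, neg_inj]; exact hg.1)
  rcases hlX with hlX | hlX <;> rcases hmY with hmY | hmY
  · exact mul_subset_mul hlX hmY p
  · simpa using mul_subset_mul hlX hmY n
  · simpa using mul_subset_mul hlX hmY n
  · simpa using mul_subset_mul hlX hmY p

/-- A product of four non-scalar classes contains all non-scalar matrices. -/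
theorem nonscalar_subset_mul_four {A B C D : Set SL2R} (hA : IsNonscalarClass A)
    (hB : IsNonscalarClass B) (hC : IsNonscalarClass C) (hD : IsNonscalarClass D) :
    {1, -1}ᶜ ⊆ A * B * C * D := by
  rw [mul_assoc (A * B)]
  exact nonscalar_subset_mul (hA.conjInv.mul hB.conjInv) (hC.conjInv.mul hD.conjInv)
    (exists_hyperbolic hA hB) (exists_hyperbolic hC hD)

theorem mul_five_eq_univ {A B C D E : Set SL2R} (hA : IsNonscalarClass A)
    (hB : IsNonscalarClass B) (hC : IsNonscalarClass C) (hD : IsNonscalarClass D)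
    (hE : IsNonscalarClass E) : A * B * C * D * E = univ :=
  mul_eq_univ (nonscalar_subset_mul_four hA hB hC hD) hE

theorem cl4_mul_cl4_mul {l m : ℝ} (hl : 1 < l) (hm : 1 < m) {C : Set SL2R}
    (hC : IsNonscalarClass C) : cl4 l * cl4 m * C = univ := by
  refine mul_eq_univ (fun g hg => ?_) hC
  rw [mem_compl_iff, mem_insert_iff, mem_singleton_iff, not_or] at hg
  exact mem_cl4_mul_cl4_of_ne hl hm hg.1 hg.2

theorem eq_univ_of_subset_of_mem {X : Set SL2R} (h : {1, -1}ᶜ ⊆ X) (h1 : (1 : SL2R) ∈ X)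
    (h2 : (-1 : SL2R) ∈ X) : X = univ := by
  refine eq_univ_of_forall fun g => ?_
  by_cases hg : g ∈ ({1, -1} : Set SL2R)
  · rcases hg with rfl | rfl
    · exact h1
    · exact h2
  · exact h hg

theorem eq_compl_one {X : Set SL2R} (h : {1, -1}ᶜ ⊆ X) (h1 : (1 : SL2R) ∉ X)
    (h2 : (-1 : SL2R) ∈ X) : X = {1}ᶜ := by
  ext g
  rw [mem_compl_singleton_iff]
  refine ⟨fun hg e => h1 (e ▸ hg), fun hg => ?_⟩
  by_cases hg' : g = -1
  · rwa [hg']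
  · exact h (by simp [hg, hg'])

theorem eq_compl_neg_one {X : Set SL2R} (h : {1, -1}ᶜ ⊆ X) (h1 : (1 : SL2R) ∈ X)
    (h2 : (-1 : SL2R) ∉ X) : X = {-1}ᶜ := by
  ext g
  rw [mem_compl_singleton_iff]
  refine ⟨fun hg e => h2 (e ▸ hg), fun hg => ?_⟩
  by_cases hg' : g = 1
  · rwa [hg']
  · exact h (by simp [hg, hg'])

/-- The inverses of the elements of `D` form one class, and `X` contains all or none of it; testing
a single representative suffices. -/
theorem one_mem_mul_iff {X D : Set SL2R} (hX : ConjInv X) (hD : IsClass D) {d : SL2R}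
    (hd : d ∈ D) : (1 : SL2R) ∈ X * D ↔ d⁻¹ ∈ X := by
  constructor
  · rintro ⟨x, hx, c, hc, e⟩
    rw [← hD.eq_conjugatesOf hc, mem_conjugatesOf] at hd
    obtain ⟨a, rfl⟩ := isConj_iff.1 hd
    rw [eq_inv_of_mul_eq_one_left e] at hx
    exact hX (isConj_iff.2 ⟨a, by simp [mul_assoc]⟩) hx
  · intro hx
    exact ⟨_, hx, d, hd, by simp⟩

theorem ConjInv.neg {X : Set SL2R} (hX : ConjInv X) : ConjInv (-X) :=
  fun _ _ h hx => Set.mem_neg.2 (hX (isConj_neg h) hx)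

theorem neg_one_mem_mul_iff {X D : Set SL2R} (hX : ConjInv X) (hD : IsClass D) {d : SL2R}
    (hd : d ∈ D) : (-1 : SL2R) ∈ X * D ↔ -d⁻¹ ∈ X := by
  rw [← Set.mem_neg, ← neg_mul, one_mem_mul_iff hX.neg hD hd, Set.mem_neg]

/-! ### Elliptic triples whose product contains the identity. -/

section EllipticTriples
variable {α β γ : ℝ}

/-- A criterion uniform in the total angle, suited to testing scalars and inverses of
representatives without separating cases. -/
theorem mem_cl3_mul_cl3_mul_cl3 (hα : α ∈ Ioo 0 π) (hβ : β ∈ Ioo 0 π) (hγ : γ ∈ Ioo 0 π)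
    {g : SL2R} :
    g ∈ cl3 α * cl3 β * cl3 γ ↔ (-2 ≤ tr g → tr g ≤ 2 → skew g < 0) ∨
      (α + β + γ ≤ π ∧ tr g = -2 ∧ skew g = 0) ∨
      (α + β + γ < π ∧ α + β + γ ≤ ang g ∧ (-2 ≤ tr g → 0 < skew g)) ∨
      (2 * π ≤ α + β + γ ∧ tr g = 2 ∧ skew g = 0) ∨
      (2 * π < α + β + γ ∧ ang g ≤ α + β + γ - 2 * π ∧ (tr g ≤ 2 → 0 < skew g)) := by
  obtain ⟨a0, a1⟩ := hα
  obtain ⟨b0, b1⟩ := hβ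
  obtain ⟨c0, c1⟩ := hγ
  rcases lt_trichotomy (α + β + γ) π with h1 | h1 | h1
  · rw [cl3_mul_cl3_mul_cl3_of_lt_pi a0 b0 c0 h1]
    simp only [mem_compl_iff, mem_union, mem_singleton_iff, eq_one_iff, mem_cl2_one_one,
      mem_cl3On_Ioo le_rfl h1.le]
    rcases trichotomies g with h | h | h | h | h | h | h | h | h | h <;> grind
  · rw [cl3_mul_cl3_mul_cl3_of_eq_pi a0 b0 c0 h1, mem_union, mem_singleton_iff, eq_neg_one_iff,
      mem_lowerFull]
    grind
  · rw [mem_cl3_mul_cl3_mul_cl3_of_gt_pi a0 a1 b0 b1 c0 c1 h1, mem_lowerFull]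
    grind

theorem ang_one : ang 1 = 0 := by rw [ang, tr_one]; norm_num

theorem one_mem_cl3_mul_cl3_mul_cl3 (hα : α ∈ Ioo 0 π) (hβ : β ∈ Ioo 0 π) (hγ : γ ∈ Ioo 0 π) :
    (1 : SL2R) ∈ cl3 α * cl3 β * cl3 γ ↔ 2 * π ≤ α + β + γ := by
  rw [mem_cl3_mul_cl3_mul_cl3 hα hβ hγ, tr_one, skew_one, ang_one]
  obtain ⟨a0, a1⟩ := hα
  obtain ⟨b0, b1⟩ := hβ
  obtain ⟨c0, c1⟩ := hγ
  grind

theorem neg_one_mem_cl3_mul_cl3_mul_cl3 (hα : α ∈ Ioo 0 π) (hβ : β ∈ Ioo 0 π)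
    (hγ : γ ∈ Ioo 0 π) : (-1 : SL2R) ∈ cl3 α * cl3 β * cl3 γ ↔ α + β + γ ≤ π := by
  rw [mem_cl3_mul_cl3_mul_cl3 hα hβ hγ, tr_neg, skew_neg, ang_neg, tr_one, skew_one, ang_one]
  obtain ⟨a0, a1⟩ := hα
  obtain ⟨b0, b1⟩ := hβ
  obtain ⟨c0, c1⟩ := hγ
  grind

theorem exists_add_pi (h : α ∈ Ioo 0 (2 * π) \ {π}) :
    (α ∈ Ioo 0 π) ∨ ∃ α' ∈ Ioo 0 π, α = α' + π := by
  obtain ⟨⟨h0, h1⟩, h2⟩ := h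
  rcases lt_or_gt_of_ne (show α ≠ π from h2) with h3 | h3
  · exact Or.inl ⟨h0, h3⟩
  · exact Or.inr ⟨α - π, ⟨by linarith, by linarith⟩, by ring⟩

/-- Each angle above `π` gives up a factor `-1` and loses `π`. With `k` such angles, the parity of
`k` decides whether `1` or `-1` is tested, and the thresholds `2 * π` or `π` for the reduced sum
rise by `k * π`. -/
theorem one_mem_elliptic_triple (hα : α ∈ Ioo 0 (2 * π) \ {π}) (hβ : β ∈ Ioo 0 (2 * π) \ {π})
    (hγ : γ ∈ Ioo 0 (2 * π) \ {π}) :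
    (1 : SL2R) ∈ cl3 α * cl3 β * cl3 γ ↔
      (α < π ∧ β < π ∧ γ < π ∧ 2 * π ≤ α + β + γ) ∨
      (((π < α ∧ β < π ∧ γ < π) ∨ (α < π ∧ π < β ∧ γ < π) ∨ (α < π ∧ β < π ∧ π < γ)) ∧
        α + β + γ ≤ 2 * π) ∨
      (((α < π ∧ π < β ∧ π < γ) ∨ (π < α ∧ β < π ∧ π < γ) ∨ (π < α ∧ π < β ∧ γ < π)) ∧
        4 * π ≤ α + β + γ) ∨
      (π < α ∧ π < β ∧ π < γ ∧ α + β + γ ≤ 4 * π) := by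
  rcases exists_add_pi hα with hα' | ⟨α, hα', rfl⟩ <;>
  rcases exists_add_pi hβ with hβ' | ⟨β, hβ', rfl⟩ <;>
  rcases exists_add_pi hγ with hγ' | ⟨γ, hγ', rfl⟩ <;>
  simp only [cl3_add_pi, neg_mul, mul_neg, neg_neg, Set.mem_neg,
    one_mem_cl3_mul_cl3_mul_cl3 hα' hβ' hγ', neg_one_mem_cl3_mul_cl3_mul_cl3 hα' hβ' hγ'] <;>
  rw [mem_Ioo] at hα' hβ' hγ' <;>
  clear hα hβ hγ <;>
  grind

theorem exists_add_two_pi (h : α ∈ Ioo (-π) π \ {0}) :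
    ∃ α' ∈ Ioo 0 (2 * π) \ {π}, cl3 α = cl3 α' ∧
      ((0 < α ∧ α' = α ∧ α' < π) ∨ (α < 0 ∧ α' = α + 2 * π ∧ π < α')) := by
  obtain ⟨⟨h0, h1⟩, h2⟩ := h
  rcases lt_or_gt_of_ne (show α ≠ 0 from h2) with h3 | h3
  · exact ⟨α + 2 * π, ⟨⟨by linarith, by linarith⟩, (by linarith : π < α + 2 * π).ne'⟩,
      (cl3_add_two_pi α).symm, Or.inr ⟨h3, rfl, by linarith⟩⟩
  · exact ⟨α, ⟨⟨h3, by linarith⟩, h1.ne⟩, rfl, Or.inl ⟨h3, rfl, h1⟩⟩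

/-- Adding `2 * π` to each negative angle preserves its class and reduces to the previous
parametrization. -/
theorem one_mem_elliptic_triple_symm (hα : α ∈ Ioo (-π) π \ {0}) (hβ : β ∈ Ioo (-π) π \ {0})
    (hγ : γ ∈ Ioo (-π) π \ {0}) :
    (1 : SL2R) ∈ cl3 α * cl3 β * cl3 γ ↔
      (0 < α ∧ 0 < β ∧ 0 < γ ∧ 2 * π ≤ α + β + γ) ∨
      (((α < 0 ∧ 0 < β ∧ 0 < γ) ∨ (0 < α ∧ β < 0 ∧ 0 < γ) ∨ (0 < α ∧ 0 < β ∧ γ < 0)) ∧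
        α + β + γ ≤ 0) ∨
      (((0 < α ∧ β < 0 ∧ γ < 0) ∨ (α < 0 ∧ 0 < β ∧ γ < 0) ∨ (α < 0 ∧ β < 0 ∧ 0 < γ)) ∧
        0 ≤ α + β + γ) ∨
      (α < 0 ∧ β < 0 ∧ γ < 0 ∧ α + β + γ ≤ -(2 * π)) := by
  obtain ⟨α', hα', e1, h1⟩ := exists_add_two_pi hα
  obtain ⟨β', hβ', e2, h2⟩ := exists_add_two_pi hβ
  obtain ⟨γ', hγ', e3, h3⟩ := exists_add_two_pi hγ
  rw [e1, e2, e3, one_mem_elliptic_triple hα' hβ' hγ']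
  clear e1 e2 e3 hα hβ hγ hα' hβ' hγ'
  rcases h1 with h1 | h1 <;> rcases h2 with h2 | h2 <;> rcases h3 with h3 | h3 <;> grind

end EllipticTriples

/-! ### The exceptional quadruple products. -/

section Quadruples
variable {α β γ δ : ℝ}

theorem lowerUnip_one_mem : lowerUnip 1 ∈ cl2 1 1 := by
  rw [cl2_one_eq]; simpa using mem_conjugatesOf_self

theorem lowerUnip_neg_one_mem : lowerUnip (-1) ∈ cl2 1 (-1) := by
  rw [cl2_one_eq]; simpa using mem_conjugatesOf_self

theorem rot_mem (α : ℝ) : rot α ∈ cl3 α := by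
  rw [cl3_eq]; exact mem_conjugatesOf_self

theorem ang_eq_zero {g : SL2R} (h : tr g = 2) : ang g = 0 := by
  rw [ang, h]; norm_num

theorem cl2_pos_pos_neg_neg :
    cl2 1 1 * cl2 1 1 * cl2 1 (-1) * cl2 1 (-1) = {-1}ᶜ := by
  refine eq_compl_neg_one (nonscalar_subset_mul_four isNonscalarClass_cl2_pos
    isNonscalarClass_cl2_pos isNonscalarClass_cl2_neg isNonscalarClass_cl2_neg) ?_ ?_
  · obtain ⟨h1, h2⟩ := mem_cl2_one_neg_one.1 lowerUnip_neg_one_mem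
    rw [one_mem_mul_iff (((conjInv_cl2 _ _).mul (conjInv_cl2 _ _)).mul (conjInv_cl2 _ _))
      (isClass_cl2 _ _) lowerUnip_neg_one_mem, cl2_pos_pos_neg]
    simp only [mem_compl_iff, mem_union, mem_singleton_iff, eq_neg_one_iff,
      mem_cl2_neg_one_neg_one, mem_cl3On_Ioo_lower le_rfl le_rfl, tr_inv, skew_inv, ang_inv]
    grind
  · obtain ⟨h1, h2⟩ := mem_cl2_one_neg_one.1 lowerUnip_neg_one_mem
    rw [neg_one_mem_mul_iff (((conjInv_cl2 _ _).mul (conjInv_cl2 _ _)).mul (conjInv_cl2 _ _))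
      (isClass_cl2 _ _) lowerUnip_neg_one_mem, cl2_pos_pos_neg, notMem_compl_iff]
    have h3 := ang_eq_zero h1
    simp only [mem_union, mem_singleton_iff, eq_neg_one_iff, ang_neg, tr_neg, skew_neg,
      mem_cl2_neg_one_neg_one, mem_cl3On_Ioo_lower le_rfl le_rfl, tr_inv, skew_inv, ang_inv]
    grind

theorem cl3_mul_cl3_mul_cl3_mul_cl3_subset (hα : α ∈ Ioo 0 π) (hβ : β ∈ Ioo 0 π)
    (hγ : γ ∈ Ioo 0 π) {D : Set SL2R} (hD : IsNonscalarClass D) :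
    {1, -1}ᶜ ⊆ cl3 α * cl3 β * cl3 γ * D :=
  nonscalar_subset_mul_four (isNonscalarClass_cl3 hα.1 hα.2) (isNonscalarClass_cl3 hβ.1 hβ.2)
    (isNonscalarClass_cl3 hγ.1 hγ.2) hD

theorem conjInv_cl3_mul_cl3_mul_cl3 (α β γ : ℝ) : ConjInv (cl3 α * cl3 β * cl3 γ) :=
  ((conjInv_cl3 _).mul (conjInv_cl3 _)).mul (conjInv_cl3 _)

theorem one_mem_cl3_four (hα : α ∈ Ioo 0 π) (hβ : β ∈ Ioo 0 π) (hγ : γ ∈ Ioo 0 π)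
    (hδ : δ ∈ Ioo 0 π) : (1 : SL2R) ∈ cl3 α * cl3 β * cl3 γ * cl3 δ := by
  obtain ⟨h1, h2⟩ := (mem_cl3 hδ.1 hδ.2).1 (rot_mem δ)
  rw [one_mem_mul_iff (conjInv_cl3_mul_cl3_mul_cl3 _ _ _) (isClass_cl3 δ) (rot_mem δ),
    mem_cl3_mul_cl3_mul_cl3 hα hβ hγ, skew_inv]
  -- The inverse of a positively oriented rotation is negatively oriented, hence lies in the part
  -- common to all elliptic triple products.
  exact Or.inl fun _ _ => by linarith

/-- The element to test is `-(rot δ)⁻¹`, positively oriented with angle `π - δ`. The third and fifth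
alternatives of the triple criterion become the two thresholds for the sum of four angles. -/
theorem neg_one_mem_cl3_four (hα : α ∈ Ioo 0 π) (hβ : β ∈ Ioo 0 π) (hγ : γ ∈ Ioo 0 π)
    (hδ : δ ∈ Ioo 0 π) : (-1 : SL2R) ∈ cl3 α * cl3 β * cl3 γ * cl3 δ ↔
      α + β + γ + δ ≤ π ∨ 3 * π ≤ α + β + γ + δ := by
  obtain ⟨h1, h2⟩ := (mem_cl3 hδ.1 hδ.2).1 (rot_mem δ)
  rw [neg_one_mem_mul_iff (conjInv_cl3_mul_cl3_mul_cl3 _ _ _) (isClass_cl3 δ) (rot_mem δ),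
    mem_cl3_mul_cl3_mul_cl3 hα hβ hγ, skew_neg, skew_inv, tr_neg, tr_inv, ang_neg, ang_inv, h1]
  rw [mem_Ioo] at hα hβ hγ hδ
  rcases trichotomies (rot δ) with h | h | h | h | h | h | h | h | h | h <;> grind

theorem cl3_four_of_mid (hα : α ∈ Ioo 0 π) (hβ : β ∈ Ioo 0 π) (hγ : γ ∈ Ioo 0 π)
    (hδ : δ ∈ Ioo 0 π) (h1 : π < α + β + γ + δ) (h2 : α + β + γ + δ < 3 * π) :
    cl3 α * cl3 β * cl3 γ * cl3 δ = {-1}ᶜ := by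
  refine eq_compl_neg_one (cl3_mul_cl3_mul_cl3_mul_cl3_subset hα hβ hγ
    (isNonscalarClass_cl3 hδ.1 hδ.2)) (one_mem_cl3_four hα hβ hγ hδ) ?_
  rw [neg_one_mem_cl3_four hα hβ hγ hδ]
  grind

theorem cl3_four_eq_univ (hα : α ∈ Ioo 0 π) (hβ : β ∈ Ioo 0 π) (hγ : γ ∈ Ioo 0 π)
    (hδ : δ ∈ Ioo 0 π) (h : α + β + γ + δ ≤ π ∨ 3 * π ≤ α + β + γ + δ) :
    cl3 α * cl3 β * cl3 γ * cl3 δ = univ :=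
  eq_univ_of_subset_of_mem (cl3_mul_cl3_mul_cl3_mul_cl3_subset hα hβ hγ
    (isNonscalarClass_cl3 hδ.1 hδ.2)) (one_mem_cl3_four hα hβ hγ hδ)
    ((neg_one_mem_cl3_four hα hβ hγ hδ).2 h)

theorem one_mem_cl3_three_mul_cl2_pos (hα : α ∈ Ioo 0 π) (hβ : β ∈ Ioo 0 π) (hγ : γ ∈ Ioo 0 π) :
    (1 : SL2R) ∈ cl3 α * cl3 β * cl3 γ * cl2 1 1 := by
  obtain ⟨h1, h2⟩ := mem_cl2_one_one.1 lowerUnip_one_mem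
  rw [one_mem_mul_iff (conjInv_cl3_mul_cl3_mul_cl3 _ _ _) (isClass_cl2 _ _) lowerUnip_one_mem,
    mem_cl3_mul_cl3_mul_cl3 hα hβ hγ, skew_inv]
  exact Or.inl fun _ _ => by linarith

/-- The element to test has trace `-2`, angle `π` and positive `skew`. The alternative beyond `2 *
π` would need a sum of at least `3 * π`, which is impossible. -/
theorem neg_one_mem_cl3_three_mul_cl2_pos (hα : α ∈ Ioo 0 π) (hβ : β ∈ Ioo 0 π)
    (hγ : γ ∈ Ioo 0 π) :
    (-1 : SL2R) ∈ cl3 α * cl3 β * cl3 γ * cl2 1 1 ↔ α + β + γ < π := by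
  obtain ⟨h1, h2⟩ := mem_cl2_one_one.1 lowerUnip_one_mem
  have h3 := ang_eq_zero h1
  rw [neg_one_mem_mul_iff (conjInv_cl3_mul_cl3_mul_cl3 _ _ _) (isClass_cl2 _ _)
    lowerUnip_one_mem, mem_cl3_mul_cl3_mul_cl3 hα hβ hγ, skew_neg, skew_inv, tr_neg, tr_inv,
    ang_neg, ang_inv, h1, h3]
  rw [mem_Ioo] at hα hβ hγ
  grind

theorem neg_one_mem_cl3_three_mul_cl2_neg (hα : α ∈ Ioo 0 π) (hβ : β ∈ Ioo 0 π)
    (hγ : γ ∈ Ioo 0 π) : (-1 : SL2R) ∈ cl3 α * cl3 β * cl3 γ * cl2 1 (-1) := by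
  obtain ⟨h1, h2⟩ := mem_cl2_one_neg_one.1 lowerUnip_neg_one_mem
  rw [neg_one_mem_mul_iff (conjInv_cl3_mul_cl3_mul_cl3 _ _ _) (isClass_cl2 _ _)
    lowerUnip_neg_one_mem, mem_cl3_mul_cl3_mul_cl3 hα hβ hγ, skew_neg, skew_inv]
  exact Or.inl fun _ _ => by linarith

theorem one_mem_cl3_three_mul_cl2_neg (hα : α ∈ Ioo 0 π) (hβ : β ∈ Ioo 0 π)
    (hγ : γ ∈ Ioo 0 π) :
    (1 : SL2R) ∈ cl3 α * cl3 β * cl3 γ * cl2 1 (-1) ↔ 2 * π < α + β + γ := by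
  obtain ⟨h1, h2⟩ := mem_cl2_one_neg_one.1 lowerUnip_neg_one_mem
  have h3 := ang_eq_zero h1
  rw [one_mem_mul_iff (conjInv_cl3_mul_cl3_mul_cl3 _ _ _) (isClass_cl2 _ _)
    lowerUnip_neg_one_mem, mem_cl3_mul_cl3_mul_cl3 hα hβ hγ, skew_inv, tr_inv, ang_inv, h1, h3]
  rw [mem_Ioo] at hα hβ hγ
  grind

theorem cl3_three_mul_cl2_pos (hα : α ∈ Ioo 0 π) (hβ : β ∈ Ioo 0 π) (hγ : γ ∈ Ioo 0 π) :
    (α + β + γ < π → cl3 α * cl3 β * cl3 γ * cl2 1 1 = univ) ∧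
    (π ≤ α + β + γ → cl3 α * cl3 β * cl3 γ * cl2 1 1 = {-1}ᶜ) := by
  have hs := cl3_mul_cl3_mul_cl3_mul_cl3_subset hα hβ hγ isNonscalarClass_cl2_pos
  have h1 := one_mem_cl3_three_mul_cl2_pos hα hβ hγ
  have h2 := neg_one_mem_cl3_three_mul_cl2_pos hα hβ hγ
  exact ⟨fun h => eq_univ_of_subset_of_mem hs h1 (h2.2 h),
    fun h => eq_compl_neg_one hs h1 (mt h2.1 (not_lt.2 h))⟩

theorem cl3_three_mul_cl2_neg (hα : α ∈ Ioo 0 π) (hβ : β ∈ Ioo 0 π) (hγ : γ ∈ Ioo 0 π) :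
    (α + β + γ ≤ 2 * π → cl3 α * cl3 β * cl3 γ * cl2 1 (-1) = {1}ᶜ) ∧
    (2 * π < α + β + γ → cl3 α * cl3 β * cl3 γ * cl2 1 (-1) = univ) := by
  have hs := cl3_mul_cl3_mul_cl3_mul_cl3_subset hα hβ hγ isNonscalarClass_cl2_neg
  have h1 := neg_one_mem_cl3_three_mul_cl2_neg hα hβ hγ
  have h2 := one_mem_cl3_three_mul_cl2_neg hα hβ hγ
  exact ⟨fun h => eq_compl_one hs (mt h2.1 (not_lt.2 h)) h1,
    fun h => eq_univ_of_subset_of_mem hs (h2.2 h) h1⟩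

/-- Bringing the elliptic class to the front exposes a triple product equal to `upperFull`. -/
theorem cl2_pos_neg_neg_mul_cl3 (hα : α ∈ Ioo 0 π) :
    cl2 1 1 * cl2 1 (-1) * cl2 1 (-1) * cl3 α = {-1}ᶜ := by
  rw [← (conjInv_cl3 α).mul_comm, ← mul_assoc, ← mul_assoc, cl3_mul_cl2_pos_neg hα.1 hα.2,
    upperFull_mul_cl2_neg]

theorem cl2_pos_pos_neg_mul_cl3 (hα : α ∈ Ioo 0 π) :
    cl2 1 1 * cl2 1 1 * cl2 1 (-1) * cl3 α = {1}ᶜ := by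
  rw [← (conjInv_cl3 α).mul_comm, mul_assoc (cl2 1 1), (conjInv_cl2 1 1).mul_comm, ← mul_assoc,
    ← mul_assoc, cl3_mul_cl2_pos_neg hα.1 hα.2, upperFull_mul_cl2_pos]

theorem cl2_pos_neg_mul_cl3_cl3 (hα : α ∈ Ioo 0 π) (hβ : β ∈ Ioo 0 π) :
    cl2 1 1 * cl2 1 (-1) * cl3 α * cl3 β = {1}ᶜ := by
  rw [← (conjInv_cl3 α).mul_comm, ← mul_assoc, cl3_mul_cl2_pos_neg hα.1 hα.2,
    upperFull_mul_cl3 hβ.1 hβ.2]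

theorem cl2_mul_cl2_mul_cl3_mul_cl3 (ε δ ζ η : ℤˣ) :
    cl2 ε δ * cl2 ζ η * cl3 α * cl3 β = cl3 α * cl3 β * cl2 ε δ * cl2 ζ η := by
  rw [mul_assoc, ((conjInv_cl2 _ _).mul (conjInv_cl2 _ _)).mul_comm, mul_assoc (cl3 α * cl3 β)]

theorem cl2_pos_pos_mul_cl3_cl3 (hα : α ∈ Ioo 0 π) (hβ : β ∈ Ioo 0 π) (h : π ≤ α + β) :
    cl2 1 1 * cl2 1 1 * cl3 α * cl3 β = {-1}ᶜ := by
  rw [cl2_mul_cl2_mul_cl3_mul_cl3,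
    cl3_mul_cl3_mul_cl2_pos_of_ge hα.1 hα.2 hβ.1 hβ.2 h, lowerFull_mul_cl2_pos]

theorem cl2_neg_neg_mul_cl3_cl3 (hα : α ∈ Ioo 0 π) (hβ : β ∈ Ioo 0 π) (h : α + β ≤ π) :
    cl2 1 (-1) * cl2 1 (-1) * cl3 α * cl3 β = {-1}ᶜ := by
  rw [cl2_mul_cl2_mul_cl3_mul_cl3,
    cl3_mul_cl3_mul_cl2_neg_of_le hα.1 hβ.1 h, upperFull_mul_cl2_neg]

theorem cl2_pos_pos_mul_cl3_cl3_eq_univ (hα : α ∈ Ioo 0 π) (hβ : β ∈ Ioo 0 π) (h : α + β < π) :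
    cl2 1 1 * cl2 1 1 * cl3 α * cl3 β = univ := by
  obtain ⟨h1, h2⟩ := mem_cl2_one_one.1 lowerUnip_one_mem
  have hX : ConjInv (cl3 α * cl3 β * cl2 1 1) :=
    ((conjInv_cl3 _).mul (conjInv_cl3 _)).mul (conjInv_cl2 _ _)
  rw [cl2_mul_cl2_mul_cl3_mul_cl3]
  refine eq_univ_of_subset_of_mem (nonscalar_subset_mul_four (isNonscalarClass_cl3 hα.1 hα.2)
    (isNonscalarClass_cl3 hβ.1 hβ.2) isNonscalarClass_cl2_pos isNonscalarClass_cl2_pos) ?_ ?_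
  · rw [one_mem_mul_iff hX (isClass_cl2 _ _) lowerUnip_one_mem,
      cl3_mul_cl3_mul_cl2_pos_of_lt hα.1 hβ.1 h]
    simp only [mem_compl_iff, mem_union, mem_singleton_iff, eq_one_iff, mem_cl2_one_one,
      mem_cl3On_Ioc le_rfl h, tr_inv, skew_inv]
    grind
  · rw [neg_one_mem_mul_iff hX (isClass_cl2 _ _) lowerUnip_one_mem,
      cl3_mul_cl3_mul_cl2_pos_of_lt hα.1 hβ.1 h]
    have h3 := ang_eq_zero h1
    simp only [mem_compl_iff, mem_union, mem_singleton_iff, eq_one_iff, mem_cl2_one_one,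
      mem_cl3On_Ioc le_rfl h, tr_neg, skew_neg, ang_neg, tr_inv, skew_inv, ang_inv]
    grind

theorem cl2_neg_neg_mul_cl3_cl3_eq_univ (hα : α ∈ Ioo 0 π) (hβ : β ∈ Ioo 0 π) (h : π < α + β) :
    cl2 1 (-1) * cl2 1 (-1) * cl3 α * cl3 β = univ := by
  obtain ⟨h1, h2⟩ := mem_cl2_one_neg_one.1 lowerUnip_neg_one_mem
  have hX : ConjInv (cl3 α * cl3 β * cl2 1 (-1)) :=
    ((conjInv_cl3 _).mul (conjInv_cl3 _)).mul (conjInv_cl2 _ _)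
  rw [cl2_mul_cl2_mul_cl3_mul_cl3]
  refine eq_univ_of_subset_of_mem (nonscalar_subset_mul_four (isNonscalarClass_cl3 hα.1 hα.2)
    (isNonscalarClass_cl3 hβ.1 hβ.2) isNonscalarClass_cl2_neg isNonscalarClass_cl2_neg) ?_ ?_
  · rw [one_mem_mul_iff hX (isClass_cl2 _ _) lowerUnip_neg_one_mem,
      cl3_mul_cl3_mul_cl2_neg_of_gt hα.2 hβ.2 h]
    simp only [mem_compl_iff, mem_union, mem_singleton_iff, eq_one_iff, mem_cl2_one_neg_one,
      mem_cl3On_Ico_lower h le_rfl, tr_inv, skew_inv]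
    grind
  · rw [neg_one_mem_mul_iff hX (isClass_cl2 _ _) lowerUnip_neg_one_mem,
      cl3_mul_cl3_mul_cl2_neg_of_gt hα.2 hβ.2 h]
    have h3 := ang_eq_zero h1
    obtain ⟨a0, a1⟩ := hα
    obtain ⟨b0, b1⟩ := hβ
    simp only [mem_compl_iff, mem_union, mem_singleton_iff, eq_one_iff, mem_cl2_one_neg_one,
      mem_cl3On_Ico_lower h le_rfl, tr_neg, skew_neg, ang_neg, tr_inv, skew_inv, ang_inv]
    grind

end Quadruples

/-! ### All remaining quadruples. -/

theorem IsNonscalarClass.cases_of_subset_GPlus {C : Set SL2R} (hC : IsNonscalarClass C)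
    (h : C ⊆ GPlus) : (C = cl2 1 1 ∨ C = cl2 1 (-1) ∨ ∃ α ∈ Ioo 0 π, C = cl3 α) ∨
      ∃ l, 1 < l ∧ C = cl4 l := by
  rcases hC.isClass.subset_GPlus_iff.1 h with h | h | h | h | h
  · obtain ⟨A, h1, -, rfl⟩ := hC
    have hA : A ∈ ({1} : Set SL2R) := h ▸ mem_conjugatesOf_self
    exact absurd hA h1
  · exact Or.inl (Or.inl h)
  · exact Or.inl (Or.inr (Or.inl h))
  · exact Or.inl (Or.inr (Or.inr h))
  · exact Or.inr h

theorem nonscalar_subset_compl_one : ({1, -1}ᶜ : Set SL2R) ⊆ {1}ᶜ :=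
  compl_subset_compl.2 (by simp)

theorem nonscalar_subset_compl_neg_one : ({1, -1}ᶜ : Set SL2R) ⊆ {-1}ᶜ :=
  compl_subset_compl.2 (by simp)

/-- With a hyperbolic factor three classes already reach every non-scalar matrix, so by
`mul_eq_univ` a fourth yields the whole group. -/
theorem nonscalar_subset_cl4_mul_mul {l : ℝ} (hl : 1 < l) {A B : Set SL2R}
    (hA : IsNonscalarClass A) (hB : IsNonscalarClass B) (hA' : A ⊆ GPlus) (hB' : B ⊆ GPlus) :
    {1, -1}ᶜ ⊆ cl4 l * A * B := by
  rcases hB.cases_of_subset_GPlus hB' with hB'' | ⟨m, hm, rfl⟩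
  · rcases hA.cases_of_subset_GPlus hA' with (rfl | rfl | ⟨α, hα, rfl⟩) | ⟨m, hm, rfl⟩
    · rw [cl4_mul_cl2_pos hl]
      rcases hB'' with rfl | rfl | ⟨β, hβ, rfl⟩
      · rw [upperFull_mul_cl2_pos]; exact nonscalar_subset_compl_one
      · rw [upperFull_mul_cl2_neg]; exact nonscalar_subset_compl_neg_one
      · rw [upperFull_mul_cl3 hβ.1 hβ.2]; exact nonscalar_subset_compl_one
    · rw [cl4_mul_cl2_neg hl]
      rcases hB'' with rfl | rfl | ⟨β, hβ, rfl⟩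
      · rw [lowerFull_mul_cl2_pos]; exact nonscalar_subset_compl_neg_one
      · rw [lowerFull_mul_cl2_neg]; exact nonscalar_subset_compl_one
      · rw [lowerFull_mul_cl3 hβ.1 hβ.2]; exact nonscalar_subset_compl_neg_one
    · rw [cl4_mul_cl3 hl hα.1 hα.2]
      rcases hB'' with rfl | rfl | ⟨β, hβ, rfl⟩
      · rw [upperFull_mul_cl2_pos]; exact nonscalar_subset_compl_one
      · rw [upperFull_mul_cl2_neg]; exact nonscalar_subset_compl_neg_one
      · rw [upperFull_mul_cl3 hβ.1 hβ.2]; exact nonscalar_subset_compl_one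
    · rw [cl4_mul_cl4_mul hl hm hB]; exact subset_univ _
  · rw [mul_assoc, hA.conjInv.mul_comm, ← mul_assoc, cl4_mul_cl4_mul hl hm hA]
    exact subset_univ _

theorem prod_eq_of_perm {L M : List (Set SL2R)} (h : L.Perm M)
    (hL : ∀ C ∈ L, IsNonscalarClass C) : L.prod = M.prod :=
  h.prod_eq' (List.pairwise_of_forall_mem_list fun _ hC _ _ => (hL _ hC).conjInv.mul_comm _)

theorem exists_perm_normal_form (L : List (Set SL2R))
    (h : ∀ C ∈ L, C = cl2 1 1 ∨ C = cl2 1 (-1) ∨ ∃ α ∈ Ioo 0 π, C = cl3 α) :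
    ∃ (a b : ℕ) (M : List ℝ), (∀ α ∈ M, α ∈ Ioo 0 π) ∧
      L.Perm (List.replicate a (cl2 1 1) ++ (List.replicate b (cl2 1 (-1)) ++ M.map cl3)) := by
  induction L with
  | nil => exact ⟨0, 0, [], by simp, by simp⟩
  | cons C L ih =>
    obtain ⟨a, b, M, hM, hp⟩ := ih fun D hD => h D (List.mem_cons_of_mem _ hD)
    rcases h C List.mem_cons_self with rfl | rfl | ⟨α, hα, rfl⟩
    · exact ⟨a + 1, b, M, hM, by simpa [List.replicate_succ] using hp⟩
    · refine ⟨a, b + 1, M, hM, (hp.cons _).trans ?_⟩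
      rw [List.replicate_succ, List.cons_append]
      exact List.perm_middle.symm
    · refine ⟨a, b, α :: M, by simpa using ⟨hα, hM⟩, (hp.cons _).trans ?_⟩
      rw [List.map_cons, ← List.append_assoc, ← List.append_assoc]
      exact List.perm_middle.symm

/-- Every distribution of types either is listed, or contains three equal unipotent factors whose
product omits only `1`, or falls on the unlisted side of an angle condition where both scalars are
attained. -/
theorem prod_four_normal_form (a b : ℕ) (M : List ℝ) (hM : ∀ α ∈ M, α ∈ Ioo 0 π)
    (hlen : a + (b + M.length) = 4)
    (h : ¬ IsListed ↑(List.replicate a (cl2 1 1) ++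
      (List.replicate b (cl2 1 (-1)) ++ M.map cl3))) :
    (List.replicate a (cl2 1 1) ++ (List.replicate b (cl2 1 (-1)) ++ M.map cl3)).prod
      = univ := by
  have np := isNonscalarClass_cl2_pos
  have nn := isNonscalarClass_cl2_neg
  match M, hM, hlen, h with
  | [], _, hlen, h =>
    obtain ⟨rfl, rfl⟩ | ⟨rfl, rfl⟩ | ⟨rfl, rfl⟩ | ⟨rfl, rfl⟩ | ⟨rfl, rfl⟩ :
        (a = 4 ∧ b = 0) ∨ (a = 3 ∧ b = 1) ∨ (a = 2 ∧ b = 2) ∨ (a = 1 ∧ b = 3) ∨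
          (a = 0 ∧ b = 4) := by simp at hlen; omega
    · simp only [List.replicate, List.map, List.nil_append, List.cons_append, List.prod_cons,
        List.prod_nil, mul_one]
      rw [← mul_assoc, ← mul_assoc, cl2_pos_pos_pos]
      exact mul_eq_univ nonscalar_subset_compl_one np
    · simp only [List.replicate, List.map, List.nil_append, List.cons_append, List.prod_cons,
        List.prod_nil, mul_one]
      rw [← mul_assoc, ← mul_assoc, cl2_pos_pos_pos]
      exact mul_eq_univ nonscalar_subset_compl_one nn
    · exact absurd (Or.inl rfl) h
    · simp only [List.replicate, List.map, List.nil_append, List.cons_append, List.prod_cons,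
        List.prod_nil, mul_one]
      rw [np.conjInv.mul_comm, ← mul_assoc, cl2_neg_neg_neg]
      exact mul_eq_univ nonscalar_subset_compl_one np
    · simp only [List.replicate, List.map, List.nil_append, List.cons_append, List.prod_cons,
        List.prod_nil, mul_one]
      rw [← mul_assoc, ← mul_assoc, cl2_neg_neg_neg]
      exact mul_eq_univ nonscalar_subset_compl_one nn
  | [α], hM, hlen, h =>
    have hα := hM α (by simp)
    have ne := isNonscalarClass_cl3 hα.1 hα.2
    obtain ⟨rfl, rfl⟩ | ⟨rfl, rfl⟩ | ⟨rfl, rfl⟩ | ⟨rfl, rfl⟩ :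
        (a = 3 ∧ b = 0) ∨ (a = 2 ∧ b = 1) ∨ (a = 1 ∧ b = 2) ∨ (a = 0 ∧ b = 3) := by
      simp at hlen; omega
    · simp only [List.replicate, List.map, List.nil_append, List.cons_append, List.prod_cons,
        List.prod_nil, mul_one]
      rw [← mul_assoc, ← mul_assoc, cl2_pos_pos_pos]
      exact mul_eq_univ nonscalar_subset_compl_one ne
    · exact absurd (Or.inr (Or.inl ⟨α, hα, rfl⟩)) h
    · exact absurd (Or.inr (Or.inr (Or.inl ⟨α, hα, rfl⟩))) h
    · simp only [List.replicate, List.map, List.nil_append, List.cons_append, List.prod_cons,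
        List.prod_nil, mul_one]
      rw [← mul_assoc, ← mul_assoc, cl2_neg_neg_neg]
      exact mul_eq_univ nonscalar_subset_compl_one ne
  | [α, β], hM, hlen, h =>
    have hα := hM α (by simp)
    have hβ := hM β (by simp)
    obtain ⟨rfl, rfl⟩ | ⟨rfl, rfl⟩ | ⟨rfl, rfl⟩ :
        (a = 2 ∧ b = 0) ∨ (a = 1 ∧ b = 1) ∨ (a = 0 ∧ b = 2) := by
      simp at hlen; omega
    · simp only [List.replicate, List.map, List.nil_append, List.cons_append, List.prod_cons,
        List.prod_nil, mul_one]
      rw [← mul_assoc, ← mul_assoc]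
      refine cl2_pos_pos_mul_cl3_cl3_eq_univ hα hβ (not_le.1 fun hle => h ?_)
      exact Or.inr (Or.inr (Or.inr (Or.inr (Or.inl ⟨α, hα, β, hβ, hle, rfl⟩))))
    · exact absurd (Or.inr (Or.inr (Or.inr (Or.inl ⟨α, hα, β, hβ, rfl⟩)))) h
    · simp only [List.replicate, List.map, List.nil_append, List.cons_append, List.prod_cons,
        List.prod_nil, mul_one]
      rw [← mul_assoc, ← mul_assoc]
      refine cl2_neg_neg_mul_cl3_cl3_eq_univ hα hβ (not_le.1 fun hle => h ?_)
      exact Or.inr (Or.inr (Or.inr (Or.inr (Or.inr (Or.inl ⟨α, hα, β, hβ, hle, rfl⟩)))))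
  | [α, β, γ], hM, hlen, h =>
    have hα := hM α (by simp)
    have hβ := hM β (by simp)
    have hγ := hM γ (by simp)
    obtain ⟨rfl, rfl⟩ | ⟨rfl, rfl⟩ : (a = 1 ∧ b = 0) ∨ (a = 0 ∧ b = 1) := by
      simp at hlen; omega
    -- Three elliptic classes with a unipotent one are listed for every angle sum, but with the
    -- unipotent class last, hence the permutation.
    · exact absurd (Or.inr (Or.inr (Or.inr (Or.inr (Or.inr (Or.inr (Or.inr
        ⟨α, hα, β, hβ, γ, hγ, Or.inl (Multiset.coe_eq_coe.2
          (List.perm_append_comm (l₁ := [cl2 1 1]) (l₂ := [cl3 α, cl3 β, cl3 γ])))⟩))))))) h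
    · exact absurd (Or.inr (Or.inr (Or.inr (Or.inr (Or.inr (Or.inr (Or.inr
        ⟨α, hα, β, hβ, γ, hγ, Or.inr (Multiset.coe_eq_coe.2
          (List.perm_append_comm (l₁ := [cl2 1 (-1)]) (l₂ := [cl3 α, cl3 β, cl3 γ])))⟩))))))) h
  | [α, β, γ, δ], hM, hlen, h =>
    have hα := hM α (by simp)
    have hβ := hM β (by simp)
    have hγ := hM γ (by simp)
    have hδ := hM δ (by simp)
    obtain ⟨rfl, rfl⟩ : a = 0 ∧ b = 0 := by simp at hlen; omega
    simp only [List.replicate, List.map, List.nil_append, List.prod_cons,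
      List.prod_nil, mul_one]
    rw [← mul_assoc, ← mul_assoc]
    refine cl3_four_eq_univ hα hβ hγ hδ ?_
    by_contra! hcon
    exact h (Or.inr (Or.inr (Or.inr (Or.inr (Or.inr (Or.inr (Or.inl
      ⟨α, hα, β, hβ, γ, hγ, δ, hδ, hcon.1, hcon.2, rfl⟩)))))))
  | _ :: _ :: _ :: _ :: _ :: _, _, hlen, _ => simp at hlen; omega

theorem mul_four_eq_univ {C₁ C₂ C₃ C₄ : Set SL2R} (h₁ : IsNonscalarClass C₁)
    (h₂ : IsNonscalarClass C₂) (h₃ : IsNonscalarClass C₃) (h₄ : IsNonscalarClass C₄)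
    (g₁ : C₁ ⊆ GPlus) (g₂ : C₂ ⊆ GPlus) (g₃ : C₃ ⊆ GPlus) (g₄ : C₄ ⊆ GPlus)
    (h : ¬ IsListed {C₁, C₂, C₃, C₄}) : C₁ * C₂ * C₃ * C₄ = univ := by
  have hL : ∀ C ∈ [C₁, C₂, C₃, C₄], IsNonscalarClass C ∧ C ⊆ GPlus := by
    simp [h₁, h₂, h₃, h₄, g₁, g₂, g₃, g₄]
  have hprod : C₁ * C₂ * C₃ * C₄ = [C₁, C₂, C₃, C₄].prod := by simp [mul_assoc]
  have hlen : [C₁, C₂, C₃, C₄].length = 4 := rfl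
  -- Viewing the multiset as a list lets permutations act on both the product and the listing
  -- condition.
  change ¬ IsListed ↑[C₁, C₂, C₃, C₄] at h
  rw [hprod]
  generalize [C₁, C₂, C₃, C₄] = L at hL hlen h
  by_cases hyp : ∃ l, 1 < l ∧ cl4 l ∈ L
  -- A hyperbolic factor can be moved to the front because the classes commute; the listing
  -- condition then plays no role.
  · obtain ⟨l, hl, hmem⟩ := hyp
    obtain ⟨s, t, rfl⟩ := List.append_of_mem hmem
    have hp : (s ++ cl4 l :: t).Perm (cl4 l :: (s ++ t)) := List.perm_middle
    rw [prod_eq_of_perm hp fun C hC => (hL C hC).1]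
    have hlen' := hp.length_eq
    rw [hlen, List.length_cons] at hlen'
    obtain ⟨A, B, C, e⟩ := List.length_eq_three.1 (show (s ++ t).length = 3 by omega)
    rw [e] at hp ⊢
    have hA := hL A (hp.mem_iff.2 (by simp))
    have hB := hL B (hp.mem_iff.2 (by simp))
    have hC := hL C (hp.mem_iff.2 (by simp))
    simp only [List.prod_cons, List.prod_nil, mul_one]
    rw [← mul_assoc, ← mul_assoc]
    exact mul_eq_univ (nonscalar_subset_cl4_mul_mul hl hA.1 hB.1 hA.2 hB.2) hC.1
  · have hk : ∀ C ∈ L, C = cl2 1 1 ∨ C = cl2 1 (-1) ∨ ∃ α ∈ Ioo 0 π, C = cl3 α := by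
      intro C hC
      rcases (hL C hC).1.cases_of_subset_GPlus (hL C hC).2 with h5 | ⟨l, hl, rfl⟩
      · exact h5
      · exact absurd ⟨l, hl, hC⟩ hyp
    obtain ⟨a, b, M, hM, hp⟩ := exists_perm_normal_form L hk
    rw [prod_eq_of_perm hp fun C hC => (hL C hC).1]
    rw [Multiset.coe_eq_coe.2 hp] at h
    refine prod_four_normal_form a b M hM ?_ h
    simpa [hlen] using hp.length_eq.symm

end SL2Classes

open SL2Classes
theorem theorem3p1 :
    -- (a) the classes contained in G⁺; the factors of a product may be permuted
    ((∀ C : Set SL2R, IsClass C →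
        (C ⊆ GPlus ↔ C = {1} ∨ C = cl2 1 1 ∨ C = cl2 1 (-1) ∨
          (∃ α ∈ Ioo 0 π, C = cl3 α) ∨ ∃ l ∈ Ioi (1 : ℝ), C = cl4 l)) ∧
      (∀ C D : Set SL2R, IsClass C → IsClass D → C * D = D * C) ∧
      (∀ C : Set SL2R, IsClass C → {1} * C = C)) ∧
    -- (a) double products
    (cl2 1 1 * cl2 1 1 = cl2 1 1 ∪ cl3On (Ioo 0 π) ∪ cl2 (-1) 1 ∪ cl4Neg ∧
      cl2 1 1 * cl2 1 (-1) = cl4PosBar ∧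
      cl2 1 (-1) * cl2 1 (-1) =
        cl4Neg ∪ cl2 (-1) (-1) ∪ cl3On (Ioo π (2 * π)) ∪ cl2 1 (-1) ∧
      (∀ α ∈ Ioo 0 π, cl3 α * cl2 1 1 = cl3On (Ioo α π) ∪ cl2 (-1) 1 ∪ cl4Neg) ∧
      (∀ α ∈ Ioo 0 π, cl3 α * cl2 1 (-1) = cl4Pos ∪ cl2 1 1 ∪ cl3On (Ioo 0 α)) ∧
      (∀ α ∈ Ioo 0 π, ∀ β ∈ Ioo 0 π,
        (α + β < π → cl3 α * cl3 β = cl3On (Ico (α + β) π) ∪ cl2 (-1) 1 ∪ cl4Neg) ∧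
        (α + β = π → cl3 α * cl3 β = {-1} ∪ cl4Neg) ∧
        (π < α + β → cl3 α * cl3 β = cl4Neg ∪ cl2 (-1) (-1) ∪ cl3On (Ioc π (α + β)))) ∧
      (∀ l ∈ Ioi (1 : ℝ), cl4 l * cl2 1 1 = upperFull ∧ cl4 l * cl2 1 (-1) = lowerFull) ∧
      (∀ l ∈ Ioi (1 : ℝ), ∀ α ∈ Ioo 0 π, cl4 l * cl3 α = upperFull) ∧
      (∀ l ∈ Ioi (1 : ℝ), cl4 l * cl4 l = {-1}ᶜ) ∧
      (∀ l ∈ Ioi (1 : ℝ), ∀ m ∈ Ioi (1 : ℝ), l ≠ m → cl4 l * cl4 m = {1, -1}ᶜ)) ∧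
    -- (a) triple products
    (cl2 1 1 * cl2 1 1 * cl2 1 1 = {1}ᶜ ∧
      cl2 1 1 * cl2 1 1 * cl2 1 (-1) =
        ({-1} ∪ cl2 (-1) (-1) ∪ cl3On (Ioo π (2 * π)))ᶜ ∧
      cl2 1 1 * cl2 1 (-1) * cl2 1 (-1) = ({-1} ∪ cl3On (Ioo 0 π) ∪ cl2 (-1) 1)ᶜ ∧
      cl2 1 (-1) * cl2 1 (-1) * cl2 1 (-1) = {1}ᶜ ∧
      (∀ α ∈ Ioo 0 π,
        cl3 α * cl2 1 1 * cl2 1 1 = ({1} ∪ cl2 1 1 ∪ cl3On (Ioc 0 α))ᶜ ∧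
        cl3 α * cl2 1 1 * cl2 1 (-1) = upperFull ∧
        cl3 α * cl2 1 (-1) * cl2 1 (-1) = ({-1} ∪ cl3On (Ico α π) ∪ cl2 (-1) 1)ᶜ) ∧
      (∀ α ∈ Ioo 0 π, ∀ β ∈ Ioo 0 π,
        (α + β < π →
          cl3 α * cl3 β * cl2 1 1 = ({1} ∪ cl2 1 1 ∪ cl3On (Ioc 0 (α + β)))ᶜ) ∧
        (π ≤ α + β → cl3 α * cl3 β * cl2 1 1 = lowerFull) ∧
        (α + β ≤ π → cl3 α * cl3 β * cl2 1 (-1) = upperFull) ∧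
        (π < α + β → cl3 α * cl3 β * cl2 1 (-1) =
          ({1} ∪ cl3On (Ico (α + β) (2 * π)) ∪ cl2 1 (-1))ᶜ)) ∧
      (∀ α ∈ Ioo 0 π, ∀ β ∈ Ioo 0 π, ∀ γ ∈ Ioo 0 π,
        (α + β + γ < π →
          cl3 α * cl3 β * cl3 γ = ({1} ∪ cl2 1 1 ∪ cl3On (Ioo 0 (α + β + γ)))ᶜ) ∧
        (α + β + γ = π → cl3 α * cl3 β * cl3 γ = {-1} ∪ lowerFull) ∧
        (π < α + β + γ ∧ α + β + γ < 2 * π → cl3 α * cl3 β * cl3 γ = lowerFull) ∧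
        (α + β + γ = 2 * π → cl3 α * cl3 β * cl3 γ = {1} ∪ lowerFull) ∧
        (2 * π < α + β + γ → cl3 α * cl3 β * cl3 γ =
          ({-1} ∪ cl3On (Ioo (α + β + γ - 2 * π) π) ∪ cl2 (-1) 1)ᶜ)) ∧
      (∀ l ∈ Ioi (1 : ℝ),
        cl4 l * cl2 1 1 * cl2 1 1 = {1}ᶜ ∧
        cl4 l * cl2 1 1 * cl2 1 (-1) = {-1}ᶜ ∧
        cl4 l * cl2 1 (-1) * cl2 1 (-1) = {1}ᶜ) ∧
      (∀ l ∈ Ioi (1 : ℝ), ∀ α ∈ Ioo 0 π,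
        cl4 l * cl3 α * cl2 1 1 = {1}ᶜ ∧ cl4 l * cl3 α * cl2 1 (-1) = {-1}ᶜ) ∧
      (∀ l ∈ Ioi (1 : ℝ), ∀ α ∈ Ioo 0 π, ∀ β ∈ Ioo 0 π, cl4 l * cl3 α * cl3 β = {1}ᶜ) ∧
      (∀ l ∈ Ioi (1 : ℝ), ∀ m ∈ Ioi (1 : ℝ), ∀ C : Set SL2R, IsNonscalarClass C →
        cl4 l * cl4 m * C = univ)) ∧
    -- (a) the triples of elliptic classes whose product contains I, in two parametrizations
    ((∀ α ∈ Ioo 0 (2 * π) \ {π}, ∀ β ∈ Ioo 0 (2 * π) \ {π}, ∀ γ ∈ Ioo 0 (2 * π) \ {π},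
        ((1 : SL2R) ∈ cl3 α * cl3 β * cl3 γ ↔
          (α < π ∧ β < π ∧ γ < π ∧ 2 * π ≤ α + β + γ) ∨
          (((π < α ∧ β < π ∧ γ < π) ∨ (α < π ∧ π < β ∧ γ < π) ∨ (α < π ∧ β < π ∧ π < γ)) ∧
            α + β + γ ≤ 2 * π) ∨
          (((α < π ∧ π < β ∧ π < γ) ∨ (π < α ∧ β < π ∧ π < γ) ∨ (π < α ∧ π < β ∧ γ < π)) ∧
            4 * π ≤ α + β + γ) ∨
          (π < α ∧ π < β ∧ π < γ ∧ α + β + γ ≤ 4 * π))) ∧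
      (∀ α ∈ Ioo (-π) π \ {0}, ∀ β ∈ Ioo (-π) π \ {0}, ∀ γ ∈ Ioo (-π) π \ {0},
        ((1 : SL2R) ∈ cl3 α * cl3 β * cl3 γ ↔
          (0 < α ∧ 0 < β ∧ 0 < γ ∧ 2 * π ≤ α + β + γ) ∨
          (((α < 0 ∧ 0 < β ∧ 0 < γ) ∨ (0 < α ∧ β < 0 ∧ 0 < γ) ∨ (0 < α ∧ 0 < β ∧ γ < 0)) ∧
            α + β + γ ≤ 0) ∨
          (((0 < α ∧ β < 0 ∧ γ < 0) ∨ (α < 0 ∧ 0 < β ∧ γ < 0) ∨ (α < 0 ∧ β < 0 ∧ 0 < γ)) ∧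
            0 ≤ α + β + γ) ∨
          (α < 0 ∧ β < 0 ∧ γ < 0 ∧ α + β + γ ≤ -(2 * π))))) ∧
    -- (b) quadruple products
    (cl2 1 1 * cl2 1 1 * cl2 1 (-1) * cl2 1 (-1) = {-1}ᶜ ∧
      (∀ α ∈ Ioo 0 π,
        cl2 1 1 * cl2 1 (-1) * cl2 1 (-1) * cl3 α = {-1}ᶜ ∧
        cl2 1 1 * cl2 1 1 * cl2 1 (-1) * cl3 α = {1}ᶜ) ∧
      (∀ α ∈ Ioo 0 π, ∀ β ∈ Ioo 0 π,
        cl2 1 1 * cl2 1 (-1) * cl3 α * cl3 β = {1}ᶜ ∧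
        (π ≤ α + β → cl2 1 1 * cl2 1 1 * cl3 α * cl3 β = {-1}ᶜ) ∧
        (α + β ≤ π → cl2 1 (-1) * cl2 1 (-1) * cl3 α * cl3 β = {-1}ᶜ)) ∧
      (∀ α ∈ Ioo 0 π, ∀ β ∈ Ioo 0 π, ∀ γ ∈ Ioo 0 π, ∀ δ ∈ Ioo 0 π,
        π < α + β + γ + δ → α + β + γ + δ < 3 * π →
        cl3 α * cl3 β * cl3 γ * cl3 δ = {-1}ᶜ) ∧
      (∀ α ∈ Ioo 0 π, ∀ β ∈ Ioo 0 π, ∀ γ ∈ Ioo 0 π,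
        (α + β + γ < π → cl3 α * cl3 β * cl3 γ * cl2 1 1 = univ) ∧
        (π ≤ α + β + γ → cl3 α * cl3 β * cl3 γ * cl2 1 1 = {-1}ᶜ) ∧
        (α + β + γ ≤ 2 * π → cl3 α * cl3 β * cl3 γ * cl2 1 (-1) = {1}ᶜ) ∧
        (2 * π < α + β + γ → cl3 α * cl3 β * cl3 γ * cl2 1 (-1) = univ)) ∧
      (∀ C₁ C₂ C₃ C₄ : Set SL2R,
        IsNonscalarClass C₁ → IsNonscalarClass C₂ → IsNonscalarClass C₃ → IsNonscalarClass C₄ →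
        C₁ ⊆ GPlus → C₂ ⊆ GPlus → C₃ ⊆ GPlus → C₄ ⊆ GPlus →
        ¬ IsListed {C₁, C₂, C₃, C₄} → C₁ * C₂ * C₃ * C₄ = univ)) ∧
    -- (c) products of five classes
    (∀ C₁ C₂ C₃ C₄ C₅ : Set SL2R,
      IsNonscalarClass C₁ → IsNonscalarClass C₂ → IsNonscalarClass C₃ → IsNonscalarClass C₄ →
      IsNonscalarClass C₅ → C₁ * C₂ * C₃ * C₄ * C₅ = univ) := by
  refine ⟨⟨fun C hC => hC.subset_GPlus_iff, fun C D hC _ => hC.conjInv.mul_comm D,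
    fun C _ => by rw [singleton_mul]; simp⟩, ?_, ?_, ?_, ?_, ?_⟩
  · refine ⟨cl2_pos_mul_cl2_pos, cl2_pos_mul_cl2_neg, cl2_neg_mul_cl2_neg,
      fun α hα => cl3_mul_cl2_pos hα.1 hα.2, fun α hα => cl3_mul_cl2_neg hα.1 hα.2,
      fun α hα β hβ => ⟨cl3_mul_cl3_of_lt hα.1 hβ.1, cl3_mul_cl3_of_eq hα.1 hβ.1,
        cl3_mul_cl3_of_gt hα.2 hβ.2⟩,
      fun l hl => ⟨cl4_mul_cl2_pos hl, cl4_mul_cl2_neg hl⟩,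
      fun l hl α hα => cl4_mul_cl3 hl hα.1 hα.2, fun l hl => cl4_mul_self hl,
      fun l hl m hm => cl4_mul_cl4 hl hm⟩
  · refine ⟨cl2_pos_pos_pos, cl2_pos_pos_neg, ?_, cl2_neg_neg_neg,
      fun α hα => ⟨cl3_mul_cl2_pos_pos hα.1 hα.2, cl3_mul_cl2_pos_neg hα.1 hα.2,
        cl3_mul_cl2_neg_neg hα.1 hα.2⟩,
      fun α hα β hβ => ⟨cl3_mul_cl3_mul_cl2_pos_of_lt hα.1 hβ.1,
        cl3_mul_cl3_mul_cl2_pos_of_ge hα.1 hα.2 hβ.1 hβ.2,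
        cl3_mul_cl3_mul_cl2_neg_of_le hα.1 hβ.1,
        cl3_mul_cl3_mul_cl2_neg_of_gt hα.2 hβ.2⟩,
      fun α hα β hβ γ hγ => ⟨cl3_mul_cl3_mul_cl3_of_lt_pi hα.1 hβ.1 hγ.1,
        cl3_mul_cl3_mul_cl3_of_eq_pi hα.1 hβ.1 hγ.1,
        fun h => cl3_mul_cl3_mul_cl3_of_lt_two_pi hα.1 hα.2 hβ.1 hβ.2 hγ.1 hγ.2 h.1 h.2,
        cl3_mul_cl3_mul_cl3_of_eq_two_pi hα.1 hα.2 hβ.1 hβ.2 hγ.1 hγ.2,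
        cl3_mul_cl3_mul_cl3_of_gt_two_pi hα.1 hα.2 hβ.1 hβ.2 hγ.1 hγ.2⟩,
      fun l hl => ?_, fun l hl α hα => ?_, fun l hl α hα β hβ => ?_,
      fun l hl m hm C hC => cl4_mul_cl4_mul hl hm hC⟩
    · rw [mul_assoc, (conjInv_cl2 1 1).mul_comm, cl2_neg_neg_pos]
    · rw [cl4_mul_cl2_pos hl, cl4_mul_cl2_neg hl]
      exact ⟨upperFull_mul_cl2_pos, upperFull_mul_cl2_neg, lowerFull_mul_cl2_neg⟩
    · rw [cl4_mul_cl3 hl hα.1 hα.2]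
      exact ⟨upperFull_mul_cl2_pos, upperFull_mul_cl2_neg⟩
    · rw [cl4_mul_cl3 hl hα.1 hα.2, upperFull_mul_cl3 hβ.1 hβ.2]
  · exact ⟨fun α hα β hβ γ hγ => one_mem_elliptic_triple hα hβ hγ,
      fun α hα β hβ γ hγ => one_mem_elliptic_triple_symm hα hβ hγ⟩
  · refine ⟨cl2_pos_pos_neg_neg,
      fun α hα => ⟨cl2_pos_neg_neg_mul_cl3 hα, cl2_pos_pos_neg_mul_cl3 hα⟩,
      fun α hα β hβ => ⟨cl2_pos_neg_mul_cl3_cl3 hα hβ, cl2_pos_pos_mul_cl3_cl3 hα hβ,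
        cl2_neg_neg_mul_cl3_cl3 hα hβ⟩,
      fun α hα β hβ γ hγ δ hδ => cl3_four_of_mid hα hβ hγ hδ,
      fun α hα β hβ γ hγ => ?_,
      fun C₁ C₂ C₃ C₄ => mul_four_eq_univ⟩
    exact ⟨(cl3_three_mul_cl2_pos hα hβ hγ).1, (cl3_three_mul_cl2_pos hα hβ hγ).2,
      (cl3_three_mul_cl2_neg hα hβ hγ).1, (cl3_three_mul_cl2_neg hα hβ hγ).2⟩
  · exact fun C₁ C₂ C₃ C₄ C₅ => mul_five_eq_univ
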